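/- Let $G$ be a finite group, let $S$ be a noetherian scheme, and let $f:X\to S$ be a separated morphism of finite type. Let $G$ act on $X$ by automorphisms over $S$. Suppose that the orbit of every point of $X$ is contained in an affine open subscheme, and that for some integer $n\ge 1$ the constant group scheme $G_S$ is isomorphic, as a group scheme over $S$, to $\mu_{n,S}$, where $\mu_n={\rm Spec}\,{\mathbb Z}[t]/(1-t^n)$. Let $\iota:X_G\to X$ be the fixed scheme (the closed subscheme representing $T\mapsto X(T)^G$) and let $q:X\to X/G$ be the categorical quotient of $X$ by $G$ in the category of schemes. A Cartier divisor is a (possibly empty) closed subscheme whose ideal sheaf is locally generated by one element which is not a zero divisor. If $G$ acts on a sheaf $F$ of modules, compatibly with the trivial action on the underlying scheme, then $F_0=F^G$ denotes the subsheaf of invariants (the part of degree $0$ of the corresponding ${\mathbb Z}/n{\mathbb Z}$-grading). Let $N_{X_G/X}={\mathcal I}/{\mathcal I}^2$ be the conormal sheaf of $X_G$ in $X$, where ${\mathcal I}$ is the ideal sheaf of $X_G$, with its natural action of $G$. Then: 1. If $n$ is prime and $X_G$ is a Cartier divisor, then $q$ is flat. 2. If $X_G$ is a Cartier divisor, then $(N_{X_G/X})_0=0$.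 3. The morphism $q\circ\iota:X_G\to X/G$ is a closed immersion and there is a set-theoretic equality $q^{-1}(q(X_G))=X_G$. Moreover $(X/G)\setminus q(X_G)$, together with the restriction of $q$, is the categorical quotient of $X\setminus X_G$ by $G$, so that there is a natural isomorphism $(X/G)\setminus q(X_G)\simeq (X\setminus X_G)/G$. 4. Let $U=X\setminus X_G$. If $n$ is prime, then the morphism $\phi:G\times U\to U\times_{U/G}U$, $(g,u)\mapsto(g(u),u)$, is an isomorphism, where $G\times U$ is the disjoint union of copies of $U$ indexed by $G$. 5. Let ${\mathcal M}$ be a $G$-equivariant locally free sheaf of finite rank on $X$. Suppose that $\iota^*{\mathcal M}$ carries the trivial action, that $q$ is flat and that $n$ is prime. Then the natural morphism $q^*\big((q_*{\mathcal M})_0\big)\to{\mathcal M}$ is an isomorphism. 6. If $X\to S$ is smooth and $X_G\to S$ is flat, then $X_G\to S$ is smooth. 7. If $n$ is prime, $X\to S$ is smooth, $X_G$ is a Cartier divisor in $X$ and $X_G\to S$ is flat, then the induced morphism $X/G\to S$ is smooth. -/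

import Mathlib

open CategoryTheory Limits AlgebraicGeometry

universe u v

noncomputable section

namespace EquivariantScheme

/-! ### Group actions on schemes, fixed schemes, quotients -/

section Actions

variable {G : Type v} [Group G] {X Y Z : Scheme.{u}}

/-- A morphism `q : X ⟶ Y` is invariant under the action `ρ` of `G` on `X` (in other words, it is
equivariant for the trivial action on `Y`). -/
def IsInvariant (ρ : G →* Aut X) (q : X ⟶ Y) : Prop :=
  ∀ g : G, (ρ g).hom ≫ q = q

/-- `q : X ⟶ Y` is the categorical quotient of `X` by `G` in the category of schemes: it is
invariant, and every invariant morphism from `X` to a scheme factors uniquely through `q`. -/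
structure IsCategoricalQuotient (ρ : G →* Aut X) (q : X ⟶ Y) : Prop where
  invariant : IsInvariant ρ q
  existsUnique_desc : ∀ (X' : Scheme.{u}) (q' : X ⟶ X'), IsInvariant ρ q' →
    ∃! h : Y ⟶ X', q ≫ h = q'

/-- The closed subscheme `ι : Z ⟶ X` is the fixed scheme of `X`: it represents the functor
sending `T` to the set of `G`-fixed elements of `X(T)`. -/
structure IsFixedScheme (ρ : G →* Aut X) (ι : Z ⟶ X) [IsClosedImmersion ι] : Prop where
  fixed : ∀ g : G, ι ≫ (ρ g).hom = ι
  existsUnique_lift : ∀ (T : Scheme.{u}) (t : T ⟶ X), (∀ g : G, t ≫ (ρ g).hom = t) →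
    ∃! h : T ⟶ Z, h ≫ ι = t

/-- The orbit of every point of `X` is contained in an affine open subscheme. -/
def OrbitsInAffineOpens (ρ : G →* Aut X) : Prop :=
  ∀ x : X, ∃ U : X.Opens, IsAffineOpen U ∧ ∀ g : G, (ρ g).hom x ∈ U

/-- The complement of a closed subscheme. -/
def complement (ι : Z ⟶ X) [IsClosedImmersion ι] : X.Opens :=
  ⟨(Set.range ι)ᶜ, ι.isClosedEmbedding.isClosed_range.isOpen_compl⟩

lemma action_one_hom (ρ : G →* Aut X) : (ρ 1).hom = 𝟙 X := by
  rw [map_one]; rfl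

lemma action_mul_hom (ρ : G →* Aut X) (g h : G) :
    (ρ (g * h)).hom = (ρ h).hom ≫ (ρ g).hom := by
  rw [map_mul]; rfl

lemma action_hom_inv (ρ : G →* Aut X) (g : G) : (ρ g).hom ≫ (ρ g⁻¹).hom = 𝟙 X := by
  rw [← action_mul_hom, inv_mul_cancel, action_one_hom]

lemma action_inv_hom (ρ : G →* Aut X) (g : G) : (ρ g⁻¹).hom ≫ (ρ g).hom = 𝟙 X := by
  rw [← action_mul_hom, mul_inv_cancel, action_one_hom]

lemma complement_le_preimage (ρ : G →* Aut X) (ι : Z ⟶ X) [IsClosedImmersion ι]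
    (hι : IsFixedScheme ρ ι) (g : G) : complement ι ≤ (ρ g).hom ⁻¹ᵁ complement ι := by
  rintro x hx ⟨z, hz⟩
  refine hx ⟨z, ?_⟩
  have hz' : ι z = (ρ g).hom x := hz
  calc ι z = (ι ≫ (ρ g⁻¹).hom) z := by rw [hι.fixed g⁻¹]
    _ = (ρ g⁻¹).hom (ι z) := Scheme.Hom.comp_apply _ _ _
    _ = (ρ g⁻¹).hom ((ρ g).hom x) := by rw [hz']
    _ = ((ρ g).hom ≫ (ρ g⁻¹).hom) x := (Scheme.Hom.comp_apply _ _ _).symm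
    _ = x := by rw [action_hom_inv]; rfl

/-- The action of `G` on a `G`-stable open subscheme `U` of `X`. -/
def restrictAction (ρ : G →* Aut X) (U : X.Opens) (hU : ∀ g : G, U ≤ (ρ g).hom ⁻¹ᵁ U) :
    G →* Aut (U : Scheme.{u}) where
  toFun g :=
    { hom := (ρ g).hom.resLE U U (hU g)
      inv := (ρ g⁻¹).hom.resLE U U (hU g⁻¹)
      hom_inv_id := by
        rw [← cancel_mono U.ι, Category.assoc, Scheme.Hom.resLE_comp_ι,
          Scheme.Hom.resLE_comp_ι_assoc, action_hom_inv, Category.comp_id, Category.id_comp]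
      inv_hom_id := by
        rw [← cancel_mono U.ι, Category.assoc, Scheme.Hom.resLE_comp_ι,
          Scheme.Hom.resLE_comp_ι_assoc, action_inv_hom, Category.comp_id, Category.id_comp] }
  map_one' := by
    refine Iso.ext ?_
    change (ρ 1).hom.resLE U U (hU 1) = 𝟙 (U : Scheme.{u})
    rw [← cancel_mono U.ι, Scheme.Hom.resLE_comp_ι, action_one_hom, Category.comp_id,
      Category.id_comp]
  map_mul' g h := by
    refine Iso.ext ?_
    change (ρ (g * h)).hom.resLE U U (hU _) =
      (ρ h).hom.resLE U U (hU h) ≫ (ρ g).hom.resLE U U (hU g)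
    rw [← cancel_mono U.ι, Category.assoc, Scheme.Hom.resLE_comp_ι, Scheme.Hom.resLE_comp_ι,
      Scheme.Hom.resLE_comp_ι_assoc, action_mul_hom]

/-- The action of `G` on the complement of the fixed scheme. -/
def complementAction (ρ : G →* Aut X) (ι : Z ⟶ X) [IsClosedImmersion ι]
    (hι : IsFixedScheme ρ ι) : G →* Aut (complement ι : Scheme.{u}) :=
  restrictAction ρ (complement ι) (complement_le_preimage ρ ι hι)

/-- For an invariant morphism `r : X ⟶ Y`, the morphism `G × X ⟶ X ×_Y X`, `(g, x) ↦ (g x, x)`.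
Here `G` is the constant group scheme, so that `G × X` is the disjoint union of copies of `X`
indexed by `G`. -/
def torsorMap [Finite G] (ρ : G →* Aut X) (r : X ⟶ Y) (hr : IsInvariant ρ r) :
    (∐ fun _ : G => X) ⟶ pullback r r :=
  Sigma.desc fun g => pullback.lift (ρ g).hom (𝟙 X) (by rw [hr g, Category.id_comp])

/-- A closed subscheme is an (effective) Cartier divisor: locally on `X` its ideal is generated by
one element which is not a zero divisor. The empty subscheme is allowed. -/
def IsCartierDivisor (ι : Z ⟶ X) : Prop :=
  ∀ x : X, ∃ U : X.Opens, IsAffineOpen U ∧ x ∈ U ∧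
    ∃ t ∈ nonZeroDivisors Γ(X, U), RingHom.ker (ι.app U).hom = Ideal.span {t}

end Actions

/-- The constant group scheme `G_S` is isomorphic to the group scheme `μ_n` over `S`. Group
schemes over `S` are given through their functors of points: the `T`-points of `G_S` are the
locally constant functions `T → G`, those of `μ_n` are the `n`-th roots of unity in `Γ(T, 𝒪_T)`. -/
def ConstantGroupIsoMu (G : Type v) [Group G] (n : ℕ) (S : Scheme.{u}) : Prop :=
  ∃ e : ∀ (T : Scheme.{u}) (_ : T ⟶ S), LocallyConstant T G ≃* rootsOfUnity n Γ(T, ⊤),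
    ∀ (T T' : Scheme.{u}) (p : T ⟶ S) (h : T' ⟶ T) (a : LocallyConstant T G),
      (e T' (h ≫ p) (a.comap h.base.hom) : (Γ(T', ⊤))ˣ) =
        Units.map (h.appTop.hom : Γ(T, ⊤) →* Γ(T', ⊤)) (e T p a : (Γ(T, ⊤))ˣ)

/-! ### Equivariant sheaves -/

section Sheaves

open Scheme.Modules hiding pullback

variable {G : Type v} [Group G] {X Y Z : Scheme.{u}}

/-- A `G`-equivariant structure on an `𝒪_X`-module `M`: morphisms `α_g : M ⟶ g_* M` with
`α_1 = id` and `α_{gh} = g_*(α_h) ∘ α_g`. -/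
structure EquivariantStructure (ρ : G →* Aut X) (M : X.Modules) where
  act : ∀ g : G, M ⟶ (pushforward (ρ g).hom).obj M
  act_one : act 1 = (pushforwardId X).inv.app M ≫
    (pushforwardCongr (action_one_hom ρ).symm).hom.app M
  act_mul : ∀ g h : G, act (g * h) =
    act g ≫ (pushforward (ρ g).hom).map (act h) ≫
      (pushforwardComp (ρ h).hom (ρ g).hom).hom.app M ≫
        (pushforwardCongr (action_mul_hom ρ g h).symm).hom.app M

/-- The action of `G` on the direct image `q_* M` along an invariant morphism `q`: on sections over
`V` it is `α_g : M(q⁻¹ V) ⟶ M(g⁻¹ q⁻¹ V) = M(q⁻¹ V)`. -/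
def pushforwardAction {ρ : G →* Aut X} {M : X.Modules} (α : EquivariantStructure ρ M)
    {q : X ⟶ Y} (hq : IsInvariant ρ q) (g : G) :
    (pushforward q).obj M ⟶ (pushforward q).obj M :=
  (pushforward q).map (α.act g) ≫ (pushforwardComp (ρ g).hom q).hom.app M ≫
    (pushforwardCongr (hq g)).hom.app M

/-- The action of `G` on the inverse image `ι^* M` along a morphism `ι` whose image is pointwise
fixed, that is, `g ∘ ι = ι`: the endomorphism of `ι^* M` adjoint to the composition
`M ⟶ g_* M ⟶ g_* ι_* ι^* M = (g ∘ ι)_* ι^* M = ι_* ι^* M`. -/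
def pullbackAction {ρ : G →* Aut X} {M : X.Modules} (α : EquivariantStructure ρ M)
    {ι : Z ⟶ X} (hι : ∀ g : G, ι ≫ (ρ g).hom = ι) (g : G) :
    (Scheme.Modules.pullback ι).obj M ⟶ (Scheme.Modules.pullback ι).obj M :=
  ((pullbackPushforwardAdjunction ι).homEquiv _ _).symm
    (α.act g ≫ (pushforward (ρ g).hom).map ((pullbackPushforwardAdjunction ι).unit.app M) ≫
      (pushforwardComp ι (ρ g).hom).hom.app _ ≫ (pushforwardCongr (hι g)).hom.app _)

/-- The subsheaf of invariants of an `𝒪_X`-module on which `G` acts by the endomorphisms `a g`,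
that is, its part of degree `0` when `G ≃ μ_n`. -/
def invariants [Finite G] {M : X.Modules} (a : G → (M ⟶ M)) : X.Modules :=
  equalizer (Pi.lift a) (Pi.lift fun _ : G => 𝟙 M)

/-- The inclusion of the subsheaf of invariants. -/
def invariantsι [Finite G] {M : X.Modules} (a : G → (M ⟶ M)) : invariants a ⟶ M :=
  equalizer.ι _ _

/-- The natural morphism `q^* (q_* M)_0 ⟶ M`, adjoint to the inclusion `(q_* M)_0 ⟶ q_* M`. -/
def pullbackInvariantsMap [Finite G] {ρ : G →* Aut X} {M : X.Modules}
    (α : EquivariantStructure ρ M) {q : X ⟶ Y} (hq : IsInvariant ρ q) :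
    (Scheme.Modules.pullback q).obj (invariants (pushforwardAction α hq)) ⟶ M :=
  ((pullbackPushforwardAdjunction q).homEquiv _ _).symm (invariantsι (pushforwardAction α hq))

/-- `M` is locally free of finite rank (the rank may vary). -/
def IsLocallyFreeOfFiniteRank (M : X.Modules) : Prop :=
  ∀ x : X, ∃ (U : X.Opens) (_ : x ∈ U) (r : ℕ),
    Nonempty (M.restrict U.ι ≅ (SheafOfModules.free (ULift.{u} (Fin r)) :
      SheafOfModules (U : Scheme.{u}).ringCatSheaf))

/-- The structure sheaf, as a module over itself. -/
def structureModule (X : Scheme.{u}) : X.Modules := SheafOfModules.unit X.ringCatSheaf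

/-- The morphism `𝒪_X ⟶ f_* 𝒪_Z`. -/
def structureMap (f : Z ⟶ X) : structureModule X ⟶ (pushforward f).obj (structureModule Z) :=
  SheafOfModules.unitToPushforwardObjUnit f.toRingCatSheafHom

lemma structureMap_app (f : Z ⟶ X) (U : X.Opens) (s : Γ(X, U)) :
    (structureMap f).app U s = (f.app U s : Γ(Z, f ⁻¹ᵁ U)) := rfl

lemma structureMap_id (k : X ⟶ X) (h : 𝟙 X = k) :
    structureMap k = (pushforwardId X).inv.app (structureModule X) ≫
      (pushforwardCongr h).hom.app (structureModule X) := by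
  subst h
  refine Scheme.Modules.hom_ext _ _ fun U => ?_
  ext s
  change ((𝟙 X : X ⟶ X).app U).hom s = (X.presheaf.map (𝟙 _)).hom s
  rw [Scheme.Hom.id_app, CategoryTheory.Functor.map_id]
  rfl

lemma structureMap_comp {W : Scheme.{u}} (f : Z ⟶ X) (k : X ⟶ W) (m : Z ⟶ W) (h : f ≫ k = m) :
    structureMap m = structureMap k ≫ (pushforward k).map (structureMap f) ≫
      (pushforwardComp f k).hom.app (structureModule Z) ≫
        (pushforwardCongr h).hom.app (structureModule Z) := by
  subst h
  refine Scheme.Modules.hom_ext _ _ fun U => ?_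
  ext s
  change ((f ≫ k).app U).hom s =
    (Z.presheaf.map (𝟙 _)).hom ((f.app (k ⁻¹ᵁ U)).hom ((k.app U).hom s))
  rw [CategoryTheory.Functor.map_id, Scheme.Hom.comp_app]
  rfl

/-- The ideal sheaf of a closed subscheme, as an `𝒪_X`-module. -/
def idealModule (ι : Z ⟶ X) : X.Modules := kernel (structureMap ι)

/-- The inclusion of the ideal sheaf in the structure sheaf. -/
def idealInclusion (ι : Z ⟶ X) : idealModule ι ⟶ structureModule X := kernel.ι (structureMap ι)

instance (ι : Z ⟶ X) : Mono (idealInclusion ι) :=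
  inferInstanceAs (Mono (kernel.ι (structureMap ι)))

lemma idealAct_aux (ι : Z ⟶ X) (k : X ⟶ X) (h : ι ≫ k = ι) :
    (idealInclusion ι ≫ structureMap k) ≫ (pushforward k).map (structureMap ι) = 0 := by
  rw [← cancel_mono ((pushforwardComp ι k).hom.app (structureModule Z) ≫
        (pushforwardCongr h).hom.app (structureModule Z))]
  simp only [Category.assoc]
  rw [← structureMap_comp ι k ι h, zero_comp]
  exact kernel.condition (structureMap ι)

/-- The restriction `I ⟶ k_* I` of `𝒪_X ⟶ k_* 𝒪_X` to the ideal sheaf `I` of a closed subscheme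
which is pointwise fixed by `k`. -/
def idealAct (ι : Z ⟶ X) (k : X ⟶ X) (h : ι ≫ k = ι) :
    idealModule ι ⟶ (pushforward k).obj (idealModule ι) :=
  kernel.lift ((pushforward k).map (structureMap ι)) (idealInclusion ι ≫ structureMap k)
    (idealAct_aux ι k h) ≫ (PreservesKernel.iso (pushforward k) (structureMap ι)).inv

lemma idealAct_inclusion (ι : Z ⟶ X) (k : X ⟶ X) (h : ι ≫ k = ι) :
    idealAct ι k h ≫ (pushforward k).map (idealInclusion ι) =
      idealInclusion ι ≫ structureMap k := by
  have h1 : (PreservesKernel.iso (pushforward k) (structureMap ι)).inv ≫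
      (pushforward k).map (idealInclusion ι) =
        kernel.ι ((pushforward k).map (structureMap ι)) :=
    PreservesKernel.iso_inv_ι (pushforward k) (structureMap ι)
  refine (Category.assoc _ _ _).trans ?_
  refine (congrArg (kernel.lift ((pushforward k).map (structureMap ι))
    (idealInclusion ι ≫ structureMap k) (idealAct_aux ι k h) ≫ ·) h1).trans ?_
  exact kernel.lift_ι _ _ _

lemma idealAct_id (ι : Z ⟶ X) (k : X ⟶ X) (h : ι ≫ k = ι) (hk : 𝟙 X = k) :
    idealAct ι k h = (pushforwardId X).inv.app (idealModule ι) ≫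
      (pushforwardCongr hk).hom.app (idealModule ι) := by
  rw [← cancel_mono ((pushforward k).map (idealInclusion ι)), idealAct_inclusion,
    structureMap_id k hk, Category.assoc]
  have h1 := (pushforwardCongr hk).hom.naturality (idealInclusion ι)
  have h2 := (pushforwardId X).inv.naturality (idealInclusion ι)
  rw [← h1, reassoc_of% h2]

lemma idealAct_comp (ι : Z ⟶ X) (k l m : X ⟶ X) (hk : ι ≫ k = ι) (hl : ι ≫ l = ι)
    (hm : ι ≫ m = ι) (h : l ≫ k = m) :
    idealAct ι m hm = idealAct ι k hk ≫ (pushforward k).map (idealAct ι l hl) ≫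
      (pushforwardComp l k).hom.app (idealModule ι) ≫
        (pushforwardCongr h).hom.app (idealModule ι) := by
  rw [← cancel_mono ((pushforward m).map (idealInclusion ι)), idealAct_inclusion,
    structureMap_comp l k m h]
  simp only [Category.assoc]
  have h1 := (pushforwardCongr h).hom.naturality (idealInclusion ι)
  have h2 := (pushforwardComp l k).hom.naturality (idealInclusion ι)
  rw [← h1, ← reassoc_of% h2, ← reassoc_of% (idealAct_inclusion ι k hk)]
  congr 1
  simp only [← Category.assoc]
  congr 2
  have h3 := congrArg (pushforward k).map (idealAct_inclusion ι l hl)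
  rw [Functor.map_comp, Functor.map_comp] at h3
  exact h3.symm

/-- The `G`-equivariant structure on the ideal sheaf of a closed subscheme which is pointwise fixed
by `G`, induced by the natural one of `𝒪_X`. -/
def idealEquivariant (ρ : G →* Aut X) (ι : Z ⟶ X) (hι : ∀ g : G, ι ≫ (ρ g).hom = ι) :
    EquivariantStructure ρ (idealModule ι) where
  act g := idealAct ι (ρ g).hom (hι g)
  act_one := idealAct_id ι _ _ _
  act_mul _ _ := idealAct_comp ι _ _ _ _ _ _ _

/-- The conormal sheaf `N = I / I² = I ⊗ 𝒪_X / I` of a closed subscheme with ideal sheaf `I`, as a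
module over the structure sheaf of the subscheme. -/
def conormalSheaf (ι : Z ⟶ X) : Z.Modules := (Scheme.Modules.pullback ι).obj (idealModule ι)

/-- The natural action of `G` on the conormal sheaf of a closed subscheme which is pointwise fixed
by `G`. -/
def conormalAction (ρ : G →* Aut X) (ι : Z ⟶ X) (hι : ∀ g : G, ι ≫ (ρ g).hom = ι) (g : G) :
    conormalSheaf ι ⟶ conormalSheaf ι :=
  pullbackAction (idealEquivariant ρ ι hι) hι g

end Sheaves

end EquivariantScheme

end

open EquivariantScheme

/-!
An isomorphism of the constant group `G` with `μ_n` over `S` makes the action tame and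
diagonalizable: `G` is cyclic of order `n`, the integer `n` is invertible on `S`, and there is a
character `χ` of `G` with values in the invertible functions on `S` such that `χ g - 1` is
invertible for every `g ≠ 1` (`ConstantGroupIsoMu.exists_character`). Hence a function, or a section
of an equivariant module, over a stable open subset is a sum of sections of weights `0, …, n - 1`,
those of weight `0` being the invariant ones.

The quotient `q` is geometric, that is, affine with `𝒪_Y` the sheaf of invariants
(`IsCategoricalQuotient.isGeometricQuotient_of_orbits`). Indeed, as orbits lie in affine open
subsets and `f` is separated, prime avoidance provides stable affine neighbourhoods; their
quotients, the spectra of the rings of invariants, are glued, and a geometric quotient is a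
categorical one. All assertions thus become statements about a `G`-ring `A` and its ring of
invariants `A₀`. The ideal of the fixed scheme is the ideal generated by the elements `g a - a`
(`ker_app_eq_fixedIdeal`), which is also the ideal generated by the elements of nonzero weight
(`IsPrimitiveCharacter.fixedIdeal_eq_span`).

For some assertions averaging over `G` is enough. The mean of the translates of a function is an
invariant function with the same restriction to the fixed scheme, so that the fixed scheme is
embedded in the quotient (`IsFixedScheme.isClosedImmersion_comp`); the mean of the translates of a
solution of an infinitesimal lifting problem shows that the fixed scheme is smooth if `X` is
(`formallySmooth_quotient_fixedIdeal`); and the trace of an element of the ideal `I` of the fixed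
scheme belongs to `I²`, as weights add up to `0` only if both or none of them are zero
(`IsPrimitiveCharacter.sum_smul_mem_sq`).

The others, for `n` prime, come from Kummer theory. Where the fixed scheme is a Cartier divisor it
has, locally on the quotient, an equation `t` of nonzero weight, and of weight `1` after replacing
`χ` by a power (`IsGeometricQuotient.exists_isKummer`); away from the fixed points this equation is
invertible. Dividing a function of weight `k` by `t` exactly `k` times one finds that `A = A₀[t] /
(tⁿ - u)` with `u = tⁿ` (`IsPrimitiveCharacter.bijective_adjoinRoot`). So `A` is free over `A₀`;
smoothness descends from `A` to `A₀` (`formallySmooth_of_adjoinRoot`); and if `t` is invertible then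
`A` is a torsor over `A₀`, by the orthogonality relations
(`IsPrimitiveCharacter.bijective_torsorHom`).

An equivariant locally free module `M` has, locally on the quotient, bases of invariant sections.
Near a fixed point these are the traces of the members of a basis, as `G` acts trivially on the
fibre of `M`; elsewhere sections of arbitrary weight are divided by powers of the invertible
function `t`. The coordinates in such a basis of an invariant section are functions on the quotient,
which determines `q^* (q_* M)^G` (`IsGeometricQuotient.bijective_pullbackInvariantsMap_app`).
-/

namespace EquivariantScheme

/-! ### The ideal of the fixed scheme and formal smoothness -/

section Algebra

/-- A multiplicative character `χ` of `G` with values in the invariants of a `G`-ring `A`, all of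
whose nontrivial values stay different from `1` at every point of `Spec A`. If `G` has order `n` and
`n` is invertible in the ring of invariants, then this is an isomorphism of the constant group
scheme `G` with `μ_n` over that ring. -/
structure IsPrimitiveCharacter {G A : Type*} [Group G] [CommRing A] [MulSemiringAction G A]
    (χ : G →* A) : Prop where
  smul_apply : ∀ g h : G, g • χ h = χ h
  isUnit_sub_one : ∀ g : G, g ≠ 1 → IsUnit (χ g - 1)

/-- The ideal of a `G`-ring `A` generated by the elements `g a - a`: the ideal of the fixed scheme
of `Spec A`. -/
def fixedIdeal (G A : Type*) [Group G] [CommRing A] [MulSemiringAction G A] : Ideal A :=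
  Ideal.span {x | ∃ (g : G) (a : A), x = g • a - a}

variable {G A : Type*} [Group G] [CommRing A] [MulSemiringAction G A]

lemma smul_sub_mem_fixedIdeal (g : G) (a : A) : g • a - a ∈ fixedIdeal G A :=
  Ideal.subset_span ⟨g, a, rfl⟩

lemma smul_natCast' (g : G) (n : ℕ) : g • (n : A) = n := by
  rw [← MulSemiringAction.toRingHom_apply G A g, map_natCast]

lemma smul_eq_self_of_natCast_mul_eq_one {n : ℕ} {c : A} (hc : (n : A) * c = 1) (g : G) :
    g • c = c := by
  have h1 : (n : A) * (g • c) = 1 := by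
    have h2 : g • ((n : A) * c) = g • (1 : A) := by rw [hc]
    rwa [smul_mul', smul_one, smul_natCast'] at h2
  calc g • c = ((n : A) * c) * (g • c) := by rw [hc, one_mul]
    _ = c := by rw [mul_comm (n : A) c, mul_assoc, h1, mul_one]

/-- Modulo the ideal of the fixed scheme every element is equal to the mean of its translates, which
is invariant. -/
lemma exists_invariant_sub_mem_fixedIdeal [Finite G] (h : IsUnit (Nat.card G : A)) (a : A) :
    ∃ b : A, (∀ g : G, g • b = b) ∧ b - a ∈ fixedIdeal G A := by
  classical
  have := Fintype.ofFinite G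
  obtain ⟨c, hc⟩ := h.exists_right_inv
  refine ⟨c * ∑ g : G, g • a, fun g => ?_, ?_⟩
  · rw [smul_mul', smul_eq_self_of_natCast_mul_eq_one hc, Finset.smul_sum]
    congr 1
    simp_rw [smul_smul]
    exact Fintype.sum_equiv (Equiv.mulLeft g) _ _ fun _ => rfl
  · have : c * ∑ g : G, g • a - a = c * ∑ g : G, (g • a - a) := by
      rw [Finset.sum_sub_distrib, mul_sub, Finset.sum_const, Finset.card_univ,
        ← Nat.card_eq_fintype_card, nsmul_eq_mul, ← mul_assoc, mul_comm c (Nat.card G : A), hc,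
        one_mul]
    rw [this]
    exact Ideal.mul_mem_left _ _ (Ideal.sum_mem _ fun g _ => smul_sub_mem_fixedIdeal g a)

/-- If `A` is formally smooth over `R` and the order of `G` is invertible in `A`, then so is the
ring of functions on the fixed scheme of `Spec A`: over a square-zero extension the mean of the
translates of a lift of an invariant homomorphism is again a homomorphism, and it is invariant. -/
theorem formallySmooth_quotient_fixedIdeal {R A : Type*} [CommRing R] [CommRing A]
    [Algebra R A] [MulSemiringAction G A] [SMulCommClass G R A] [Finite G]
    (h : IsUnit (Nat.card G : A)) [Algebra.FormallySmooth R A] :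
    Algebra.FormallySmooth R (A ⧸ fixedIdeal G A) := by
  classical
  have := Fintype.ofFinite G
  refine Algebra.FormallySmooth.of_comp_surjective fun B _ _ I hI φ => ?_
  obtain ⟨s, hs⟩ := Algebra.FormallySmooth.comp_surjective R A I hI
    (φ.comp (Ideal.Quotient.mkₐ R (fixedIdeal G A)))
  obtain ⟨c, hc⟩ : ∃ c : B, (Nat.card G : B) * c = 1 := by
    have := (h.map s).exists_right_inv
    simpa using this
  have hc' : ∀ x : B, c * ((Nat.card G : B) * x) = x := fun x => by
    rw [← mul_assoc, mul_comm c, hc, one_mul]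
  have hsa : ∀ a, Ideal.Quotient.mk I (s a) = φ (Ideal.Quotient.mk _ a) := fun a =>
    DFunLike.congr_fun hs a
  have hsg : ∀ (g : G) a, s (g • a) - s a ∈ I := fun g a => by
    rw [← Ideal.Quotient.eq, hsa, hsa]
    congr 1
    rw [Ideal.Quotient.eq]
    exact smul_sub_mem_fixedIdeal g a
  -- the mean of the translates of the lift `s`, which differ from `s` by elements of `I`
  let m : A → B := fun a => c * ∑ g : G, s (g • a)
  have hm : ∀ a, m a - s a ∈ I := fun a => by
    have : m a - s a = c * ∑ g : G, (s (g • a) - s a) := by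
      rw [Finset.sum_sub_distrib, mul_sub, Finset.sum_const, Finset.card_univ,
        ← Nat.card_eq_fintype_card, nsmul_eq_mul, hc']
    rw [this]
    exact Ideal.mul_mem_left _ _ (Ideal.sum_mem _ fun g _ => hsg g a)
  have hI2 : ∀ x ∈ I, ∀ y ∈ I, x * y = 0 := fun x hx y hy => by
    have : x * y ∈ I ^ 2 := by rw [pow_two]; exact Ideal.mul_mem_mul hx hy
    rwa [hI] at this
  have hmg : ∀ (g : G) a, s (g • a) - m a ∈ I := fun g a => by
    have := I.sub_mem (hsg g a) (hm a)
    simpa using this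
  have hsum : ∀ a, ∑ g : G, (s (g • a) - m a) = 0 := fun a => by
    rw [Finset.sum_sub_distrib, Finset.sum_const, Finset.card_univ,
        ← Nat.card_eq_fintype_card, nsmul_eq_mul, ← mul_assoc, hc, one_mul, sub_self]
  let m' : A →ₐ[R] B :=
    { toFun := m
      map_one' := by
        simp only [m, smul_one, map_one, Finset.sum_const, Finset.card_univ, nsmul_eq_mul]
        rw [← Nat.card_eq_fintype_card, hc']
      map_zero' := by simp [m]
      map_add' := fun a b => by simp [m, Finset.sum_add_distrib, mul_add]
      map_mul' := fun a b => by
        -- In `s (g a) s (g b)` the product of the two deviations from the means lies in `I² = 0`,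
        -- and the deviations themselves have sum zero over `G`.
        have h1 : ∀ g : G, s (g • (a * b)) = m a * m b + m a * (s (g • b) - m b) +
            (s (g • a) - m a) * m b := fun g => by
          have h2 := hI2 _ (hmg g a) _ (hmg g b)
          rw [smul_mul', map_mul]
          linear_combination h2
        change c * ∑ g : G, s (g • (a * b)) = m a * m b
        simp only [h1, Finset.sum_add_distrib, ← Finset.mul_sum, ← Finset.sum_mul, hsum, mul_zero,
          zero_mul, add_zero, Finset.sum_const, Finset.card_univ, nsmul_eq_mul]
        rw [← Nat.card_eq_fintype_card, mul_left_comm (m a), hc']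
      commutes' := fun r => by
        simp only [m, smul_algebraMap, AlgHom.commutes, Finset.sum_const, Finset.card_univ,
          nsmul_eq_mul]
        rw [← Nat.card_eq_fintype_card, hc'] }
  have hker : ∀ a ∈ fixedIdeal G A, m' a = 0 := by
    have : fixedIdeal G A ≤ RingHom.ker m' := by
      refine Ideal.span_le.mpr ?_
      rintro _ ⟨g, a, rfl⟩
      change m' (g • a - a) = 0
      rw [map_sub, sub_eq_zero]
      change c * ∑ h : G, s (h • g • a) = c * ∑ h : G, s (h • a)
      congr 1
      simp_rw [smul_smul]
      exact Fintype.sum_equiv (Equiv.mulRight g) _ _ fun _ => rfl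
    exact this
  refine ⟨Ideal.Quotient.liftₐ _ m' hker, ?_⟩
  refine Ideal.Quotient.algHom_ext _ (AlgHom.ext fun a => ?_)
  change Ideal.Quotient.mk I (m a) = φ (Ideal.Quotient.mk _ a)
  rw [← hsa, Ideal.Quotient.eq]
  exact hm a

/-- Descent of formal smoothness along `A ⟶ A[t]/(tⁿ - u)`: given a lifting problem for `A`, solve
the one it induces for `A[t]/(tⁿ - u)`, and take the constant coefficient of the solution. -/
theorem formallySmooth_of_adjoinRoot {R A : Type*} [CommRing R] [CommRing A] [Algebra R A]
    (n : ℕ) (hn : n ≠ 0) (u : A)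
    [Algebra.FormallySmooth R (AdjoinRoot (Polynomial.X ^ n - Polynomial.C u))] :
    Algebra.FormallySmooth R A := by
  refine Algebra.FormallySmooth.of_comp_surjective fun B _ _ I hI φ => ?_
  -- With `w` a lift of `φ u`, the homomorphism `φ` extends to a homomorphism `φ'` from `A[t]/(tⁿ -
  -- u)` to the quotient of `B[t]/(tⁿ - w)` by the square-zero ideal `J` generated by `I`.
  obtain ⟨w, hw⟩ := Ideal.Quotient.mk_surjective (φ u)
  set p : Polynomial B := Polynomial.X ^ n - Polynomial.C w with hp
  have hpm : p.Monic := Polynomial.monic_X_pow_sub_C w hn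
  let J : Ideal (AdjoinRoot p) := I.map (algebraMap B (AdjoinRoot p))
  have hJ : J ^ 2 = ⊥ := by rw [← Ideal.map_pow, hI, Ideal.map_bot]
  let ψ : (B ⧸ I) →ₐ[R] (AdjoinRoot p ⧸ J) := Ideal.quotientMapₐ J
    (IsScalarTower.toAlgHom R B (AdjoinRoot p)) Ideal.le_comap_map
  have hψ : ∀ b : B, ψ (Ideal.Quotient.mk I b) =
      Ideal.Quotient.mk J (algebraMap B (AdjoinRoot p) b) := fun b => rfl
  have hroot : (Ideal.Quotient.mk J (AdjoinRoot.root p)) ^ n - ψ (φ u) = 0 := by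
    rw [← hw, hψ, ← map_pow, ← map_sub]
    have := AdjoinRoot.eval₂_root p
    rw [hp, Polynomial.eval₂_sub, Polynomial.eval₂_pow, Polynomial.eval₂_X,
      Polynomial.eval₂_C] at this
    exact (congrArg (Ideal.Quotient.mk J) this).trans (map_zero _)
  let φ' : AdjoinRoot (Polynomial.X ^ n - Polynomial.C u) →ₐ[R] AdjoinRoot p ⧸ J :=
    { AdjoinRoot.lift (ψ.comp φ : A →+* AdjoinRoot p ⧸ J)
        (Ideal.Quotient.mk J (AdjoinRoot.root p)) (by simpa using hroot) with
      commutes' := fun r => by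
        change AdjoinRoot.lift _ _ _ (algebraMap R (AdjoinRoot _) r) = _
        rw [IsScalarTower.algebraMap_apply R A (AdjoinRoot _), AdjoinRoot.algebraMap_eq,
          AdjoinRoot.lift_of]
        simp }
  have hφ' : ∀ a, φ' (AdjoinRoot.of _ a) = ψ (φ a) := fun a =>
    AdjoinRoot.lift_of (by simpa using hroot)
  obtain ⟨s, hs⟩ := Algebra.FormallySmooth.comp_surjective R _ J hJ φ'
  have hs' : ∀ x, Ideal.Quotient.mk J (s x) = φ' x := fun x => DFunLike.congr_fun hs x
  -- the constant coefficient, a retraction of `B[t]/(tⁿ - w)` onto `B`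
  let c₀ : AdjoinRoot p →ₗ[B] B := (Polynomial.lcoeff B 0).comp (AdjoinRoot.modByMonicHom hpm)
  have hc₀ : ∀ b, c₀ (algebraMap B _ b) = b := fun b => by
    change ((AdjoinRoot.modByMonicHom hpm) (AdjoinRoot.mk p (Polynomial.C b))).coeff 0 = b
    nontriviality B
    rw [AdjoinRoot.modByMonicHom_mk, (Polynomial.modByMonic_eq_self_iff hpm).mpr,
      Polynomial.coeff_C_zero]
    refine Polynomial.degree_C_le.trans_lt ?_
    rw [hp, Polynomial.degree_X_pow_sub_C (Nat.pos_of_ne_zero hn)]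
    exact_mod_cast Nat.pos_of_ne_zero hn
  have hc₀J : ∀ x ∈ J, c₀ x ∈ I := fun x hx => by
    have h1 : I • (⊤ : Submodule B (AdjoinRoot p)) ≤ Submodule.comap c₀ I :=
      Submodule.smul_le.mpr fun r hr y _ => by
        change c₀ (r • y) ∈ I
        rw [map_smul]
        exact I.mul_mem_right _ hr
    refine h1 ?_
    rw [Ideal.smul_top_eq_map]
    exact hx
  have hsJ : ∀ a b, Ideal.Quotient.mk I b = φ a →
      s (AdjoinRoot.of _ a) - algebraMap B _ b ∈ J := fun a b hb => by
    rw [← Ideal.Quotient.eq, hs', hφ', ← hb, hψ]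
  have hsc : ∀ a, s (AdjoinRoot.of _ a) - algebraMap B _ (c₀ (s (AdjoinRoot.of _ a))) ∈ J :=
    fun a => by
      obtain ⟨b, hb'⟩ := Ideal.Quotient.mk_surjective (φ a)
      have hb := hsJ a b hb'
      have h1 := hc₀J _ hb
      rw [map_sub, hc₀] at h1
      have h2 := J.sub_mem hb (Ideal.mem_map_of_mem (algebraMap B (AdjoinRoot p)) h1)
      rw [map_sub] at h2
      simpa using h2
  have hJ2 : ∀ x ∈ J, ∀ y ∈ J, x * y = 0 := fun x hx y hy => by
    have : x * y ∈ J ^ 2 := by rw [pow_two]; exact Ideal.mul_mem_mul hx hy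
    rwa [hJ] at this
  -- The constant coefficient is multiplicative on elements which are constant up to `J`, as `J² =
  -- 0`.
  have hmul : ∀ a b, c₀ (s (AdjoinRoot.of _ (a * b))) =
      c₀ (s (AdjoinRoot.of _ a)) * c₀ (s (AdjoinRoot.of _ b)) := fun a b => by
    set x := s (AdjoinRoot.of _ a)
    set y := s (AdjoinRoot.of _ b)
    have h1 := hJ2 _ (hsc a) _ (hsc b)
    have h2 : x * y = c₀ y • x + c₀ x • y - algebraMap B _ (c₀ x * c₀ y) := by
      rw [Algebra.smul_def, Algebra.smul_def, map_mul]
      linear_combination h1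
    rw [map_mul, map_mul, h2, map_sub, map_add, map_smul, map_smul, hc₀, smul_eq_mul,
      smul_eq_mul]
    ring
  have halg : ∀ r : R, s (AdjoinRoot.of _ (algebraMap R A r)) =
      algebraMap B _ (algebraMap R B r) := fun r => by
    rw [← AdjoinRoot.algebraMap_eq, ← IsScalarTower.algebraMap_apply, AlgHom.commutes,
      ← IsScalarTower.algebraMap_apply]
  refine ⟨{ toFun := fun a => c₀ (s (AdjoinRoot.of _ a))
            map_one' := by
              have := halg 1
              simp only [map_one] at this ⊢
              rw [← map_one (algebraMap B (AdjoinRoot p)), hc₀]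
            map_zero' := by simp
            map_add' := fun a b => by simp
            map_mul' := hmul
            commutes' := fun r => by
              change c₀ (s (AdjoinRoot.of _ (algebraMap R A r))) = _
              rw [halg, hc₀] }, ?_⟩
  refine AlgHom.ext fun a => ?_
  change Ideal.Quotient.mk I (c₀ (s (AdjoinRoot.of _ a))) = φ a
  obtain ⟨b, hb⟩ := Ideal.Quotient.mk_surjective (φ a)
  rw [← hb, Ideal.Quotient.eq]
  have h2 := hc₀J _ (hsJ a b hb)
  rwa [map_sub, hc₀] at h2

end Algebra


/-! ### Weights -/

section Characters

variable {G A : Type*} [Group G] [CommRing A] [MulSemiringAction G A] {χ : G →* A}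

omit [MulSemiringAction G A] in
lemma character_inv_mul (χ : G →* A) (g : G) : χ g⁻¹ * χ g = 1 := by
  rw [← map_mul, inv_mul_cancel, map_one]

/-- An element `m` of an `A`-module with `G`-action has weight `i` for the character `χ` if `g m =
χ(g)ⁱ m` for all `g`. -/
def IsWeight {M : Type*} [AddCommGroup M] [Module A M] [DistribMulAction G M] (χ : G →* A) (i : ℕ)
    (m : M) : Prop :=
  ∀ g : G, g • m = χ g ^ i • m

namespace IsPrimitiveCharacter

variable (hχ : IsPrimitiveCharacter χ)
include hχ

lemma sum_pow [Finite G] (g : G) (hg : g ≠ 1) : ∑ k ∈ Finset.range (Nat.card G), χ g ^ k = 0 := by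
  have h1 := mul_geom_sum (χ g) (Nat.card G)
  rw [← map_pow, pow_card_eq_one', map_one, sub_self] at h1
  exact (hχ.isUnit_sub_one g hg).mul_right_eq_zero.mp h1

variable {M : Type*} [AddCommGroup M] [Module A M] [DistribMulAction G M]

omit hχ in
/-- Up to the factor `|G|`, the projection of `m` to the part of weight `i`. -/
def proj [Fintype G] (χ : G →* A) (i : ℕ) (m : M) : M := ∑ g : G, χ g⁻¹ ^ i • g • m

lemma isWeight_proj [Fintype G] (hM : ∀ (g : G) (a : A) (m : M), g • a • m = (g • a) • g • m)
    (i : ℕ) (m : M) : IsWeight χ i (proj χ i m) := fun h => by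
  rw [proj, Finset.smul_sum, Finset.smul_sum]
  refine Fintype.sum_equiv (Equiv.mulLeft h) _ _ fun g => ?_
  rw [hM, smul_pow', hχ.smul_apply, smul_smul, smul_smul, ← mul_pow]
  simp only [Equiv.coe_mulLeft, mul_inv_rev, map_mul, mul_left_comm (χ h),
    mul_comm (χ h) (χ h⁻¹), character_inv_mul, mul_one]

lemma sum_proj [Fintype G] (m : M) :
    ∑ i ∈ Finset.range (Nat.card G), proj χ i m = (Nat.card G : A) • m := by
  classical
  simp only [proj]
  rw [Finset.sum_comm, Fintype.sum_eq_single 1]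
  · simp [Nat.cast_smul_eq_nsmul]
  · intro g hg
    rw [← Finset.sum_smul, hχ.sum_pow _ (inv_ne_one.mpr hg), zero_smul]

/-- Up to the factor `|G|`, every element is a sum of elements of weights `0, …, |G| - 1`. -/
lemma exists_sum_isWeight [Finite G]
    (hM : ∀ (g : G) (a : A) (m : M), g • a • m = (g • a) • g • m) (m : M) :
    ∃ s : ℕ → M, (Nat.card G : A) • m = ∑ i ∈ Finset.range (Nat.card G), s i ∧
      ∀ i, IsWeight χ i (s i) := by
  have := Fintype.ofFinite G
  exact ⟨fun i => proj χ i m, (hχ.sum_proj m).symm, fun i => hχ.isWeight_proj hM i m⟩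

lemma isUnit_pow_sub_one {σ : G} {i : ℕ} (hi : σ ^ i ≠ 1) : IsUnit (χ σ ^ i - 1) := by
  rw [← map_pow]
  exact hχ.isUnit_sub_one _ hi

lemma sum_eq_zero_of_not_dvd [Fintype G] [IsCyclic G] {i : ℕ} (hi : ¬ Nat.card G ∣ i) :
    ∑ g : G, χ g ^ i = 0 := by
  obtain ⟨σ, hσ⟩ := IsCyclic.exists_generator (α := G)
  have h1 : σ ^ i ≠ 1 := fun h => hi (by
    rw [← orderOf_eq_card_of_forall_mem_zpowers hσ]; exact orderOf_dvd_of_pow_eq_one h)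
  have h2 : (χ σ ^ i - 1) * ∑ g : G, χ g ^ i = 0 := by
    rw [sub_mul, one_mul, Finset.mul_sum, sub_eq_zero]
    refine Fintype.sum_equiv (Equiv.mulLeft σ) _ _ fun g => ?_
    rw [Equiv.coe_mulLeft, map_mul, mul_pow]
  exact (hχ.isUnit_pow_sub_one h1).mul_right_eq_zero.mp h2

/-- For a generator `σ` and `a` of weight `i` one has `σ a - a = (χ σ ^ i - 1) a`, and the factor is
a unit if `0 < i < |G|`. -/
lemma mem_fixedIdeal_of_isWeight [Finite G] [IsCyclic G] {i : ℕ} (hi0 : 0 < i)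
    (hi : i < Nat.card G) {a : A} (ha : IsWeight χ i a) : a ∈ fixedIdeal G A := by
  obtain ⟨σ, hσ⟩ := IsCyclic.exists_generator (α := G)
  have h1 : σ ^ i ≠ 1 := fun h => by
    rw [← orderOf_eq_card_of_forall_mem_zpowers hσ] at hi
    exact absurd (Nat.le_of_dvd hi0 (orderOf_dvd_of_pow_eq_one h)) (not_le.mpr hi)
  have h2 := smul_sub_mem_fixedIdeal σ a
  rw [ha σ, smul_eq_mul, ← sub_one_mul] at h2
  exact (Ideal.unit_mul_mem_iff_mem _ (hχ.isUnit_pow_sub_one h1)).mp h2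

/-- The ideal of the fixed scheme is generated by the elements of nonzero weight. -/
theorem fixedIdeal_eq_span [Finite G] [IsCyclic G] (hN : IsUnit (Nat.card G : A)) :
    fixedIdeal G A = Ideal.span {a | ∃ i, 0 < i ∧ i < Nat.card G ∧ IsWeight χ i a} := by
  refine le_antisymm (Ideal.span_le.mpr ?_) (Ideal.span_le.mpr ?_)
  · rintro _ ⟨g, a, rfl⟩
    obtain ⟨s, hs, hw⟩ := hχ.exists_sum_isWeight (fun g a m => smul_mul' g a m) a
    refine (Ideal.unit_mul_mem_iff_mem _ hN).mp ?_
    have h1 : (Nat.card G : A) * (g • a - a) =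
        ∑ i ∈ Finset.range (Nat.card G), (χ g ^ i - 1) * s i := by
      have h2 : g • ((Nat.card G : A) • a) = (Nat.card G : A) * g • a := by
        rw [smul_eq_mul, smul_mul', smul_natCast']
      rw [mul_sub, ← h2, ← smul_eq_mul (Nat.card G : A) a, hs, Finset.smul_sum,
        ← Finset.sum_sub_distrib]
      exact Finset.sum_congr rfl fun i _ => by rw [hw i g, smul_eq_mul, sub_mul, one_mul]
    rw [h1]
    refine Ideal.sum_mem _ fun i hi => ?_
    rcases Nat.eq_zero_or_pos i with rfl | h0
    · rw [pow_zero, sub_self, zero_mul]; exact zero_mem _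
    · exact Ideal.mul_mem_left _ _ (Ideal.subset_span ⟨i, h0, Finset.mem_range.mp hi, hw i⟩)
  · rintro a ⟨i, hi0, hi, ha⟩
    exact hχ.mem_fixedIdeal_of_isWeight hi0 hi ha

/-- The part of weight `0` of `I / I²` vanishes: for `a = b h` with `h` of nonzero weight `i` only
the component of `b` of weight `-i` contributes to the trace of `a`, and it belongs to `I`. -/
theorem sum_smul_mem_sq [Fintype G] [IsCyclic G] (hN : IsUnit (Nat.card G : A)) {a : A}
    (ha : a ∈ fixedIdeal G A) : ∑ g : G, g • a ∈ fixedIdeal G A * fixedIdeal G A := by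
  have key : ∀ (b h : A) (i : ℕ), 0 < i → i < Nat.card G → IsWeight χ i h →
      ∑ g : G, g • (b * h) ∈ fixedIdeal G A * fixedIdeal G A := by
    intro b h i hi0 hi hh
    obtain ⟨s, hs, hw⟩ := hχ.exists_sum_isWeight (fun g a m => smul_mul' g a m) b
    refine (Ideal.unit_mul_mem_iff_mem _ hN).mp ?_
    have h1 : (Nat.card G : A) * ∑ g : G, g • (b * h) =
        ∑ j ∈ Finset.range (Nat.card G), (∑ g : G, χ g ^ (j + i)) * (s j * h) := by
      simp only [Finset.mul_sum, Finset.sum_mul]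
      rw [Finset.sum_comm]
      refine Finset.sum_congr rfl fun g _ => ?_
      have h2 : (Nat.card G : A) * g • (b * h) = g • ((Nat.card G : A) • b) * g • h := by
        rw [smul_eq_mul, smul_mul', smul_mul', smul_natCast', mul_assoc]
      rw [h2, hs, Finset.smul_sum, Finset.sum_mul]
      refine Finset.sum_congr rfl fun j _ => ?_
      rw [hw j g, hh g, smul_eq_mul, smul_eq_mul, pow_add]
      ring
    rw [h1]
    refine Ideal.sum_mem _ fun j hj => ?_
    rw [Finset.mem_range] at hj
    -- Only the summands with `j + i` divisible by `|G|` survive, and then `j` is nonzero like `i`.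
    by_cases hd : Nat.card G ∣ j + i
    · have hj0 : 0 < j := by
        rcases Nat.eq_zero_or_pos j with rfl | h0
        · rw [zero_add] at hd
          exact absurd (Nat.le_of_dvd hi0 hd) (not_le.mpr hi)
        · exact h0
      exact Ideal.mul_mem_left _ _ (Ideal.mul_mem_mul
        (hχ.mem_fixedIdeal_of_isWeight hj0 hj (hw j)) (hχ.mem_fixedIdeal_of_isWeight hi0 hi hh))
    · rw [hχ.sum_eq_zero_of_not_dvd hd, zero_mul]
      exact zero_mem _
  suffices ∀ b : A, ∑ g : G, g • (b * a) ∈ fixedIdeal G A * fixedIdeal G A by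
    simpa using this 1
  rw [hχ.fixedIdeal_eq_span hN] at ha
  induction ha using Submodule.span_induction with
  | mem x hx =>
    obtain ⟨i, h0, hi, hw⟩ := hx
    exact fun b => key b x i h0 hi hw
  | zero => simp
  | add x y _ _ hx hy =>
    intro b
    simp only [mul_add, smul_add, Finset.sum_add_distrib]
    exact add_mem (hx b) (hy b)
  | smul c x _ hx =>
    intro b
    rw [smul_eq_mul, ← mul_assoc]
    exact hx _

/-- If the ideal of the fixed scheme is generated by a nonzerodivisor `t`, then for every proper
ideal `P` some element of nonzero weight is a multiple of `t` with cofactor outside `P`. Otherwise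
the elements of nonzero weight, which generate the ideal, would all lie in `P t`. -/
lemma exists_isWeight_eq_mul [Finite G] [IsCyclic G] (hN : IsUnit (Nat.card G : A)) {t : A}
    (ht : t ∈ nonZeroDivisors A) (hI : fixedIdeal G A = Ideal.span {t}) {P : Ideal A}
    (hP : P ≠ ⊤) : ∃ i, 0 < i ∧ i < Nat.card G ∧ ∃ h c : A, IsWeight χ i h ∧ h = c * t ∧ c ∉ P := by
  by_contra! hcon
  have h1 : fixedIdeal G A ≤ P * Ideal.span {t} := by
    rw [hχ.fixedIdeal_eq_span hN]
    refine Ideal.span_le.mpr ?_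
    rintro h ⟨i, h0, hi, hw⟩
    have h2 : h ∈ Ideal.span {t} := hI ▸ hχ.mem_fixedIdeal_of_isWeight h0 hi hw
    obtain ⟨c, hc⟩ := Ideal.mem_span_singleton'.mp h2
    exact hc ▸ Ideal.mul_mem_mul (hcon i h0 hi h c hw hc.symm) (Ideal.mem_span_singleton_self t)
  have h2 : t ∈ P * Ideal.span {t} := h1 (hI ▸ Ideal.mem_span_singleton_self t)
  obtain ⟨p, hp, hpt⟩ := Ideal.mem_mul_span_singleton.mp h2
  have h3 : p = 1 := by
    have : (p - 1) * t = 0 := by rw [sub_mul, hpt, one_mul, sub_self]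
    exact sub_eq_zero.mp ((mem_nonZeroDivisors_iff.mp ht).2 _ this)
  exact hP ((Ideal.eq_top_iff_one _).mpr (h3 ▸ hp))

/-- At a point of `Spec A` outside the fixed scheme some function of nonzero weight does not vanish.
-/
lemma exists_isWeight_notMem [Finite G] [IsCyclic G] (hN : IsUnit (Nat.card G : A)) {P : Ideal A}
    (hP : ¬ fixedIdeal G A ≤ P) :
    ∃ i, 0 < i ∧ i < Nat.card G ∧ ∃ h : A, IsWeight χ i h ∧ h ∉ P := by
  by_contra! hcon
  refine hP ?_
  rw [hχ.fixedIdeal_eq_span hN]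
  refine Ideal.span_le.mpr ?_
  rintro h ⟨i, h0, hi, hw⟩
  exact hcon i h0 hi h hw

/-- For `G` of prime order every nontrivial power of a primitive character is primitive. -/
lemma pow_of_prime {i : ℕ} (hG : (Nat.card G).Prime) (h0 : 0 < i) (hi : i < Nat.card G) :
    IsPrimitiveCharacter (χ ^ i) where
  smul_apply g h := by rw [MonoidHom.pow_apply, smul_pow', hχ.smul_apply]
  isUnit_sub_one g hg := by
    rw [MonoidHom.pow_apply]
    refine hχ.isUnit_pow_sub_one fun h => hg ?_
    have h1 : g ^ Nat.card G = 1 := pow_card_eq_one'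
    have h2 : Nat.Coprime i (Nat.card G) := Nat.Coprime.symm
      ((Nat.Prime.coprime_iff_not_dvd hG).mpr fun h => absurd (Nat.le_of_dvd h0 h) (not_le.mpr hi))
    have := pow_gcd_eq_one.mpr ⟨h, h1⟩
    rwa [h2.gcd_eq_one, pow_one] at this

end IsPrimitiveCharacter

end Characters


/-! ### Kummer coverings -/

section Kummer

open scoped TensorProduct
open Polynomial

variable {G A : Type*} [Group G] [CommRing A] [MulSemiringAction G A] {χ : G →* A}

namespace IsPrimitiveCharacter

variable (hχ : IsPrimitiveCharacter χ)
include hχ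

/-- The orthogonality relations for the powers of a primitive character. -/
lemma sum_inv_pow_mul_pow [Fintype G] [IsCyclic G] {j k : ℕ} (hj : j < Nat.card G)
    (hk : k < Nat.card G) :
    ∑ g : G, χ g⁻¹ ^ j * χ g ^ k = if k = j then (Nat.card G : A) else 0 := by
  split_ifs with h
  · subst h
    simp [← mul_pow, character_inv_mul]
  · obtain ⟨σ, hσ⟩ := IsCyclic.exists_generator (α := G)
    have h1 : (σ⁻¹) ^ j * σ ^ k ≠ 1 := fun h1 => by
      rw [inv_pow, inv_mul_eq_one] at h1
      rw [← orderOf_eq_card_of_forall_mem_zpowers hσ] at hj hk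
      exact h (pow_injOn_Iio_orderOf hk hj h1.symm)
    have h2 : (χ ((σ⁻¹) ^ j * σ ^ k) - 1) * ∑ g : G, χ g⁻¹ ^ j * χ g ^ k = 0 := by
      rw [sub_mul, one_mul, Finset.mul_sum, sub_eq_zero]
      refine Fintype.sum_equiv (Equiv.mulLeft σ) _ _ fun g => ?_
      simp only [Equiv.coe_mulLeft, map_mul, map_pow, mul_inv_rev]
      ring
    exact (hχ.isUnit_sub_one _ h1).mul_right_eq_zero.mp h2

variable {t : A} (ht : IsWeight χ 1 t)
include ht

omit hχ in
lemma smul_pow_eq (g : G) (k : ℕ) : g • t ^ k = χ g ^ k * t ^ k := by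
  rw [smul_pow', ht g, pow_one, smul_eq_mul, mul_pow]

omit hχ in
lemma pow_card_invariant [Finite G] (g : G) : g • t ^ Nat.card G = t ^ Nat.card G := by
  rw [smul_pow_eq ht, ← map_pow, pow_card_eq_one', map_one, one_mul]

section Basis

variable [Finite G] [IsCyclic G] (htn : t ∈ nonZeroDivisors A)
    (hI : fixedIdeal G A = Ideal.span {t})
include htn hI

/-- A function of positive weight lies in the ideal of the fixed scheme, so it is divisible by `t`,
and the quotient has weight smaller by one. -/
lemma exists_invariant_mul_pow {k : ℕ} (hk : k < Nat.card G) {a : A} (ha : IsWeight χ k a) :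
    ∃ b : A, (∀ g : G, g • b = b) ∧ a = b * t ^ k := by
  induction k generalizing a with
  | zero => exact ⟨a, fun g => by simpa using ha g, by simp⟩
  | succ k ih =>
    have h1 := hχ.mem_fixedIdeal_of_isWeight k.succ_pos hk ha
    rw [hI] at h1
    obtain ⟨c, rfl⟩ := Ideal.mem_span_singleton'.mp h1
    have hc : IsWeight χ k c := fun g => by
      have h2 := ha g
      rw [smul_mul', ht g, smul_eq_mul, smul_eq_mul, pow_one, pow_succ] at h2
      have h3 : χ g * ((g • c - χ g ^ k * c) * t) = 0 := by linear_combination h2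
      have h4 : (g • c - χ g ^ k * c) * t = 0 := by
        have := congrArg (χ g⁻¹ * ·) h3
        simpa [← mul_assoc, character_inv_mul] using this
      exact sub_eq_zero.mp ((mem_nonZeroDivisors_iff.mp htn).2 _ h4)
    obtain ⟨b, hb, rfl⟩ := ih (Nat.lt_of_succ_lt hk) hc
    exact ⟨b, hb, by ring⟩

variable {A₀ : Type*} [CommRing A₀] [Algebra A₀ A] [Algebra.IsInvariant A₀ A G]

lemma exists_eq_sum_mul_pow (hN : IsUnit (Nat.card G : A)) (a : A) : ∃ b : ℕ → A₀,
    a = ∑ k ∈ Finset.range (Nat.card G), algebraMap A₀ A (b k) * t ^ k := by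
  obtain ⟨s, hs, hw⟩ := hχ.exists_sum_isWeight (fun g a m => smul_mul' g a m) a
  obtain ⟨c, hc⟩ := hN.exists_right_inv
  have h1 : ∀ k, ∃ b : A₀, k < Nat.card G → c * s k = algebraMap A₀ A b * t ^ k := fun k => by
    by_cases hk : k < Nat.card G
    · obtain ⟨b, hb, hbt⟩ := hχ.exists_invariant_mul_pow ht htn hI hk (hw k)
      obtain ⟨b', hb'⟩ := Algebra.IsInvariant.isInvariant (A := A₀) (G := G) (c * b) fun g => by
        rw [smul_mul', hb, smul_eq_self_of_natCast_mul_eq_one hc]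
      exact ⟨b', fun _ => by rw [hb', hbt, mul_assoc]⟩
    · exact ⟨0, fun h => absurd h hk⟩
  choose b hb using h1
  refine ⟨b, ?_⟩
  calc a = c * ((Nat.card G : A) • a) := by rw [smul_eq_mul, ← mul_assoc, mul_comm c, hc, one_mul]
    _ = _ := by
      rw [hs, Finset.mul_sum]
      exact Finset.sum_congr rfl fun k hk => hb k (Finset.mem_range.mp hk)

omit [Algebra.IsInvariant A₀ A G] hI in
/-- The powers of `t` are linearly independent over the invariants, as their weights are distinct.
-/
lemma eq_zero_of_sum_mul_pow_eq_zero [SMulCommClass G A₀ A] (hN : IsUnit (Nat.card G : A))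
    (hinj : Function.Injective (algebraMap A₀ A)) (b : ℕ → A₀)
    (hb : ∑ k ∈ Finset.range (Nat.card G), algebraMap A₀ A (b k) * t ^ k = 0) {j : ℕ}
    (hj : j < Nat.card G) : b j = 0 := by
  have := Fintype.ofFinite G
  have h1 : ∑ g : G, χ g⁻¹ ^ j * g • ∑ k ∈ Finset.range (Nat.card G),
      algebraMap A₀ A (b k) * t ^ k = (Nat.card G : A) * (algebraMap A₀ A (b j) * t ^ j) := by
    simp only [Finset.smul_sum, smul_mul', smul_algebraMap, smul_pow_eq ht, Finset.mul_sum]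
    rw [Finset.sum_comm, Finset.sum_eq_single j]
    · have h2 := hχ.sum_inv_pow_mul_pow hj hj
      rw [if_pos rfl] at h2
      rw [← h2, Finset.sum_mul]
      exact Finset.sum_congr rfl fun g _ => by ring
    · intro k hk hkj
      have h2 := hχ.sum_inv_pow_mul_pow hj (Finset.mem_range.mp hk)
      rw [if_neg hkj] at h2
      have h3 : ∀ g : G, χ g⁻¹ ^ j * (algebraMap A₀ A (b k) * (χ g ^ k * t ^ k)) =
          χ g⁻¹ ^ j * χ g ^ k * (algebraMap A₀ A (b k) * t ^ k) := fun g => by ring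
      simp only [h3]
      rw [← Finset.sum_mul, h2, zero_mul]
    · intro h
      exact absurd (Finset.mem_range.mpr hj) h
  rw [hb] at h1
  simp only [smul_zero, mul_zero, Finset.sum_const_zero] at h1
  have h2 := hN.mul_right_eq_zero.mp h1.symm
  have h3 := (mem_nonZeroDivisors_iff.mp (pow_mem htn j)).2 _ h2
  exact hinj (h3.trans (map_zero _).symm)

/-- If the ideal of the fixed scheme is generated by a nonzerodivisor `t` of weight `1`, then `A` is
obtained from the ring of invariants by extracting an `n`-th root of `u = tⁿ`. -/
theorem bijective_adjoinRoot [SMulCommClass G A₀ A] (hN : IsUnit (Nat.card G : A))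
    (hinj : Function.Injective (algebraMap A₀ A)) {u : A₀}
    (hu : algebraMap A₀ A u = t ^ Nat.card G) :
    Function.Bijective (AdjoinRoot.liftAlgHom (X ^ Nat.card G - C u) (Algebra.ofId A₀ A) t
      (by simp [hu])) := by
  have hpos : Nat.card G ≠ 0 := Nat.card_pos.ne'
  have hm := monic_X_pow_sub_C u hpos
  rcases subsingleton_or_nontrivial A₀ with h0 | h0
  · have := Module.subsingleton A₀ A
    have := Module.subsingleton A₀ (AdjoinRoot (X ^ Nat.card G - C u))
    exact ⟨Function.injective_of_subsingleton _, Function.surjective_to_subsingleton _⟩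
  constructor
  · rw [injective_iff_map_eq_zero]
    intro x hx
    obtain ⟨f, rfl⟩ := AdjoinRoot.mk_surjective x
    rw [← AdjoinRoot.mk_leftInverse hm (AdjoinRoot.mk _ f), AdjoinRoot.modByMonicHom_mk] at hx ⊢
    set r := f %ₘ (X ^ Nat.card G - C u)
    have hdeg : r.natDegree < Nat.card G := by
      have := natDegree_modByMonic_lt f hm fun h => by
        have := congrArg natDegree h
        rw [natDegree_X_pow_sub_C, natDegree_one] at this
        exact hpos this
      rwa [natDegree_X_pow_sub_C] at this
    rw [AdjoinRoot.liftAlgHom_mk, eval₂_eq_sum_range' _ hdeg] at hx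
    have : r = 0 := by
      ext j
      by_cases hj : j < Nat.card G
      · exact hχ.eq_zero_of_sum_mul_pow_eq_zero ht htn hN hinj r.coeff hx hj
      · exact coeff_eq_zero_of_natDegree_lt (hdeg.trans_le (not_lt.mp hj))
    rw [this, map_zero]
  · intro a
    obtain ⟨b, hb⟩ := hχ.exists_eq_sum_mul_pow (A₀ := A₀) ht htn hI hN a
    refine ⟨∑ k ∈ Finset.range (Nat.card G), AdjoinRoot.of _ (b k) * AdjoinRoot.root _ ^ k, ?_⟩
    rw [map_sum, hb]
    refine Finset.sum_congr rfl fun k _ => ?_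
    rw [map_mul, map_pow, AdjoinRoot.liftAlgHom_root, AdjoinRoot.liftAlgHom_of, Algebra.ofId_apply]

/-- The presentation `A = A₀[t]/(tⁿ - u)`. -/
theorem exists_adjoinRoot_equiv [SMulCommClass G A₀ A] (hN : IsUnit (Nat.card G : A))
    (hinj : Function.Injective (algebraMap A₀ A)) :
    ∃ u : A₀, Nonempty (AdjoinRoot (X ^ Nat.card G - C u) ≃ₐ[A₀] A) := by
  obtain ⟨u, hu⟩ := Algebra.IsInvariant.isInvariant (A := A₀) (G := G) _ (pow_card_invariant ht)
  exact ⟨u, ⟨AlgEquiv.ofBijective _ (hχ.bijective_adjoinRoot ht htn hI hN hinj hu)⟩⟩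

/-- The ring `A` is free over the ring of invariants, with basis `1, t, …, tⁿ⁻¹`. -/
lemma free_invariants [SMulCommClass G A₀ A] (hN : IsUnit (Nat.card G : A))
    (hinj : Function.Injective (algebraMap A₀ A)) :
    Module.Free A₀ A ∧ Module.Finite A₀ A := by
  obtain ⟨u, ⟨e⟩⟩ := hχ.exists_adjoinRoot_equiv (A₀ := A₀) ht htn hI hN hinj
  have hm := monic_X_pow_sub_C u (Nat.card_pos (α := G)).ne'
  have h1 := Module.Free.of_basis (AdjoinRoot.powerBasis' hm).basis
  have h2 : Module.Finite A₀ (AdjoinRoot (X ^ Nat.card G - C u)) := (AdjoinRoot.powerBasis' hm).finite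
  exact ⟨Module.Free.of_equiv e.toLinearEquiv, Module.Finite.equiv e.toLinearEquiv⟩

/-- Smoothness descends to the ring of invariants. -/
theorem smooth_invariants {R : Type*} [CommRing R] [IsNoetherianRing R] [Algebra R A₀]
    [Algebra R A] [IsScalarTower R A₀ A] [Algebra.Smooth R A] [SMulCommClass G A₀ A]
    (hN : IsUnit (Nat.card G : A)) (hinj : Function.Injective (algebraMap A₀ A)) :
    Algebra.Smooth R A₀ := by
  obtain ⟨u, ⟨e⟩⟩ := hχ.exists_adjoinRoot_equiv (A₀ := A₀) ht htn hI hN hinj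
  have h1 : Algebra.FormallySmooth R (AdjoinRoot (X ^ Nat.card G - C u)) :=
    Algebra.FormallySmooth.of_equiv (e.restrictScalars R).symm
  have h2 := (hχ.free_invariants (A₀ := A₀) ht htn hI hN hinj).2
  have h3 : Algebra.FiniteType R A₀ := ⟨by
    refine fg_of_fg_of_fg R A₀ A Algebra.FiniteType.out Module.Finite.fg_top hinj⟩
  exact ⟨formallySmooth_of_adjoinRoot (Nat.card G) (Nat.card_pos (α := G)).ne' u,
    Algebra.FinitePresentation.of_finiteType.mp h3⟩

end Basis

/-- If there is a unit of weight `1`, then `Spec A` is a `G`-torsor over the spectrum of the ring of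
invariants. -/
theorem bijective_torsorHom [Fintype G] [IsCyclic G] (hG : 1 < Nat.card G)
    (hN : IsUnit (Nat.card G : A)) (htu : IsUnit t)
    {A₀ : Type*} [CommRing A₀] [Algebra A₀ A] [Algebra.IsInvariant A₀ A G] [SMulCommClass G A₀ A] :
    Function.Bijective (AlgHom.pi fun g : G =>
      Algebra.TensorProduct.productMap (MulSemiringAction.toAlgHom A₀ A g) (AlgHom.id A₀ A)) := by
  -- As `t` is a unit the fixed scheme is empty, and `t` generates its ideal.
  have htn : t ∈ nonZeroDivisors A := htu.mem_nonZeroDivisors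
  have hI : fixedIdeal G A = Ideal.span {t} := by
    have h1 := hχ.mem_fixedIdeal_of_isWeight one_pos hG ht
    rw [Ideal.span_singleton_eq_top.mpr htu]
    exact Ideal.eq_top_of_isUnit_mem _ h1 htu
  set F := AlgHom.pi fun g : G =>
      Algebra.TensorProduct.productMap (MulSemiringAction.toAlgHom A₀ A g) (AlgHom.id A₀ A)
  have hF : ∀ (g : G) (a b : A), F (a ⊗ₜ b) g = g • a * b := fun g a b => by simp [F]
  have hFs : ∀ (b : ℕ → A) (g : G), F (∑ k ∈ Finset.range (Nat.card G), (t ^ k) ⊗ₜ[A₀] b k) g =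
      ∑ k ∈ Finset.range (Nat.card G), χ g ^ k * (t ^ k * b k) := fun b g => by
    rw [map_sum, Finset.sum_apply]
    exact Finset.sum_congr rfl fun k _ => by rw [hF, smul_pow_eq ht, mul_assoc]
  have hex : ∀ x : A ⊗[A₀] A, ∃ b : ℕ → A,
      x = ∑ k ∈ Finset.range (Nat.card G), (t ^ k) ⊗ₜ[A₀] b k := fun x => by
    induction x using TensorProduct.induction_on with
    | zero => exact ⟨0, by simp⟩
    | tmul a a' =>
      obtain ⟨b, hb⟩ := hχ.exists_eq_sum_mul_pow (A₀ := A₀) ht htn hI hN a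
      refine ⟨fun k => b k • a', ?_⟩
      rw [hb, TensorProduct.sum_tmul]
      refine Finset.sum_congr rfl fun k _ => ?_
      rw [← Algebra.smul_def, TensorProduct.smul_tmul]
    | add x y hx hy =>
      obtain ⟨b, rfl⟩ := hx
      obtain ⟨c, rfl⟩ := hy
      exact ⟨b + c, by simp [TensorProduct.tmul_add, Finset.sum_add_distrib]⟩
  constructor
  · rw [injective_iff_map_eq_zero]
    intro x hx
    obtain ⟨b, rfl⟩ := hex x
    have hb : ∀ j < Nat.card G, b j = 0 := fun j hj => by
      -- The orthogonality relations recover the coefficient `b j` from the image under `F`.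
      have h1 : ∑ g : G, χ g⁻¹ ^ j * F (∑ k ∈ Finset.range (Nat.card G), (t ^ k) ⊗ₜ[A₀] b k) g =
          (Nat.card G : A) * (t ^ j * b j) := by
        simp only [hFs, Finset.mul_sum]
        rw [Finset.sum_comm, Finset.sum_eq_single j]
        · have h2 := hχ.sum_inv_pow_mul_pow hj hj
          rw [if_pos rfl] at h2
          simp only [← mul_assoc]
          rw [← h2, Finset.sum_mul, Finset.sum_mul]
        · intro k hk hkj
          have h2 := hχ.sum_inv_pow_mul_pow hj (Finset.mem_range.mp hk)
          rw [if_neg hkj] at h2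
          simp only [← mul_assoc]
          rw [← Finset.sum_mul, ← Finset.sum_mul, h2, zero_mul, zero_mul]
        · intro h
          exact absurd (Finset.mem_range.mpr hj) h
      rw [hx] at h1
      simp only [Pi.zero_apply, mul_zero, Finset.sum_const_zero] at h1
      exact (htu.pow j).mul_right_eq_zero.mp (hN.mul_right_eq_zero.mp h1.symm)
    exact Finset.sum_eq_zero fun k hk => by
      rw [hb k (Finset.mem_range.mp hk), TensorProduct.tmul_zero]
  · intro c
    obtain ⟨m, hm⟩ := hN.exists_right_inv
    obtain ⟨w, hw⟩ := htu.exists_right_inv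
    -- Fourier inversion: `m` and `w` are the inverses of `|G|` and of `t`.
    refine ⟨∑ k ∈ Finset.range (Nat.card G), (t ^ k) ⊗ₜ[A₀] (m * w ^ k *
      ∑ g : G, χ g⁻¹ ^ k * c g), funext fun h => ?_⟩
    rw [hFs]
    have h1 : ∀ k, χ h ^ k * (t ^ k * (m * w ^ k * ∑ g : G, χ g⁻¹ ^ k * c g)) =
        ∑ g : G, m * c g * χ (h * g⁻¹) ^ k := fun k => by
      have : t ^ k * w ^ k = 1 := by rw [← mul_pow, hw, one_pow]
      rw [Finset.mul_sum, Finset.mul_sum, Finset.mul_sum]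
      refine Finset.sum_congr rfl fun g _ => ?_
      rw [map_mul, mul_pow]
      linear_combination (χ h ^ k * m * χ g⁻¹ ^ k * c g) * this
    simp only [h1]
    rw [Finset.sum_comm, Fintype.sum_eq_single h]
    · simp only [mul_inv_cancel, map_one, one_pow, mul_one, Finset.sum_const, Finset.card_range,
        nsmul_eq_mul]
      rw [← mul_assoc, hm, one_mul]
    · intro g hg
      rw [← Finset.mul_sum, hχ.sum_pow _ (fun h' => hg (mul_inv_eq_one.mp h').symm), mul_zero]

end IsPrimitiveCharacter

end Kummer


/-! ### Stable open subsets -/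

section StableOpens

variable {G : Type v} [Group G] {X Y : Scheme.{u}}

/-- An open subset `V` of `X` is stable under the action of `G`. -/
def IsStable (ρ : G →* Aut X) (V : X.Opens) : Prop := ∀ g : G, V ≤ (ρ g).hom ⁻¹ᵁ V

lemma action_inv_apply (ρ : G →* Aut X) (g : G) (x : X) : (ρ g⁻¹).hom ((ρ g).hom x) = x := by
  rw [← Scheme.Hom.comp_apply, action_hom_inv]; rfl

lemma IsStable.preimage_eq {ρ : G →* Aut X} {V : X.Opens} (hV : IsStable ρ V) (g : G) :
    (ρ g).hom ⁻¹ᵁ V = V := by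
  refine le_antisymm (fun x hx => ?_) (hV g)
  have := hV g⁻¹ hx
  rwa [Scheme.Hom.mem_preimage, action_inv_apply] at this

lemma IsInvariant.apply_eq {ρ : G →* Aut X} {q : X ⟶ Y} (hq : IsInvariant ρ q) (g : G) (x : X) :
    q ((ρ g).hom x) = q x := by
  rw [← Scheme.Hom.comp_apply, hq g]

lemma IsInvariant.isStable_preimage {ρ : G →* Aut X} {q : X ⟶ Y} (hq : IsInvariant ρ q)
    (W : Y.Opens) : IsStable ρ (q ⁻¹ᵁ W) := fun g x hx => by
  rw [Scheme.Hom.mem_preimage, Scheme.Hom.mem_preimage, hq.apply_eq]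
  exact hx

/-- The action of `g` on the sections over a stable open subset. -/
def sectionsMap (ρ : G →* Aut X) {V : X.Opens} (hV : IsStable ρ V) (g : G) :
    Γ(X, V) ⟶ Γ(X, V) :=
  (ρ g).hom.appLE V V (hV g)

lemma sectionsMap_one (ρ : G →* Aut X) {V : X.Opens} (hV : IsStable ρ V) :
    sectionsMap ρ hV 1 = 𝟙 _ := by
  have : ∀ (k : X ⟶ X) (hk : k = 𝟙 X) (e : V ≤ k ⁻¹ᵁ V), k.appLE V V e = 𝟙 _ := by
    rintro k rfl e
    simp only [Scheme.Hom.appLE, Scheme.Hom.id_app]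
    exact X.presheaf.map_id _
  exact this _ (action_one_hom ρ) _

lemma sectionsMap_mul (ρ : G →* Aut X) {V : X.Opens} (hV : IsStable ρ V) (g h : G) :
    sectionsMap ρ hV (g * h) = sectionsMap ρ hV g ≫ sectionsMap ρ hV h := by
  have : ∀ (k : X ⟶ X) (hk : k = (ρ h).hom ≫ (ρ g).hom) (e : V ≤ k ⁻¹ᵁ V),
      k.appLE V V e = sectionsMap ρ hV g ≫ sectionsMap ρ hV h := by
    rintro k rfl e
    exact (Scheme.Hom.appLE_comp_appLE _ _ _ _ _ _ _).symm
  exact this _ (action_mul_hom ρ g h) _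

/-- The action of `G` on the sections over a stable open subset: `g` acts as the pullback of
functions along `g⁻¹`. -/
abbrev sectionsAction (ρ : G →* Aut X) {V : X.Opens} (hV : IsStable ρ V) :
    MulSemiringAction G Γ(X, V) where
  smul g a := sectionsMap ρ hV g⁻¹ a
  one_smul a := by
    change sectionsMap ρ hV 1⁻¹ a = a
    rw [inv_one, sectionsMap_one]; rfl
  mul_smul g h a := by
    change sectionsMap ρ hV (g * h)⁻¹ a = sectionsMap ρ hV g⁻¹ (sectionsMap ρ hV h⁻¹ a)
    rw [mul_inv_rev, sectionsMap_mul]; rfl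
  smul_zero g := map_zero (sectionsMap ρ hV g⁻¹).hom
  smul_add g := map_add (sectionsMap ρ hV g⁻¹).hom
  smul_one g := map_one (sectionsMap ρ hV g⁻¹).hom
  smul_mul g := map_mul (sectionsMap ρ hV g⁻¹).hom

lemma sectionsMap_map (ρ : G →* Aut X) {V V' : X.Opens} (hV : IsStable ρ V) (hV' : IsStable ρ V')
    (h : V' ≤ V) (g : G) :
    X.presheaf.map (homOfLE h).op ≫ sectionsMap ρ hV' g =
      sectionsMap ρ hV g ≫ X.presheaf.map (homOfLE h).op := by
  rw [sectionsMap, sectionsMap, Scheme.Hom.map_appLE, Scheme.Hom.appLE_map]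

lemma basicOpen_sectionsMap (ρ : G →* Aut X) {V : X.Opens} (hV : IsStable ρ V) (g : G)
    (a : Γ(X, V)) : X.basicOpen (sectionsMap ρ hV g a) = (ρ g).hom ⁻¹ᵁ X.basicOpen a := by
  rw [sectionsMap, Scheme.Hom.appLE, CommRingCat.comp_apply, Scheme.basicOpen_res,
    ← Scheme.preimage_basicOpen, inf_eq_right]
  exact ((ρ g).hom.preimage_mono (X.basicOpen_le a)).trans (hV.preimage_eq g).le

/-- The ideal of the sections over `V` vanishing at a point `x`. -/
noncomputable def idealAt (V : X.Opens) (x : X) (hx : x ∈ V) : Ideal Γ(X, V) :=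
  RingHom.ker (X.evaluation V x hx).hom

lemma mem_idealAt {V : X.Opens} {x : X} {hx : x ∈ V} {a : Γ(X, V)} :
    a ∈ idealAt V x hx ↔ x ∉ X.basicOpen a :=
  X.evaluation_eq_zero_iff_notMem_basicOpen x hx a

instance (V : X.Opens) (x : X) (hx : x ∈ V) : (idealAt V x hx).IsPrime :=
  RingHom.ker_isPrime _

lemma eq_of_idealAt_eq {V : X.Opens} (hV : IsAffineOpen V) {x y : X} (hx : x ∈ V) (hy : y ∈ V)
    (h : idealAt V x hx = idealAt V y hy) : x = y := by
  have h1 : ∀ a : Γ(X, V), x ∈ X.basicOpen a ↔ y ∈ X.basicOpen a := fun a => by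
    rw [← not_iff_not, ← mem_idealAt (hx := hx), ← mem_idealAt (hx := hy), h]
  by_contra hne
  obtain ⟨O, hO, hO'⟩ := exists_isOpen_xor_mem hne
  have h2 : ∀ x y : X, x ∈ V → (∀ a : Γ(X, V), x ∈ X.basicOpen a ↔ y ∈ X.basicOpen a) →
      x ∈ O → y ∈ O := fun x y hx hxy hxO => by
    obtain ⟨f, hf, hfx⟩ := hV.exists_basicOpen_le (V := ⟨O, hO⟩) ⟨x, hxO⟩ hx
    exact hf ((hxy f).mp hfx)
  rcases hO' with ⟨h3, h4⟩ | ⟨h3, h4⟩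
  · exact h4 (h2 x y hx h1 h3)
  · exact h4 (h2 y x hy (fun a => (h1 a).symm) h3)

end StableOpens

/-! ### Geometric quotients -/

section GeometricQuotient

variable {G : Type v} [Group G] {X Y : Scheme.{u}}

/-- The sections of `𝒪_Y` over `W` are the invariant sections of `q_* 𝒪_X` over `W`. -/
structure SectionsAreInvariants (ρ : G →* Aut X) {q : X ⟶ Y} (hq : IsInvariant ρ q)
    (W : Y.Opens) : Prop where
  injective : Function.Injective (q.app W)
  exists_app_eq : ∀ a : Γ(X, q ⁻¹ᵁ W), (∀ g, sectionsMap ρ (hq.isStable_preimage W) g a = a) →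
    ∃ b, q.app W b = a

/-- An invariant morphism `q : X ⟶ Y` is a geometric quotient for the action of a finite group if it
is affine and `𝒪_Y` is the sheaf of invariants of `q_* 𝒪_X`. -/
structure IsGeometricQuotient (ρ : G →* Aut X) (q : X ⟶ Y) : Prop where
  invariant : IsInvariant ρ q
  isAffineHom : IsAffineHom q
  sections : ∀ W, SectionsAreInvariants ρ invariant W

lemma IsInvariant.sectionsMap_app {ρ : G →* Aut X} {q : X ⟶ Y} (hq : IsInvariant ρ q)
    (W : Y.Opens) (g : G) (b : Γ(Y, W)) :
    sectionsMap ρ (hq.isStable_preimage W) g (q.app W b) = q.app W b := by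
  have : ∀ (k : X ⟶ Y) (hk : k = q) (e : q ⁻¹ᵁ W ≤ k ⁻¹ᵁ W),
      k.appLE W (q ⁻¹ᵁ W) e = q.app W := by
    rintro k rfl e
    rw [Scheme.Hom.appLE_eq_app]
  have h2 := this _ (hq g) (by rw [hq g])
  rw [Scheme.Hom.comp_appLE] at h2
  exact congrArg (fun f => f.hom b) h2

namespace IsGeometricQuotient

variable {ρ : G →* Aut X} {q : X ⟶ Y} (hq : IsGeometricQuotient ρ q)
include hq

lemma algebra_isInvariant (W : Y.Opens) :
    letI := sectionsAction ρ (hq.invariant.isStable_preimage W)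
    letI := (q.app W).hom.toAlgebra
    Algebra.IsInvariant Γ(Y, W) Γ(X, q ⁻¹ᵁ W) G := by
  let := sectionsAction ρ (hq.invariant.isStable_preimage W)
  let := (q.app W).hom.toAlgebra
  refine ⟨fun a ha => (hq.sections W).exists_app_eq a fun g => ?_⟩
  have := ha g⁻¹
  change sectionsMap ρ _ g⁻¹⁻¹ a = a at this
  rwa [inv_inv] at this

lemma smulCommClass (W : Y.Opens) :
    letI := sectionsAction ρ (hq.invariant.isStable_preimage W)
    letI := (q.app W).hom.toAlgebra
    SMulCommClass G Γ(Y, W) Γ(X, q ⁻¹ᵁ W) := by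
  let := sectionsAction ρ (hq.invariant.isStable_preimage W)
  let := (q.app W).hom.toAlgebra
  refine ⟨fun g b a => ?_⟩
  rw [Algebra.smul_def, Algebra.smul_def, smul_mul']
  congr 1
  exact hq.invariant.sectionsMap_app W g⁻¹ b

variable [Finite G]

lemma isIntegralHom : IsIntegralHom q := by
  have := hq.isAffineHom
  refine ⟨fun W hW => ?_⟩
  let := sectionsAction ρ (hq.invariant.isStable_preimage W)
  let := (q.app W).hom.toAlgebra
  have := hq.algebra_isInvariant W
  have := Algebra.IsInvariant.isIntegral Γ(Y, W) Γ(X, q ⁻¹ᵁ W) G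
  exact this.isIntegral

/-- The fibres of a geometric quotient are the orbits. -/
theorem exists_of_apply_eq {x y : X} (hxy : q x = q y) : ∃ g, (ρ g).hom x = y := by
  obtain ⟨W, hW, hxW, -⟩ := exists_isAffineOpen_mem_and_subset (U := ⊤) (x := q x) trivial
  have := hq.isAffineHom
  have hV : IsAffineOpen (q ⁻¹ᵁ W) := hW.preimage q
  have hxV : x ∈ q ⁻¹ᵁ W := hxW
  have hyW : y ∈ q ⁻¹ᵁ W := by rw [Scheme.Hom.mem_preimage, ← hxy]; exact hxW
  let := sectionsAction ρ (hq.invariant.isStable_preimage W)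
  let := (q.app W).hom.toAlgebra
  have := hq.algebra_isInvariant W
  have := hq.smulCommClass W
  have h1 : (idealAt (q ⁻¹ᵁ W) x hxV).under Γ(Y, W) = (idealAt (q ⁻¹ᵁ W) y hyW).under Γ(Y, W) := by
    ext b
    change q.app W b ∈ idealAt _ x hxV ↔ q.app W b ∈ idealAt _ y hyW
    rw [mem_idealAt, mem_idealAt, ← Scheme.preimage_basicOpen, Scheme.Hom.mem_preimage,
      Scheme.Hom.mem_preimage, hxy]
  obtain ⟨g, hg⟩ := Algebra.IsInvariant.exists_smul_of_under_eq Γ(Y, W) Γ(X, q ⁻¹ᵁ W) G _ _ h1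
  have hgx : (ρ g).hom x ∈ q ⁻¹ᵁ W := hq.invariant.isStable_preimage W g hxV
  refine ⟨g, (eq_of_idealAt_eq hV hyW hgx ?_).symm⟩
  rw [hg]
  ext a
  rw [mem_idealAt, Ideal.mem_pointwise_smul_iff_inv_smul_mem]
  change sectionsMap ρ _ g⁻¹⁻¹ a ∈ _ ↔ _
  rw [inv_inv, mem_idealAt, basicOpen_sectionsMap, Scheme.Hom.mem_preimage]

lemma isClosedMap : IsClosedMap q := by
  have := hq.isIntegralHom
  exact q.isClosedMap

/-- The image is closed, and over its complement `W` the map `𝒪(W) ⟶ 𝒪(q ⁻¹ W) = 0` is injective, so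
that `W` is empty. -/
lemma surjective : Function.Surjective q := by
  intro y
  by_contra hy
  let W : Y.Opens := ⟨(Set.range q)ᶜ, hq.isClosedMap.isClosed_range.isOpen_compl⟩
  have hW : q ⁻¹ᵁ W = ⊥ := by
    ext x
    simp [W]
  have h1 : Subsingleton Γ(X, q ⁻¹ᵁ W) := by
    rw [hW]
    exact CommRingCat.subsingleton_of_isTerminal X.sheaf.isTerminalOfEmpty
  have h2 : (1 : Γ(Y, W)) = 0 := (hq.sections W).injective (Subsingleton.elim _ _)
  have h3 : Y.basicOpen (1 : Γ(Y, W)) = W := Scheme.basicOpen_of_isUnit _ isUnit_one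
  rw [h2, Scheme.basicOpen_zero] at h3
  have : y ∈ W := hy
  rw [← h3] at this
  exact this

lemma epi : Epi q := by
  refine ⟨fun {Z} h h' hh => ?_⟩
  have hb : h.base = h'.base := by
    ext y
    obtain ⟨x, rfl⟩ := hq.surjective y
    have := congrArg (fun f => f.base x) hh
    simpa using this
  refine Scheme.Hom.ext hb fun U => ?_
  ext s
  refine (hq.sections _).injective ?_
  have h1 : ∀ (k k' : X ⟶ Z) (V : X.Opens) (e : V ≤ k ⁻¹ᵁ U) (e' : V ≤ k' ⁻¹ᵁ U), k = k' →
      k.appLE U V e = k'.appLE U V e' := by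
    rintro k _ V e e' rfl
    rfl
  have h2 := h1 _ _ (q ⁻¹ᵁ h' ⁻¹ᵁ U) (by rw [hh]; rfl) le_rfl hh
  rw [← Scheme.Hom.appLE_comp_appLE q h U (h' ⁻¹ᵁ U) _ (by
      intro y hy; change h.base y ∈ U; rw [hb]; exact hy) le_rfl,
    ← Scheme.Hom.appLE_comp_appLE q h' U (h' ⁻¹ᵁ U) _ le_rfl le_rfl,
    Scheme.Hom.appLE_eq_app, Scheme.Hom.appLE_eq_app] at h2
  exact congrArg (fun f => f.hom s) h2

end IsGeometricQuotient

end GeometricQuotient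


/-! ### Restriction and universality of geometric quotients -/

section Restriction

variable {G : Type v} [Group G] {X Y X' Y' : Scheme.{u}}

lemma appLE_congr_hom {k k' : X ⟶ Y} (h : k = k') (U : Y.Opens) (V : X.Opens) (e : V ≤ k ⁻¹ᵁ U) :
    k.appLE U V e = k'.appLE U V (h ▸ e) := by
  subst h; rfl

lemma isIso_appLE_of_image_eq (j : X ⟶ Y) [IsOpenImmersion j] {U : X.Opens} {V : Y.Opens}
    (h : j ''ᵁ U = V) (e : U ≤ j ⁻¹ᵁ V) : IsIso (j.appLE V U e) := by
  subst h
  rw [← Scheme.Hom.appIso_hom']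
  infer_instance

lemma sectionsMap_comp_appLE {ρ : G →* Aut X} {ρ' : G →* Aut X'} {j : X' ⟶ X}
    (hj : ∀ g, (ρ' g).hom ≫ j = j ≫ (ρ g).hom) {V : X.Opens} (hV : IsStable ρ V)
    {V' : X'.Opens} (hV' : IsStable ρ' V') (e : V' ≤ j ⁻¹ᵁ V) (g : G) :
    sectionsMap ρ hV g ≫ j.appLE V V' e = j.appLE V V' e ≫ sectionsMap ρ' hV' g := by
  rw [sectionsMap, sectionsMap, Scheme.Hom.appLE_comp_appLE, Scheme.Hom.appLE_comp_appLE,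
    appLE_congr_hom (hj g)]

lemma hom_ext_of_isOpenCover {κ : Type u} {V : κ → Y.Opens} (hV : TopologicalSpace.IsOpenCover V)
    {Z : Scheme.{u}} {h h' : Y ⟶ Z} (hh : ∀ i, (V i).ι ≫ h = (V i).ι ≫ h') : h = h' :=
  (Y.openCoverOfIsOpenCover V hV).hom_ext _ _ hh

lemma exists_glue {κ : Type u} {V : κ → Y.Opens} (hV : TopologicalSpace.IsOpenCover V)
    {Z : Scheme.{u}} (h : ∀ i, (V i : Scheme.{u}) ⟶ Z)
    (hh : ∀ i j, Y.homOfLE inf_le_left ≫ h i = Y.homOfLE (inf_le_right (a := V i)) ≫ h j) :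
    ∃ H : Y ⟶ Z, ∀ i, (V i).ι ≫ H = h i := by
  have hcomp : ∀ i j : κ, pullback.fst (V i).ι (V j).ι ≫ h i =
      pullback.snd (V i).ι (V j).ι ≫ h j := fun i j => by
    let l : pullback (V i).ι (V j).ι ⟶ ((V i ⊓ V j : Y.Opens) : Scheme.{u}) :=
      IsOpenImmersion.lift (V i ⊓ V j).ι (pullback.fst _ _ ≫ (V i).ι) (by
        rintro _ ⟨p, rfl⟩
        rw [Scheme.Opens.range_ι]
        refine ⟨?_, ?_⟩
        · rw [Scheme.Hom.comp_apply]; exact Subtype.prop _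
        · rw [pullback.condition, Scheme.Hom.comp_apply]; exact Subtype.prop _)
    have hl : l ≫ (V i ⊓ V j).ι = pullback.fst _ _ ≫ (V i).ι := IsOpenImmersion.lift_fac _ _ _
    have h1 : pullback.fst (V i).ι (V j).ι = l ≫ Y.homOfLE inf_le_left := by
      rw [← cancel_mono (V i).ι, Category.assoc, Scheme.homOfLE_ι, hl]
    have h2 : pullback.snd (V i).ι (V j).ι = l ≫ Y.homOfLE inf_le_right := by
      rw [← cancel_mono (V j).ι, Category.assoc, Scheme.homOfLE_ι, hl, pullback.condition]
    rw [h1, h2, Category.assoc, Category.assoc, hh]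
  exact ⟨(Y.openCoverOfIsOpenCover V hV).glueMorphisms h hcomp,
    fun i => (Y.openCoverOfIsOpenCover V hV).ι_glueMorphisms h hcomp i⟩

namespace IsGeometricQuotient

variable {ρ : G →* Aut X} {q : X ⟶ Y}

/-- The base change of a geometric quotient to an open subscheme is a geometric quotient. -/
theorem of_isPullback (hq : IsGeometricQuotient ρ q) {ρ' : G →* Aut X'} {q' : X' ⟶ Y'}
    {j : X' ⟶ X} {k : Y' ⟶ Y} [IsOpenImmersion j] [IsOpenImmersion k]
    (hj : ∀ g, (ρ' g).hom ≫ j = j ≫ (ρ g).hom) (h : IsPullback q' j k q) :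
    IsGeometricQuotient ρ' q' := by
  have hinv : IsInvariant ρ' q' := fun g => by
    rw [← cancel_mono k, Category.assoc, h.w, reassoc_of% hj g, hq.invariant g]
  refine ⟨hinv, MorphismProperty.of_isPullback h.flip hq.isAffineHom, fun W => ?_⟩
  have hU : j ''ᵁ q' ⁻¹ᵁ W = q ⁻¹ᵁ k ''ᵁ W :=
    IsOpenImmersion.image_preimage_eq_preimage_image_of_isPullback h W
  have hle : q' ⁻¹ᵁ W ≤ j ⁻¹ᵁ q ⁻¹ᵁ k ''ᵁ W := by rw [← hU, Scheme.Hom.preimage_image_eq]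
  have hk : W ≤ k ⁻¹ᵁ k ''ᵁ W := by rw [Scheme.Hom.preimage_image_eq]
  have hi1 := isIso_appLE_of_image_eq j hU hle
  have hi2 := isIso_appLE_of_image_eq k rfl hk
  have hsq : k.appLE _ W hk ≫ q'.app W = q.app _ ≫ j.appLE _ _ hle := by
    rw [← Scheme.Hom.appLE_eq_app, ← Scheme.Hom.appLE_eq_app, Scheme.Hom.appLE_comp_appLE,
      Scheme.Hom.appLE_comp_appLE, appLE_congr_hom h.w]
  have hb1 := ConcreteCategory.bijective_of_isIso (j.appLE _ _ hle)
  have hb2 := ConcreteCategory.bijective_of_isIso (k.appLE _ W hk)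
  have hsq' : ∀ b, q'.app W (k.appLE _ W hk b) = j.appLE _ _ hle (q.app _ b) := fun b =>
    congrArg (fun f => f.hom b) hsq
  constructor
  · intro b b' hbb
    obtain ⟨c, rfl⟩ := hb2.2 b
    obtain ⟨c', rfl⟩ := hb2.2 b'
    rw [hsq', hsq'] at hbb
    rw [(hq.sections _).injective (hb1.1 hbb)]
  · intro a ha
    obtain ⟨c, rfl⟩ := hb1.2 a
    obtain ⟨b, rfl⟩ := (hq.sections (k ''ᵁ W)).exists_app_eq c fun g => hb1.1 (by
      rw [← ha g]
      exact congrArg (fun f => f.hom c) (sectionsMap_comp_appLE hj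
        (hq.invariant.isStable_preimage _) (hinv.isStable_preimage W) hle g))
    exact ⟨k.appLE _ W hk b, hsq' b⟩

lemma restrictAction_comp_ι (ρ : G →* Aut X) {U : X.Opens} (hU : IsStable ρ U) (g : G) :
    (restrictAction ρ U hU g).hom ≫ U.ι = U.ι ≫ (ρ g).hom :=
  Scheme.Hom.resLE_comp_ι _ _

/-- The restriction of a geometric quotient to an open subset of the target. -/
theorem restrict (hq : IsGeometricQuotient ρ q) {U : X.Opens} (hU : IsStable ρ U) {V : Y.Opens}
    (hUV : U = q ⁻¹ᵁ V) : IsGeometricQuotient (restrictAction ρ U hU) (q.resLE V U hUV.le) := by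
  subst hUV
  rw [Scheme.Hom.resLE_eq_morphismRestrict]
  exact hq.of_isPullback (restrictAction_comp_ι ρ hU) (isPullback_morphismRestrict q V)

variable [Finite G]

/-- Morphisms to a scheme which agree after composition with a geometric quotient agree. -/
lemma hom_ext_restrict (hq : IsGeometricQuotient ρ q) {V : Y.Opens} {Z : Scheme.{u}}
    {h h' : (V : Scheme.{u}) ⟶ Z} (hh : (q ∣_ V) ≫ h = (q ∣_ V) ≫ h') : h = h' := by
  have := hq.restrict (hq.invariant.isStable_preimage V) rfl
  rw [Scheme.Hom.resLE_eq_morphismRestrict] at this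
  have := this.epi
  exact (cancel_epi _).mp hh

/-- The image of a stable open subset under a geometric quotient is open, and the subset is its full
inverse image. -/
lemma exists_opens_preimage_eq (hq : IsGeometricQuotient ρ q) {U : X.Opens} (hU : IsStable ρ U) :
    ∃ V : Y.Opens, U = q ⁻¹ᵁ V ∧ (V : Set Y) = q '' U := by
  let V : Y.Opens := ⟨(q '' (U : Set X)ᶜ)ᶜ, (hq.isClosedMap _ U.isOpen.isClosed_compl).isOpen_compl⟩
  have h1 : U = q ⁻¹ᵁ V := by
    ext x
    refine ⟨fun hx => ?_, fun hx => ?_⟩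
    · rintro ⟨y, hy, hyx⟩
      obtain ⟨g, rfl⟩ := hq.exists_of_apply_eq hyx.symm
      exact hy (hU g hx)
    · by_contra hx'
      exact hx ⟨x, hx', rfl⟩
  refine ⟨V, h1, ?_⟩
  have h2 : (U : Set X) = q ⁻¹' (V : Set Y) := congrArg (fun O : X.Opens => (O : Set X)) h1
  rw [h2, Set.image_preimage_eq _ hq.surjective]

/-- A geometric quotient is a categorical quotient: as stable open subsets are inverse images of
open subsets, an invariant morphism to `Z` is, locally on the quotient, a morphism to an affine open
subset of `Z`, where it is given by invariant functions. -/
theorem isCategoricalQuotient (hq : IsGeometricQuotient ρ q) : IsCategoricalQuotient ρ q := by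
  refine ⟨hq.invariant, fun Z r hr => ?_⟩
  have hloc : ∀ x : X, ∃ V : Y.Opens, q x ∈ V ∧ ∃ h : (V : Scheme.{u}) ⟶ Z,
      (q ∣_ V) ≫ h = (q ⁻¹ᵁ V).ι ≫ r := by
    intro x
    obtain ⟨U', hU', hxU', -⟩ := exists_isAffineOpen_mem_and_subset (U := ⊤) (x := r x) trivial
    obtain ⟨V, hV, -⟩ := hq.exists_opens_preimage_eq (hr.isStable_preimage U')
    have hxV : x ∈ q ⁻¹ᵁ V := by rw [← hV]; exact hxU'
    refine ⟨V, hxV, ?_⟩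
    have hle : q ⁻¹ᵁ V ≤ r ⁻¹ᵁ U' := hV.ge
    have hinvt : ∀ (a : Γ(Z, U')) (g : G), sectionsMap ρ (hq.invariant.isStable_preimage V) g
        (r.appLE U' _ hle a) = r.appLE U' _ hle a := fun a g => by
      have h1 : r.appLE U' _ hle ≫ sectionsMap ρ (hq.invariant.isStable_preimage V) g =
          r.appLE U' _ hle := by
        rw [sectionsMap, Scheme.Hom.appLE_comp_appLE, appLE_congr_hom (hr g)]
      exact congrArg (fun f => f.hom a) h1
    have hb : ∀ a : Γ(Z, U'), ∃ b, q.app V b = r.appLE U' _ hle a := fun a =>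
      (hq.sections V).exists_app_eq _ (hinvt a)
    choose ψ hψ using hb
    let Ψ : Γ(Z, U') →+* Γ(Y, V) :=
      { toFun := ψ
        map_one' := (hq.sections V).injective (by rw [hψ, map_one, map_one])
        map_zero' := (hq.sections V).injective (by rw [hψ, map_zero, map_zero])
        map_add' := fun a b => (hq.sections V).injective (by
          rw [hψ, map_add, map_add, hψ, hψ])
        map_mul' := fun a b => (hq.sections V).injective (by
          rw [hψ, map_mul, map_mul, hψ, hψ]) }
    have hΨ : CommRingCat.ofHom Ψ ≫ q.app V = r.appLE U' _ hle := by
      ext a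
      exact hψ a
    refine ⟨V.toSpecΓ ≫ Spec.map (CommRingCat.ofHom Ψ) ≫ hU'.fromSpec, ?_⟩
    rw [← Scheme.Opens.toSpecΓ_naturality_assoc, ← Spec.map_comp_assoc, hΨ,
      Scheme.Opens.toSpecΓ_SpecMap_appLE_assoc, IsAffineOpen.toSpecΓ_fromSpec,
      Scheme.Hom.resLE_comp_ι]
  choose V hV h hh using hloc
  have hcov : TopologicalSpace.IsOpenCover V := by
    refine .mk (top_le_iff.mp fun y _ => ?_)
    obtain ⟨x, rfl⟩ := hq.surjective y
    exact TopologicalSpace.Opens.mem_iSup.mpr ⟨x, hV x⟩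
  have hcomp : ∀ x y, Y.homOfLE inf_le_left ≫ h x = Y.homOfLE (inf_le_right (a := V x)) ≫ h y :=
      fun x y => by
    refine hq.hom_ext_restrict ?_
    rw [morphismRestrict_homOfLE_assoc, morphismRestrict_homOfLE_assoc, hh, hh,
      Scheme.homOfLE_ι_assoc, Scheme.homOfLE_ι_assoc]
  obtain ⟨H, hH⟩ := exists_glue hcov h hcomp
  refine ⟨H, ?_, fun H' hH' => ?_⟩
  · have hcov' : TopologicalSpace.IsOpenCover fun x => q ⁻¹ᵁ V x :=
      .mk (top_le_iff.mp fun x _ => TopologicalSpace.Opens.mem_iSup.mpr ⟨x, hV x⟩)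
    refine hom_ext_of_isOpenCover hcov' fun x => ?_
    rw [← hh, ← hH, morphismRestrict_ι_assoc]
  · refine hom_ext_of_isOpenCover hcov fun x => ?_
    refine hq.hom_ext_restrict ?_
    rw [hH, hh, ← hH', morphismRestrict_ι_assoc]

end IsGeometricQuotient

/-- Categorical quotients are unique up to isomorphism. -/
lemma IsCategoricalQuotient.exists_iso {ρ : G →* Aut X} {q : X ⟶ Y} {q' : X ⟶ Y'}
    (hq : IsCategoricalQuotient ρ q) (hq' : IsCategoricalQuotient ρ q') :
    ∃ e : Y ≅ Y', q ≫ e.hom = q' := by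
  obtain ⟨a, ha, -⟩ := hq.existsUnique_desc _ q' hq'.invariant
  obtain ⟨b, hb, -⟩ := hq'.existsUnique_desc _ q hq.invariant
  refine ⟨⟨a, b, ?_, ?_⟩, ha⟩
  · exact (hq.existsUnique_desc _ q hq.invariant).unique
      (by rw [← Category.assoc, ha, hb]) (Category.comp_id _)
  · exact (hq'.existsUnique_desc _ q' hq'.invariant).unique
      (by rw [← Category.assoc, hb, ha]) (Category.comp_id _)

/-- A categorical quotient is geometric as soon as some geometric quotient exists. -/
lemma IsCategoricalQuotient.isGeometricQuotient {ρ : G →* Aut X} [Finite G] {q : X ⟶ Y}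
    {q' : X ⟶ Y'} (hq : IsCategoricalQuotient ρ q) (hq' : IsGeometricQuotient ρ q') :
    IsGeometricQuotient ρ q := by
  obtain ⟨e, he⟩ := hq.exists_iso hq'.isCategoricalQuotient
  refine hq'.of_isPullback (j := 𝟙 X) (k := e.hom) (fun g => by simp) ?_
  exact IsPullback.of_vert_isIso ⟨by rw [he, Category.id_comp]⟩

end Restriction


/-! ### Local criteria for geometric quotients -/

section LocalCriterion

variable {G : Type v} [Group G] {X Y X' Y' : Scheme.{u}} {ρ : G →* Aut X} {q : X ⟶ Y}

/-- Being the sheaf of invariants may be tested on a basis of open subsets. -/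
lemma sectionsAreInvariants_of_basis (hq : IsInvariant ρ q)
    (h : ∀ (O : Y.Opens) (y : Y), y ∈ O → ∃ W ≤ O, y ∈ W ∧ SectionsAreInvariants ρ hq W)
    (W : Y.Opens) : SectionsAreInvariants ρ hq W := by
  have hres : ∀ {O O' : Y.Opens} (e : O' ≤ O) (b : Γ(Y, O)),
      q.app O' (Y.presheaf.map (homOfLE e).op b) =
        X.presheaf.map (homOfLE (q.preimage_mono e)).op (q.app O b) := fun e b =>
    congrArg (fun f => f.hom b) (q.naturality (homOfLE e).op)
  have hinj : ∀ O : Y.Opens, Function.Injective (q.app O) := by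
    intro O b b' hbb
    choose N hN hyN hNs using fun y : O => h O y.1 y.2
    refine Y.sheaf.eq_of_locally_eq' N O (fun y => homOfLE (hN y))
      (fun y hy => TopologicalSpace.Opens.mem_iSup.mpr ⟨⟨y, hy⟩, hyN _⟩) _ _ fun y => ?_
    refine (hNs y).injective ?_
    refine (hres (hN y) b).trans (Eq.trans ?_ (hres (hN y) b').symm)
    rw [hbb]
  refine ⟨hinj W, fun a ha => ?_⟩
  choose N hN hyN hNs using fun y : W => h W y.1 y.2
  have hb : ∀ y : W, ∃ b : Γ(Y, N y), q.app (N y) b =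
      X.presheaf.map (homOfLE (q.preimage_mono (hN y))).op a := fun y => by
    refine (hNs y).exists_app_eq _ fun g => ?_
    have h1 := congrArg (fun f => f.hom a) (sectionsMap_map ρ (hq.isStable_preimage W)
      (hq.isStable_preimage (N y)) (q.preimage_mono (hN y)) g)
    refine Eq.trans h1 ?_
    change X.presheaf.map _ (sectionsMap ρ _ g a) = _
    rw [ha g]
  choose b hb using hb
  obtain ⟨s, hs, -⟩ := Y.sheaf.existsUnique_gluing' N W (fun y => homOfLE (hN y))
    (fun y hy => TopologicalSpace.Opens.mem_iSup.mpr ⟨⟨y, hy⟩, hyN _⟩) b (fun y z => by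
      refine hinj _ ?_
      refine (hres inf_le_left (b y)).trans (Eq.trans ?_ (hres inf_le_right (b z)).symm)
      rw [hb, hb, ← CommRingCat.comp_apply, ← CommRingCat.comp_apply, ← Functor.map_comp,
        ← Functor.map_comp]
      rfl)
  refine ⟨s, X.sheaf.eq_of_locally_eq' (fun y => q ⁻¹ᵁ N y) _
    (fun y => homOfLE (q.preimage_mono (hN y)))
    (fun x hx => TopologicalSpace.Opens.mem_iSup.mpr ⟨⟨q x, hx⟩, hyN _⟩) _ _ fun y => ?_⟩
  refine (hres (hN y) s).symm.trans (Eq.trans ?_ (hb y))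
  exact congrArg (q.app (N y)) (hs y)

variable [Finite G]

/-- The formation of invariants commutes with localization at an invariant element. -/
lemma SectionsAreInvariants.basicOpen {hq : IsInvariant ρ q} {W : Y.Opens} (hW : IsAffineOpen W)
    (hW' : IsAffineOpen (q ⁻¹ᵁ W)) (h : SectionsAreInvariants ρ hq W) (b : Γ(Y, W)) :
    SectionsAreInvariants ρ hq (Y.basicOpen b) := by
  have hle : Y.basicOpen b ≤ W := Y.basicOpen_le b
  have hle' : q ⁻¹ᵁ Y.basicOpen b ≤ q ⁻¹ᵁ W := q.preimage_mono hle
  let rY : Γ(Y, W) →+* Γ(Y, Y.basicOpen b) := (Y.presheaf.map (homOfLE hle).op).hom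
  let rX : Γ(X, q ⁻¹ᵁ W) →+* Γ(X, q ⁻¹ᵁ Y.basicOpen b) := (X.presheaf.map (homOfLE hle').op).hom
  let := rY.toAlgebra
  let := rX.toAlgebra
  have hlY : IsLocalization.Away b Γ(Y, Y.basicOpen b) :=
    hW.isLocalization_of_eq_basicOpen b (homOfLE hle) rfl
  have hlX : IsLocalization.Away (q.app W b) Γ(X, q ⁻¹ᵁ Y.basicOpen b) :=
    hW'.isLocalization_of_eq_basicOpen (q.app W b) (homOfLE hle') (by
      rw [Scheme.preimage_basicOpen])
  have hres : ∀ c : Γ(Y, W), q.app _ (rY c) = rX (q.app W c) := fun c =>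
    congrArg (fun f => f.hom c) (q.naturality (homOfLE hle).op)
  have hg : ∀ (g : G) (a : Γ(X, q ⁻¹ᵁ W)), sectionsMap ρ (hq.isStable_preimage _) g (rX a) =
      rX (sectionsMap ρ (hq.isStable_preimage W) g a) := fun g a =>
    congrArg (fun f => f.hom a) (sectionsMap_map ρ (hq.isStable_preimage W)
      (hq.isStable_preimage _) hle' g)
  have hbu : IsUnit (rY b) := IsLocalization.Away.algebraMap_isUnit b
  have hkill : ∀ a : Γ(X, q ⁻¹ᵁ W), rX a = 0 → ∃ k, q.app W b ^ k * a = 0 := fun a ha => by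
    obtain ⟨⟨_, k, rfl⟩, hk⟩ := (IsLocalization.map_eq_zero_iff
      (Submonoid.powers (q.app W b)) Γ(X, q ⁻¹ᵁ Y.basicOpen b) a).mp ha
    exact ⟨k, hk⟩
  constructor
  · refine (injective_iff_map_eq_zero (q.app _).hom).mpr fun c hc => ?_
    obtain ⟨k, d, hd⟩ := IsLocalization.Away.surj b c
    have hd' : c * rY b ^ k = rY d := hd
    have h1 : rX (q.app W d) = 0 := by
      rw [← hres, ← hd', map_mul]
      exact (congrArg (· * _) hc).trans (zero_mul _)
    obtain ⟨m, hm⟩ := hkill _ h1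
    have h2 : b ^ m * d = 0 := h.injective (by rw [map_mul, map_pow, map_zero, hm])
    have h3 : rY b ^ m * rY d = 0 := by rw [← map_pow, ← map_mul, h2, map_zero]
    rw [← hd', ((hbu.pow m).mul_right_eq_zero), ((hbu.pow k).mul_left_eq_zero)] at h3
    exact h3
  · intro a ha
    obtain ⟨k, d, hd⟩ := IsLocalization.Away.surj (q.app W b) a
    have hd' : a * rX (q.app W b) ^ k = rX d := hd
    -- With denominators cleared, an invariant fraction `d / b ^ k` has a numerator which becomes
    -- invariant after multiplication with a power of `b`.
    have h1 : ∀ g, ∃ m, q.app W b ^ m * (sectionsMap ρ (hq.isStable_preimage W) g d - d) = 0 :=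
        fun g => by
      refine hkill _ ?_
      rw [map_sub, ← hg, ← hd', map_mul, ha, map_pow, hg, hq.sectionsMap_app, sub_self]
    choose m hm using h1
    classical
    cases nonempty_fintype G
    obtain ⟨d', hd''⟩ := h.exists_app_eq (q.app W b ^ (∑ g, m g) * d) fun g => by
      rw [map_mul, map_pow, hq.sectionsMap_app, ← sub_eq_zero, ← mul_sub,
        ← Finset.sum_erase_add _ _ (Finset.mem_univ g), pow_add, mul_assoc, hm, mul_zero]
    have hbu' : IsUnit (rY b ^ (∑ g, m g + k)) := hbu.pow _
    obtain ⟨v, hv⟩ := isUnit_iff_exists_inv'.mp hbu'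
    refine ⟨rY d' * v, ?_⟩
    have h4 : IsUnit (q.app _ (rY b ^ (∑ g, m g + k))) := hbu'.map (q.app (Y.basicOpen b)).hom
    refine h4.mul_left_injective ?_
    change q.app _ (rY d' * v) * q.app _ (rY b ^ (∑ g, m g + k)) =
      a * q.app _ (rY b ^ (∑ g, m g + k))
    rw [← map_mul, mul_assoc, hv, mul_one, map_pow, hres, hres, hd'', map_mul,
      ← hd', map_pow]
    ring

omit [Finite G] in
/-- To be the sheaf of invariants may be tested after restriction to open subschemes. -/
lemma sectionsAreInvariants_image {ρ' : G →* Aut X'} {q' : X' ⟶ Y'} (hq : IsInvariant ρ q)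
    (hq' : IsInvariant ρ' q')
    {j : X' ⟶ X} {k : Y' ⟶ Y} [IsOpenImmersion j] [IsOpenImmersion k]
    (hj : ∀ g, (ρ' g).hom ≫ j = j ≫ (ρ g).hom) (h : IsPullback q' j k q)
    {W : Y'.Opens} (hW : SectionsAreInvariants ρ' hq' W) :
    SectionsAreInvariants ρ hq (k ''ᵁ W) := by
  have hU : j ''ᵁ q' ⁻¹ᵁ W = q ⁻¹ᵁ k ''ᵁ W :=
    IsOpenImmersion.image_preimage_eq_preimage_image_of_isPullback h W
  have hle : q' ⁻¹ᵁ W ≤ j ⁻¹ᵁ q ⁻¹ᵁ k ''ᵁ W := by rw [← hU, Scheme.Hom.preimage_image_eq]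
  have hk : W ≤ k ⁻¹ᵁ k ''ᵁ W := by rw [Scheme.Hom.preimage_image_eq]
  have hi1 := isIso_appLE_of_image_eq j hU hle
  have hi2 := isIso_appLE_of_image_eq k rfl hk
  have hsq : k.appLE _ W hk ≫ q'.app W = q.app _ ≫ j.appLE _ _ hle := by
    rw [← Scheme.Hom.appLE_eq_app, ← Scheme.Hom.appLE_eq_app, Scheme.Hom.appLE_comp_appLE,
      Scheme.Hom.appLE_comp_appLE, appLE_congr_hom h.w]
  have hb1 := ConcreteCategory.bijective_of_isIso (j.appLE _ _ hle)
  have hb2 := ConcreteCategory.bijective_of_isIso (k.appLE _ W hk)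
  have hsq' : ∀ b, q'.app W (k.appLE _ W hk b) = j.appLE _ _ hle (q.app _ b) := fun b =>
    congrArg (fun f => f.hom b) hsq
  constructor
  · intro b b' hbb
    exact hb2.1 (hW.injective (by rw [hsq', hsq', hbb]))
  · intro a ha
    obtain ⟨b, hb⟩ := hW.exists_app_eq (j.appLE _ _ hle a) fun g => by
      have := congrArg (fun f => f.hom a) (sectionsMap_comp_appLE hj
        (hq.isStable_preimage _) (hq'.isStable_preimage W) hle g)
      refine Eq.trans this.symm ?_
      change j.appLE _ _ hle (sectionsMap ρ _ g a) = _
      rw [ha]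
    obtain ⟨c, rfl⟩ := hb2.2 b
    exact ⟨c, hb1.1 (by rw [← hsq', hb])⟩

omit [Finite G] in
/-- Geometric quotients are local on the target. -/
theorem IsGeometricQuotient.of_forall_exists_isPullback (hq : IsInvariant ρ q)
    (h : ∀ y : Y, ∃ (X' Y' : Scheme.{u}) (ρ' : G →* Aut X') (q' : X' ⟶ Y') (j : X' ⟶ X)
      (k : Y' ⟶ Y) (_ : IsOpenImmersion j) (_ : IsOpenImmersion k), y ∈ Set.range k ∧
      IsGeometricQuotient ρ' q' ∧ IsPullback q' j k q ∧
      ∀ g, (ρ' g).hom ≫ j = j ≫ (ρ g).hom) : IsGeometricQuotient ρ q := by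
  refine ⟨hq, isAffineHom_of_forall_exists_isAffineOpen _ fun y => ?_,
    sectionsAreInvariants_of_basis hq fun O y hy => ?_⟩
  · obtain ⟨X', Y', ρ', q', j, k, _, _, ⟨y', rfl⟩, hq', hp, hj⟩ := h y
    obtain ⟨W, hW, hyW, -⟩ := exists_isAffineOpen_mem_and_subset (U := ⊤) (x := y') trivial
    have := hq'.isAffineHom
    refine ⟨k ''ᵁ W, ⟨y', hyW, rfl⟩, hW.image_of_isOpenImmersion k, ?_⟩
    rw [← IsOpenImmersion.image_preimage_eq_preimage_image_of_isPullback hp]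
    exact (hW.preimage q').image_of_isOpenImmersion j
  · obtain ⟨X', Y', ρ', q', j, k, _, _, ⟨y', rfl⟩, hq', hp, hj⟩ := h y
    refine ⟨k ''ᵁ k ⁻¹ᵁ O, ?_, ⟨y', hy, rfl⟩,
      sectionsAreInvariants_image hq hq'.invariant hj hp (hq'.sections _)⟩
    rw [Scheme.Hom.image_preimage_eq_opensRange_inf]
    exact inf_le_right

end LocalCriterion

/-! ### Quotients of affine schemes -/

section Affine

variable {G : Type v} [Group G] {X : Scheme.{u}} (ρ : G →* Aut X)

lemma isStable_top : IsStable ρ ⊤ := fun _ => le_top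

/-- The ring of invariant global functions. -/
def invariantFunctions : Subring Γ(X, ⊤) :=
  letI := sectionsAction ρ (isStable_top ρ)
  FixedPoints.subring Γ(X, ⊤) G

lemma mem_invariantFunctions {a : Γ(X, ⊤)} :
    a ∈ invariantFunctions ρ ↔ ∀ g, (ρ g).hom.appTop a = a := by
  have h : ∀ g, sectionsMap ρ (isStable_top ρ) g = (ρ g).hom.appTop := fun g =>
    Scheme.Hom.appLE_eq_app _
  refine ⟨fun ha g => ?_, fun ha g => ?_⟩
  · rw [← h]
    have : sectionsMap ρ (isStable_top ρ) g⁻¹⁻¹ a = a := ha g⁻¹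
    rwa [inv_inv] at this
  · change sectionsMap ρ (isStable_top ρ) g⁻¹ a = a
    rw [h, ha]

/-- The spectrum of the ring of invariants is a geometric quotient of an affine scheme. -/
theorem isGeometricQuotient_of_isAffine [Finite G] [IsAffine X] : IsGeometricQuotient ρ
    (X.toSpecΓ ≫ Spec.map (CommRingCat.ofHom (invariantFunctions ρ).subtype)) := by
  set r := X.toSpecΓ ≫ Spec.map (CommRingCat.ofHom (invariantFunctions ρ).subtype) with hr
  have hinv : IsInvariant ρ r := fun g => by
    have h1 : ∀ k : X ⟶ X, k ≫ r = X.toSpecΓ ≫ Spec.map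
        (CommRingCat.ofHom (invariantFunctions ρ).subtype ≫ k.appTop) := fun k => by
      rw [hr, ← Category.assoc, Scheme.toSpecΓ_naturality, Category.assoc, ← Spec.map_comp]
    refine (h1 _).trans ?_
    rw [hr]
    congr 2
    ext a
    exact (mem_invariantFunctions ρ).mp a.2 g
  have happ : r.appTop = (Scheme.ΓSpecIso _).hom ≫
      CommRingCat.ofHom (invariantFunctions ρ).subtype := by
    rw [hr, Scheme.Hom.comp_appTop, Scheme.toSpecΓ_appTop, Scheme.ΓSpecIso_naturality]
  have htop : SectionsAreInvariants ρ hinv ⊤ := by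
    have hb := ConcreteCategory.bijective_of_isIso
      (Scheme.ΓSpecIso (CommRingCat.of (invariantFunctions ρ))).hom
    constructor
    · change Function.Injective r.appTop
      rw [happ]
      exact (Subring.subtype_injective _).comp hb.1
    · intro a ha
      obtain ⟨c, hc⟩ := hb.2 (⟨a, (mem_invariantFunctions ρ).mpr fun g => by
        have h1 := ha g
        have h2 : sectionsMap ρ (hinv.isStable_preimage ⊤) g = (ρ g).hom.appTop :=
          Scheme.Hom.appLE_eq_app _
        rwa [h2] at h1⟩ : invariantFunctions ρ)
      refine ⟨c, ?_⟩
      have h3 := congrArg (fun f => f.hom c) happ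
      refine Eq.trans h3 ?_
      change ((Scheme.ΓSpecIso (CommRingCat.of (invariantFunctions ρ))).hom c).1 = a
      rw [hc]
  refine ⟨hinv, inferInstance, sectionsAreInvariants_of_basis hinv fun O y hy => ?_⟩
  obtain ⟨b, hb, hyb⟩ := (isAffineOpen_top (Spec _)).exists_basicOpen_le ⟨y, hy⟩ trivial
  exact ⟨_, hb, hyb, htop.basicOpen (isAffineOpen_top _) (isAffineOpen_top X) b⟩

end Affine


/-! ### Existence of geometric quotients by gluing -/

section Existence

variable {G : Type v} [Group G] {X : Scheme.{u}} (ρ : G →* Aut X)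

/-- The stable open subsets which have a geometric quotient. -/
structure QuotientableOpen where
  /-- the open subset -/
  carrier : X.Opens
  isStable : IsStable ρ carrier
  exists_quotient : ∃ (Y : Scheme.{u}) (r : (carrier : Scheme.{u}) ⟶ Y),
    IsGeometricQuotient (restrictAction ρ carrier isStable) r

namespace QuotientableOpen

variable {ρ}

instance : Preorder (QuotientableOpen ρ) := Preorder.lift carrier

instance : Small.{u} (QuotientableOpen ρ) :=
  small_of_injective (f := carrier) (by rintro ⟨_, _, _⟩ ⟨_, _, _⟩ rfl; rfl)

/-- A quotient of a stable open subset. -/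
noncomputable def quotient (V : QuotientableOpen ρ) : Scheme.{u} := V.exists_quotient.choose

/-- The quotient morphism of a stable open subset. -/
noncomputable def π (V : QuotientableOpen ρ) : (V.carrier : Scheme.{u}) ⟶ V.quotient :=
  V.exists_quotient.choose_spec.choose

lemma isGeometricQuotient (V : QuotientableOpen ρ) :
    IsGeometricQuotient (restrictAction ρ V.carrier V.isStable) V.π :=
  V.exists_quotient.choose_spec.choose_spec

lemma restrictAction_comp_homOfLE {V W : X.Opens} (hV : IsStable ρ V) (hW : IsStable ρ W)
    (h : V ≤ W) (g : G) :
    (restrictAction ρ V hV g).hom ≫ X.homOfLE h = X.homOfLE h ≫ (restrictAction ρ W hW g).hom := by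
  have h1 := IsGeometricQuotient.restrictAction_comp_ι ρ hV g
  have h2 := IsGeometricQuotient.restrictAction_comp_ι ρ hW g
  rw [← cancel_mono W.ι, Category.assoc, Category.assoc, h2, Scheme.homOfLE_ι,
    Scheme.homOfLE_ι_assoc, h1]

lemma isInvariant_homOfLE_comp {V : X.Opens} (hV : IsStable ρ V) (W : QuotientableOpen ρ)
    (h : V ≤ W.carrier) : IsInvariant (restrictAction ρ V hV) (X.homOfLE h ≫ W.π) := fun g => by
  rw [← Category.assoc, restrictAction_comp_homOfLE hV W.isStable, Category.assoc,
    W.isGeometricQuotient.invariant]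

variable [Finite G]

omit [Finite G] in
lemma isStable_preimage_ι {V : X.Opens} (hV : IsStable ρ V) (W : QuotientableOpen ρ) :
    IsStable (restrictAction ρ W.carrier W.isStable) (W.carrier.ι ⁻¹ᵁ V) := fun g x hx => by
  have h1 : W.carrier.ι ((restrictAction ρ W.carrier W.isStable g).hom x) =
      (ρ g).hom (W.carrier.ι x) := by
    have h2 := IsGeometricQuotient.restrictAction_comp_ι ρ W.isStable g
    exact congrArg (fun f => f.base x) h2
  change W.carrier.ι ((restrictAction ρ W.carrier W.isStable g).hom x) ∈ V
  rw [h1]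
  exact hV g hx

/-- A stable open subset of an open subset with a geometric quotient has one, given by an open
subset of the quotient. -/
lemma exists_restrict {V : X.Opens} (hV : IsStable ρ V) (W : QuotientableOpen ρ)
    (h : V ≤ W.carrier) : ∃ (D : W.quotient.Opens) (r : (V : Scheme.{u}) ⟶ D),
      IsGeometricQuotient (restrictAction ρ V hV) r ∧ r ≫ D.ι = X.homOfLE h ≫ W.π ∧
      IsPullback r (X.homOfLE h) D.ι W.π := by
  obtain ⟨D, hD, -⟩ := W.isGeometricQuotient.exists_opens_preimage_eq (isStable_preimage_ι hV W)
  have hle : V.ι ''ᵁ ⊤ ≤ W.carrier.ι ''ᵁ (W.π ⁻¹ᵁ D) := by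
    rw [← hD, Scheme.Opens.ι_image_top, Scheme.Hom.image_preimage_eq_opensRange_inf,
      Scheme.Opens.opensRange_ι]
    exact le_inf h le_rfl
  have hrange : Set.range (X.homOfLE h ≫ W.π) ⊆ Set.range D.ι := by
    rintro _ ⟨x, rfl⟩
    rw [Scheme.Opens.range_ι]
    have : X.homOfLE h x ∈ W.carrier.ι ⁻¹ᵁ V := by
      rw [Scheme.Hom.mem_preimage, ← Scheme.Hom.comp_apply, Scheme.homOfLE_ι]
      exact x.2
    rw [hD] at this
    exact this
  have hfac := IsOpenImmersion.lift_fac D.ι (X.homOfLE h ≫ W.π) hrange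
  have hp : IsPullback (IsOpenImmersion.lift D.ι (X.homOfLE h ≫ W.π) hrange) (X.homOfLE h) D.ι
      W.π := by
    refine IsOpenImmersion.isPullback _ _ _ _ hfac.symm ?_
    rw [Scheme.Opens.opensRange_ι, ← hD, Scheme.opensRange_homOfLE]
  exact ⟨D, _, W.isGeometricQuotient.of_isPullback
    (restrictAction_comp_homOfLE hV W.isStable h) hp, hfac, hp⟩

/-- The intersection of two open subsets with geometric quotients. -/
def inter (V W : QuotientableOpen ρ) : QuotientableOpen ρ where
  carrier := V.carrier ⊓ W.carrier
  isStable g _ hx := ⟨V.isStable g hx.1, W.isStable g hx.2⟩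
  exists_quotient := by
    obtain ⟨D, r, hr, -⟩ := exists_restrict (V := V.carrier ⊓ W.carrier)
      (fun g _ hx => ⟨V.isStable g hx.1, W.isStable g hx.2⟩) V inf_le_left
    exact ⟨_, r, hr⟩

lemma inter_le_left (V W : QuotientableOpen ρ) : V.inter W ≤ V :=
  (inf_le_left : V.carrier ⊓ W.carrier ≤ V.carrier)

lemma inter_le_right (V W : QuotientableOpen ρ) : V.inter W ≤ W :=
  (inf_le_right : V.carrier ⊓ W.carrier ≤ W.carrier)

lemma existsUnique_map {V W : QuotientableOpen ρ} (h : V ≤ W) :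
    ∃! k : V.quotient ⟶ W.quotient, V.π ≫ k = X.homOfLE h ≫ W.π :=
  V.isGeometricQuotient.isCategoricalQuotient.existsUnique_desc _ _
    (isInvariant_homOfLE_comp V.isStable W h)

/-- The morphism between the quotients of two open subsets. -/
noncomputable def map {V W : QuotientableOpen ρ} (h : V ≤ W) : V.quotient ⟶ W.quotient :=
  (existsUnique_map h).choose

lemma π_map {V W : QuotientableOpen ρ} (h : V ≤ W) : V.π ≫ map h = X.homOfLE h ≫ W.π :=
  (existsUnique_map h).choose_spec.1

lemma eq_of_π_comp_eq (V : QuotientableOpen ρ) {Z : Scheme.{u}} {k k' : V.quotient ⟶ Z}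
    (h : V.π ≫ k = V.π ≫ k') : k = k' := by
  have := V.isGeometricQuotient.epi
  exact (cancel_epi _).mp h

lemma isOpenImmersion_map {V W : QuotientableOpen ρ} (h : V ≤ W) : IsOpenImmersion (map h) := by
  obtain ⟨D, r, hr, hD, -⟩ := exists_restrict V.isStable W h
  obtain ⟨e, he⟩ := V.isGeometricQuotient.isCategoricalQuotient.exists_iso hr.isCategoricalQuotient
  have : map h = e.hom ≫ D.ι := V.eq_of_π_comp_eq (by rw [π_map, ← Category.assoc, he, hD])
  rw [this]
  infer_instance

variable (ρ) in
/-- The diagram of the quotients of the stable open subsets which have a geometric quotient. -/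
noncomputable def diagram : QuotientableOpen ρ ⥤ Scheme.{u} where
  obj V := V.quotient
  map h := map (leOfHom h)
  map_id V := V.eq_of_π_comp_eq (by
    rw [π_map, Scheme.homOfLE_rfl, Category.id_comp, Category.comp_id])
  map_comp {U V W} h k := U.eq_of_π_comp_eq (by
    rw [π_map, ← Category.assoc, π_map, Category.assoc, π_map, Scheme.homOfLE_homOfLE_assoc])

instance {V W : QuotientableOpen ρ} (h : V ⟶ W) : IsOpenImmersion ((diagram ρ).map h) :=
  isOpenImmersion_map (leOfHom h)

lemma map_π_apply {V W : QuotientableOpen ρ} (h : V ≤ W) (x : (V.carrier : Scheme.{u})) :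
    map h (V.π x) = W.π (X.homOfLE h x) := by
  rw [← Scheme.Hom.comp_apply, π_map, Scheme.Hom.comp_apply]

/-- Two points with the same image in a quotient are in the same orbit. -/
lemma exists_of_π_eq {W : QuotientableOpen ρ} {x y : (W.carrier : Scheme.{u})} (h : W.π x = W.π y) :
    ∃ g, (ρ g).hom x.1 = y.1 := by
  obtain ⟨g, hg⟩ := W.isGeometricQuotient.exists_of_apply_eq h
  refine ⟨g, ?_⟩
  have h2 := IsGeometricQuotient.restrictAction_comp_ι ρ W.isStable g
  have h3 : W.carrier.ι ((restrictAction ρ W.carrier W.isStable g).hom x) =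
      (ρ g).hom (W.carrier.ι x) := congrArg (fun f => f.base x) h2
  rw [hg] at h3
  exact h3.symm

omit [Finite G] in
lemma π_eq_of_eq {W : QuotientableOpen ρ} {x y : (W.carrier : Scheme.{u})} {g : G}
    (h : (ρ g).hom x.1 = y.1) : W.π x = W.π y := by
  have h2 := IsGeometricQuotient.restrictAction_comp_ι ρ W.isStable g
  have h3 : W.carrier.ι ((restrictAction ρ W.carrier W.isStable g).hom x) =
      (ρ g).hom (W.carrier.ι x) := congrArg (fun f => f.base x) h2
  have h4 : (restrictAction ρ W.carrier W.isStable g).hom x = y :=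
    Subtype.ext (h3.trans h)
  rw [← h4, W.isGeometricQuotient.invariant.apply_eq]

/-- Points of two quotients with the same image in a third one come from the quotient of the
intersection: they are images of points in one orbit, which by stability lies in the intersection.
This is the condition under which the colimit of the diagram is obtained by gluing. -/
instance : (diagram ρ ⋙ Scheme.forget).IsLocallyDirected where
  cond {i j k} fi fj xi xj hx := by
    obtain ⟨a, rfl⟩ := i.isGeometricQuotient.surjective xi
    obtain ⟨b, rfl⟩ := j.isGeometricQuotient.surjective xj
    have hx' : map (leOfHom fi) (i.π a) = map (leOfHom fj) (j.π b) := hx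
    obtain ⟨g, hg⟩ := exists_of_π_eq
      ((map_π_apply (leOfHom fi) a).symm.trans (hx'.trans (map_π_apply (leOfHom fj) b)))
    have hg' : (ρ g).hom a.1 = b.1 :=
      (congrArg (ρ g).hom (X.homOfLE_apply (leOfHom fi) a).symm).trans
        (hg.trans (X.homOfLE_apply (leOfHom fj) b))
    have haj : a.1 ∈ j.carrier := by
      rw [← j.isStable.preimage_eq g, Scheme.Hom.mem_preimage, hg']
      exact b.2
    have h1 : map (inter_le_left i j) ((i.inter j).π ⟨a.1, a.2, haj⟩) = i.π a :=
      (map_π_apply (inter_le_left i j) _).trans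
        (congrArg i.π (Subtype.ext (X.homOfLE_apply _ _)))
    have h2 : map (inter_le_right i j) ((i.inter j).π ⟨a.1, a.2, haj⟩) = j.π b :=
      (map_π_apply (inter_le_right i j) _).trans (π_eq_of_eq (g := g)
        ((congrArg (ρ g).hom (X.homOfLE_apply _ _)).trans hg'))
    exact ⟨i.inter j, homOfLE (inter_le_left i j), homOfLE (inter_le_right i j), _, h1, h2⟩

/-- A point of `V` and one of `W` which are identified in the colimit belong to one orbit, so the
former lies in `W`. -/
lemma mem_carrier_of_ι_π_eq {V W : QuotientableOpen ρ} {x : (V.carrier : Scheme.{u})}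
    {y : (W.carrier : Scheme.{u})}
    (h : colimit.ι (diagram ρ) V (V.π x) = colimit.ι (diagram ρ) W (W.π y)) :
    x.1 ∈ W.carrier := by
  obtain ⟨k, fi, fj, z, h1, h2⟩ := Scheme.IsLocallyDirected.ι_eq_ι_iff (diagram ρ) |>.mp h
  obtain ⟨c, rfl⟩ := k.isGeometricQuotient.surjective z
  obtain ⟨g, hg⟩ := exists_of_π_eq ((map_π_apply (leOfHom fi) c).symm.trans h1)
  have hg' : (ρ g).hom c.1 = x.1 :=
    (congrArg (ρ g).hom (X.homOfLE_apply (leOfHom fi) c).symm).trans hg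
  rw [← hg']
  exact W.isStable g (leOfHom fj c.2)

end QuotientableOpen

open QuotientableOpen in
/-- A geometric quotient exists as soon as every point has a stable neighbourhood with one. It is
the colimit of the quotients of all stable open subsets which have one. -/
theorem exists_isGeometricQuotient [Finite G]
    (h : ∀ x : X, ∃ W : QuotientableOpen ρ, x ∈ W.carrier) :
    ∃ (Y : Scheme.{u}) (q : X ⟶ Y), IsGeometricQuotient ρ q := by
  choose W hW using h
  have hcov : TopologicalSpace.IsOpenCover fun x => (W x).carrier :=
    .mk (top_le_iff.mp fun x _ => TopologicalSpace.Opens.mem_iSup.mpr ⟨x, hW x⟩)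
  let c : ∀ V : QuotientableOpen ρ, V.quotient ⟶ colimit (diagram ρ) := colimit.ι (diagram ρ)
  have hc : ∀ {V V' : QuotientableOpen ρ} (h : V ≤ V'), X.homOfLE h ≫ V'.π ≫ c V' = V.π ≫ c V :=
      fun {V V'} h => by
    have h1 : map h ≫ c V' = c V := colimit.w (diagram ρ) (homOfLE h)
    rw [← h1, ← Category.assoc (X.homOfLE h), ← π_map, Category.assoc]
  obtain ⟨q, hq⟩ := exists_glue hcov (fun x => (W x).π ≫ c (W x)) fun x y =>
    (hc (inter_le_left (W x) (W y))).trans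
      (hc (inter_le_right (W x) (W y))).symm
  have hq' : ∀ V : QuotientableOpen ρ, V.carrier.ι ≫ q = V.π ≫ c V := fun V => by
    have hcov' : TopologicalSpace.IsOpenCover fun x : V.carrier =>
        V.carrier.ι ⁻¹ᵁ (W x.1).carrier :=
      .mk (top_le_iff.mp fun x _ => TopologicalSpace.Opens.mem_iSup.mpr ⟨x, hW x.1⟩)
    refine Scheme.hom_ext_of_forall _ _ fun x =>
      ⟨V.carrier.ι ⁻¹ᵁ (W x.1).carrier, hW x.1, ?_⟩
    let l : (V.carrier.ι ⁻¹ᵁ (W x.1).carrier : Scheme.{u}) ⟶ ((V.inter (W x.1)).carrier) :=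
      IsOpenImmersion.lift (V.inter (W x.1)).carrier.ι ((V.carrier.ι ⁻¹ᵁ (W x.1).carrier).ι ≫
        V.carrier.ι) (by
          rintro _ ⟨z, rfl⟩
          rw [Scheme.Opens.range_ι]
          exact ⟨z.1.2, z.2⟩)
    have hl : l ≫ (V.inter (W x.1)).carrier.ι = (V.carrier.ι ⁻¹ᵁ (W x.1).carrier).ι ≫
        V.carrier.ι := IsOpenImmersion.lift_fac _ _ _
    have hle1 : V.inter (W x.1) ≤ V := inter_le_left _ _
    have hle2 : V.inter (W x.1) ≤ W x.1 := inter_le_right _ _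
    have hl1 : (V.carrier.ι ⁻¹ᵁ (W x.1).carrier).ι = l ≫ X.homOfLE hle1 := by
      rw [← cancel_mono V.carrier.ι, Category.assoc, Scheme.homOfLE_ι, hl]
    rw [reassoc_of% hl1, reassoc_of% hl1, hc, ← Category.assoc (X.homOfLE hle1), Scheme.homOfLE_ι,
      ← hc hle2, ← hq, Scheme.homOfLE_ι_assoc]
  have hinv : IsInvariant ρ q := fun g => by
    refine hom_ext_of_isOpenCover hcov fun x => ?_
    have h1 := IsGeometricQuotient.restrictAction_comp_ι ρ (W x).isStable g
    rw [← Category.assoc, ← h1, Category.assoc, hq, ← Category.assoc,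
      (W x).isGeometricQuotient.invariant g]
  refine ⟨_, q, IsGeometricQuotient.of_forall_exists_isPullback hinv fun y => ?_⟩
  obtain ⟨V, y', rfl⟩ := Scheme.IsLocallyDirected.ι_jointly_surjective (diagram ρ) y
  have hio : IsOpenImmersion (c V) :=
    inferInstanceAs (IsOpenImmersion (colimit.ι (diagram ρ) V))
  refine ⟨_, _, _, V.π, V.carrier.ι, c V, inferInstance, hio, ⟨y', rfl⟩, V.isGeometricQuotient, ?_,
    IsGeometricQuotient.restrictAction_comp_ι ρ V.isStable⟩
  refine IsOpenImmersion.isPullback _ _ _ _ (hq' V) ?_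
  rw [Scheme.Opens.opensRange_ι]
  have hqa : ∀ (V : QuotientableOpen ρ) (x : (V.carrier : Scheme.{u})),
      q x.1 = c V (V.π x) := fun V x => congrArg (fun f => f.base x) (hq' V)
  ext x
  constructor
  · rintro ⟨z, hz⟩
    obtain ⟨a, rfl⟩ := V.isGeometricQuotient.surjective z
    exact mem_carrier_of_ι_π_eq (x := (⟨x, hW x⟩ : (W x).carrier)) (y := a)
      ((hqa (W x) ⟨x, hW x⟩).symm.trans hz.symm)
  · intro hx
    exact ⟨V.π ⟨x, hx⟩, (hqa V ⟨x, hx⟩).symm⟩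

end Existence


/-! ### Stable affine neighbourhoods -/

section AffineNeighbourhoods

variable {G : Type v} [Group G] [Finite G] {X S : Scheme.{u}}

/-- Prime avoidance: finitely many points of an affine open subset which lie in a smaller open
subset lie in a common basic open subset of it. -/
lemma exists_basicOpen_of_finite {U : X.Opens} (hU : IsAffineOpen U) {O : X.Opens}
    {κ : Type*} [Finite κ] (x : κ → X) (hx : ∀ i, x i ∈ U) (hxO : ∀ i, x i ∈ O) :
    ∃ h : Γ(X, U), X.basicOpen h ≤ O ∧ ∀ i, x i ∈ X.basicOpen h := by
  -- the ideal of the functions vanishing on the complement of `O`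
  let J : Ideal Γ(X, U) :=
    { carrier := {a | X.basicOpen a ≤ O}
      add_mem' := fun {a b} ha hb => (X.basicOpen_add_le a b).trans (sup_le ha hb)
      zero_mem' := by
        change X.basicOpen (0 : Γ(X, U)) ≤ O
        rw [Scheme.basicOpen_zero]
        exact bot_le
      smul_mem' := fun c a ha => by
        change X.basicOpen (c * a) ≤ O
        rw [Scheme.basicOpen_mul]
        exact inf_le_right.trans ha }
  by_contra! hcon
  cases nonempty_fintype κ
  have h1 : (J : Set Γ(X, U)) ⊆ ⋃ i ∈ ((Finset.univ : Finset κ) : Set κ), idealAt U (x i) (hx i) := by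
    intro a ha
    obtain ⟨i, hi⟩ := hcon a ha
    refine Set.mem_biUnion (Finset.mem_coe.mpr (Finset.mem_univ i)) ?_
    exact mem_idealAt.mpr hi
  have h2 : ∃ i ∈ (Finset.univ : Finset κ), J ≤ idealAt U (x i) (hx i) := by
    cases isEmpty_or_nonempty κ
    · exact absurd (h1 J.zero_mem) (by simp)
    · obtain ⟨i₀⟩ := ‹Nonempty κ›
      exact (Ideal.subset_union_prime i₀ i₀ fun i _ _ _ => inferInstance).mp h1
  obtain ⟨i, -, hi⟩ := h2
  obtain ⟨a, ha, hxa⟩ := hU.exists_basicOpen_le ⟨x i, hxO i⟩ (hx i)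
  exact mem_idealAt.mp (hi (show a ∈ J from ha)) hxa

/-- Every point has a stable affine neighbourhood, if its orbit is contained in an affine open
subset. -/
theorem exists_isStable_isAffineOpen (f : X ⟶ S) [IsSeparated f] {ρ : G →* Aut X}
    (hf : IsInvariant ρ f) (horb : OrbitsInAffineOpens ρ) (x : X) :
    ∃ V : X.Opens, IsStable ρ V ∧ IsAffineOpen V ∧ x ∈ V := by
  obtain ⟨U, hU, hxU⟩ := horb x
  obtain ⟨S₀, hS₀, hxS₀, -⟩ := exists_isAffineOpen_mem_and_subset (U := ⊤) (x := f x) trivial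
  -- Shrink `U` to a basic open subset which contains the orbit and lies over an affine open subset
  -- `S₀` of `S`; as `f` is separated over `S₀`, the intersection of its translates is affine.
  obtain ⟨h, hh, hxh⟩ := exists_basicOpen_of_finite hU (O := f ⁻¹ᵁ S₀)
    (fun g : G => (ρ g).hom x) hxU fun g => by
      rw [Scheme.Hom.mem_preimage, hf.apply_eq]
      exact hxS₀
  have hD : ∀ g, IsAffineOpen ((ρ g).hom ⁻¹ᵁ X.basicOpen h) ∧
      (ρ g).hom ⁻¹ᵁ X.basicOpen h ≤ f ⁻¹ᵁ S₀ := fun g => by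
    have : IsIso (ρ g).hom := Iso.isIso_hom (ρ g)
    refine ⟨(hU.basicOpen h).preimage_of_isIso _, fun y hy => ?_⟩
    have : f ((ρ g).hom y) ∈ S₀ := hh hy
    rwa [hf.apply_eq] at this
  have hmem : ∀ y : X, y ∈ ⨅ g : G, (ρ g).hom ⁻¹ᵁ X.basicOpen h ↔
      ∀ g, (ρ g).hom y ∈ X.basicOpen h := fun y => by
    rw [← SetLike.mem_coe, TopologicalSpace.Opens.coe_iInf, Set.mem_iInter]
    rfl
  refine ⟨⨅ g : G, (ρ g).hom ⁻¹ᵁ X.basicOpen h, fun g y hy => ?_, ?_, (hmem x).mpr hxh⟩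
  · rw [Scheme.Hom.mem_preimage, hmem]
    intro g'
    have := (hmem y).mp hy (g' * g)
    have h3 : (ρ (g' * g)).hom y = (ρ g').hom ((ρ g).hom y) :=
      congrArg (fun k => k.base y) (action_mul_hom ρ g' g)
    rwa [h3] at this
  · refine (InfClosed.iInf_mem_of_nonempty (s := {V : X.Opens | IsAffineOpen V ∧ V ≤ f ⁻¹ᵁ S₀})
      (fun V hV V' hV' => ⟨?_, inf_le_left.trans hV.2⟩) hD).1
    exact isAffineHom_diagonal_iff.mp inferInstance S₀ hS₀ V hV.2 V' hV'.2 hV.1 hV'.1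

/-- The quotient of a scheme by a finite group is geometric, if orbits are contained in affine open
subsets. -/
theorem IsCategoricalQuotient.isGeometricQuotient_of_orbits {Y : Scheme.{u}} {ρ : G →* Aut X}
    {q : X ⟶ Y} (hq : IsCategoricalQuotient ρ q) (f : X ⟶ S) [IsSeparated f]
    (hf : IsInvariant ρ f) (horb : OrbitsInAffineOpens ρ) : IsGeometricQuotient ρ q := by
  obtain ⟨Y', q', hq'⟩ := exists_isGeometricQuotient ρ fun x => by
    obtain ⟨V, hV, hVa, hxV⟩ := exists_isStable_isAffineOpen f hf horb x
    have : IsAffine V := hVa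
    exact ⟨⟨V, hV, _, _, isGeometricQuotient_of_isAffine _⟩, hxV⟩
  exact hq.isGeometricQuotient hq'

end AffineNeighbourhoods

/-! ### The ideal of the fixed scheme -/

section FixedIdeal

variable {G : Type v} [Group G] {X Z : Scheme.{u}} {ρ : G →* Aut X} {ι : Z ⟶ X}

lemma sectionsMap_sub_mem_ker (hι : ∀ g, ι ≫ (ρ g).hom = ι) {V : X.Opens} (hV : IsStable ρ V)
    (g : G) (a : Γ(X, V)) : sectionsMap ρ hV g a - a ∈ RingHom.ker (ι.app V).hom := by
  have h1 : sectionsMap ρ hV g ≫ ι.app V = ι.app V := by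
    rw [sectionsMap, ← Scheme.Hom.appLE_eq_app, Scheme.Hom.appLE_comp_appLE,
      appLE_congr_hom (hι g)]
  rw [RingHom.mem_ker, map_sub, sub_eq_zero]
  exact congrArg (fun f => f.hom a) h1

/-- Over a stable affine open subset, the ideal of the fixed scheme is generated by the elements
`g • a - a`. -/
theorem ker_app_eq_fixedIdeal [IsClosedImmersion ι] (hι : IsFixedScheme ρ ι) {V : X.Opens}
    (hV : IsStable ρ V) (hVa : IsAffineOpen V) :
    letI := sectionsAction ρ hV
    RingHom.ker (ι.app V).hom = fixedIdeal G Γ(X, V) := by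
  let := sectionsAction ρ hV
  refine le_antisymm ?_ ?_
  -- The inclusion of the closed subscheme of `V` defined by the ideal on the right is invariant, so
  -- it factors through the fixed scheme.
  · let φ : Γ(X, V) ⟶ CommRingCat.of (Γ(X, V) ⧸ fixedIdeal G Γ(X, V)) :=
      CommRingCat.ofHom (Ideal.Quotient.mk _)
    have hφ : ∀ g, sectionsMap ρ hV g ≫ φ = φ := fun g => by
      ext a
      have h1 := smul_sub_mem_fixedIdeal (G := G) g⁻¹ a
      have h2 : (g⁻¹ • a : Γ(X, V)) = sectionsMap ρ hV g a := by
        change sectionsMap ρ hV g⁻¹⁻¹ a = _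
        rw [inv_inv]
      rw [h2] at h1
      exact Ideal.Quotient.eq.mpr h1
    have ht : ∀ g, (Spec.map φ ≫ hVa.fromSpec) ≫ (ρ g).hom = Spec.map φ ≫ hVa.fromSpec := fun g => by
      have h3 : hVa.fromSpec ≫ (ρ g).hom = Spec.map (sectionsMap ρ hV g) ≫ hVa.fromSpec :=
        (IsAffineOpen.SpecMap_appLE_fromSpec _ hVa hVa (hV g)).symm
      refine (Category.assoc _ _ _).trans ?_
      rw [h3, ← Category.assoc, ← Spec.map_comp, hφ]
    obtain ⟨l, hl, -⟩ := hι.existsUnique_lift _ _ ht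
    intro a ha
    have h4 : ∀ (k : Spec (CommRingCat.of (Γ(X, V) ⧸ fixedIdeal G Γ(X, V))) ⟶ X)
        (e : ⊤ ≤ k ⁻¹ᵁ V), k = l ≫ ι → k.appLE V ⊤ e a = 0 := by
      rintro k e rfl
      have h5 : (l ≫ ι).appLE V ⊤ e = ι.app V ≫ l.appLE (ι ⁻¹ᵁ V) ⊤ e := by
        rw [Scheme.Hom.comp_appLE]
      rw [h5]
      have : (ι.app V).hom a = 0 := ha
      change (l.appLE (ι ⁻¹ᵁ V) ⊤ e).hom ((ι.app V).hom a) = 0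
      rw [this, map_zero]
    have h6 : ⊤ ≤ (Spec.map φ ≫ hVa.fromSpec) ⁻¹ᵁ V := by
      rw [Scheme.Hom.comp_preimage, hVa.fromSpec_preimage_self]
      rfl
    have h7 := h4 _ h6 hl.symm
    have h8 : (Spec.map φ ≫ hVa.fromSpec).appLE V ⊤ h6 = φ ≫ (Scheme.ΓSpecIso _).inv := by
      rw [← Scheme.Hom.appLE_comp_appLE _ _ V ⊤ ⊤ (by rw [hVa.fromSpec_preimage_self]) le_rfl,
        Scheme.ΓSpecIso_inv_naturality]
      refine congrArg₂ (· ≫ ·) ?_ (Scheme.Hom.appLE_eq_app _)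
      rw [Scheme.Hom.appLE, hVa.fromSpec_app_self, Category.assoc, ← Functor.map_comp]
      exact (congrArg _ (CategoryTheory.Functor.map_id _ _)).trans (Category.comp_id _)
    rw [h8] at h7
    have h9 : φ a = 0 := by
      have hb := ConcreteCategory.bijective_of_isIso
        (Scheme.ΓSpecIso (CommRingCat.of (Γ(X, V) ⧸ fixedIdeal G Γ(X, V)))).inv
      exact hb.1 (h7.trans (map_zero _).symm)
    exact Ideal.Quotient.eq_zero_iff_mem.mp h9
  · rw [fixedIdeal, Ideal.span_le]
    rintro _ ⟨g, a, rfl⟩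
    exact sectionsMap_sub_mem_ker hι.fixed hV g⁻¹ a

end FixedIdeal


/-! ### The character defined by an isomorphism with the roots of unity -/

noncomputable section Character

variable {G : Type v} [Group G] {S X : Scheme.{u}}

lemma isUnit_of_le_basicOpen {U : X.Opens} {a : Γ(X, U)} (h : U ≤ X.basicOpen a) : IsUnit a := by
  have h1 := X.toRingedSpace.isUnit_res_basicOpen a
  have h2 := h1.map (X.presheaf.map (homOfLE h).op).hom
  have h3 : ∀ b : Γ(X, U), (X.presheaf.map (homOfLE h).op).hom
      ((X.presheaf.map (homOfLE (X.basicOpen_le a)).op).hom b) = b := fun b => by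
    change (X.presheaf.map (homOfLE (X.basicOpen_le a)).op ≫ X.presheaf.map (homOfLE h).op).hom b = b
    rw [← Functor.map_comp]
    exact congrArg (fun f => f.hom b) (X.presheaf.map_id (.op U))
  have h4 := h3 a
  exact h4 ▸ h2

/-- A global function on `S` is invertible if none of its pullbacks to the spectra of the residue
fields vanishes. -/
lemma isUnit_of_forall_fromSpecResidueField (a : Γ(S, ⊤))
    (h : ∀ s : S, (S.fromSpecResidueField s).appTop a ≠ 0) : IsUnit a := by
  refine isUnit_of_le_basicOpen fun s _ => ?_
  by_contra hs
  refine h s ?_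
  have h1 : (Spec (S.residueField s)).basicOpen ((S.fromSpecResidueField s).appTop a) = ⊥ := by
    have h2 := Scheme.preimage_basicOpen (S.fromSpecResidueField s) a
    refine h2.symm.trans ?_
    ext x
    simp only [Scheme.Hom.mem_preimage, TopologicalSpace.Opens.coe_bot, Set.mem_empty_iff_false,
      iff_false, SetLike.mem_coe]
    rwa [Scheme.fromSpecResidueField_apply]
  by_contra hne
  have hb := ConcreteCategory.bijective_of_isIso (Scheme.ΓSpecIso (S.residueField s)).hom
  have h3 : (Scheme.ΓSpecIso (S.residueField s)).hom ((S.fromSpecResidueField s).appTop a) ≠ 0 :=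
    fun h0 => hne (hb.1 (h0.trans (map_zero _).symm))
  have h4 := (isUnit_iff_ne_zero.mpr h3).map (Scheme.ΓSpecIso (S.residueField s)).inv.hom
  have h5 : (Scheme.ΓSpecIso (S.residueField s)).inv.hom ((Scheme.ΓSpecIso (S.residueField s)).hom
      ((S.fromSpecResidueField s).appTop a)) = (S.fromSpecResidueField s).appTop a := by
    exact congrArg (fun f => f.hom ((S.fromSpecResidueField s).appTop a))
      (Scheme.ΓSpecIso (S.residueField s)).hom_inv_id
  rw [h5] at h4
  have h6 := Scheme.basicOpen_of_isUnit _ h4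
  rw [h1] at h6
  have h7 : (default : Spec (S.residueField s)) ∈ (⊤ : (Spec (S.residueField s)).Opens) := trivial
  rw [← h6] at h7
  exact h7

variable {n : ℕ}

/-- If `n` were zero in `K`, then over the dual numbers of `K` the group scheme `μ_n` would have
sections with trivial reduction, unlike a constant group. -/
lemma natCast_ne_zero_of_constantGroupIsoMu (hn : 0 < n)
    {K : Type u} [Field K] (p : Spec (CommRingCat.of K) ⟶ S) (hG : ConstantGroupIsoMu G n S) :
    (n : K) ≠ 0 := by
  intro h0
  obtain ⟨e, he⟩ := hG
  have : NeZero n := ⟨hn.ne'⟩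
  let j : Spec (CommRingCat.of (DualNumber K)) ⟶ Spec (CommRingCat.of K) :=
    Spec.map (CommRingCat.ofHom (algebraMap K (DualNumber K)))
  let φ : DualNumber K →+* K := (TrivSqZeroExt.fstHom K K K).toRingHom
  let i : Spec (CommRingCat.of K) ⟶ Spec (CommRingCat.of (DualNumber K)) :=
    Spec.map (CommRingCat.ofHom φ)
  let α := (Scheme.ΓSpecIso (CommRingCat.of (DualNumber K))).inv
  -- As `n = 0` in `K`, the element `1 + ε` of the dual numbers is an `n`-th root of unity.
  have hε : (1 + DualNumber.eps : DualNumber K) ^ n = 1 := by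
    have h1 : (DualNumber.eps : DualNumber K) ^ 2 = 0 := by
      rw [pow_two, DualNumber.eps_mul_eps]
    have h2 : (n : DualNumber K) = 0 := by
      rw [← map_natCast (algebraMap K (DualNumber K)), h0, map_zero]
    have h3 := (Polynomial.X ^ n : Polynomial (DualNumber K)).eval_add_of_sq_eq_zero 1 _ h1
    simpa [Polynomial.derivative_X_pow, h2] using h3
  let ζ : rootsOfUnity n Γ(Spec (CommRingCat.of (DualNumber K)), ⊤) :=
    rootsOfUnity.mkOfPowEq (α (1 + DualNumber.eps)) (by rw [← map_pow, hε, map_one])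
  have hζ : ((ζ : Γ(Spec (CommRingCat.of (DualNumber K)), ⊤)ˣ) :
      Γ(Spec (CommRingCat.of (DualNumber K)), ⊤)) = α (1 + DualNumber.eps) :=
    rootsOfUnity.coe_mkOfPowEq _
  obtain ⟨a, ha⟩ := (e _ (j ≫ p)).surjective ζ
  have h1 := he _ _ (j ≫ p) i a
  have h2 : e _ (i ≫ j ≫ p) (a.comap i.base.hom) = 1 := by
    refine Subtype.ext (Units.ext ?_)
    rw [h1, ha]
    change i.appTop.hom ((ζ : Γ(Spec (CommRingCat.of (DualNumber K)), ⊤)ˣ) :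
      Γ(Spec (CommRingCat.of (DualNumber K)), ⊤)) = 1
    rw [hζ]
    have h3 : α ≫ i.appTop = CommRingCat.ofHom φ ≫ (Scheme.ΓSpecIso (CommRingCat.of K)).inv :=
      (Scheme.ΓSpecIso_inv_naturality _).symm
    refine (congrArg (fun f => f.hom (1 + DualNumber.eps)) h3).trans ?_
    change (Scheme.ΓSpecIso (CommRingCat.of K)).inv.hom (φ (1 + DualNumber.eps)) = 1
    have h4 : φ (1 + DualNumber.eps) = 1 := by
      change TrivSqZeroExt.fst (1 + DualNumber.eps : DualNumber K) = 1
      simp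
    rw [h4, map_one]
  rw [map_eq_one_iff _ (e _ _).injective] at h2
  have hsurj : Function.Surjective i.base := by
    have h5 : Function.Surjective φ := fun b => ⟨TrivSqZeroExt.inl b, rfl⟩
    intro P
    have h6 : P ∈ Set.range (PrimeSpectrum.comap φ) := by
      rw [range_comap_of_surjective _ φ h5]
      intro b hb
      have hb' : TrivSqZeroExt.fst b = 0 := hb
      have h7 : b ^ 2 = 0 := by
        rw [pow_two]
        exact TrivSqZeroExt.ext (by simp [hb']) (by simp [hb'])
      exact P.2.mem_of_pow_mem 2 (by rw [h7]; exact zero_mem _)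
    exact h6
  -- The spectra of `K` and of the dual numbers have the same points, so the locally constant
  -- function `a` is determined by its restriction.
  have h8 : a = 1 := by
    ext P
    obtain ⟨Q, rfl⟩ := hsurj P
    exact congrArg (fun f : LocallyConstant _ G => f Q) h2
  rw [h8, map_one] at ha
  have h9 : α (1 + DualNumber.eps) = α 1 := by rw [← hζ, ← ha, map_one]; rfl
  have h10 := (ConcreteCategory.bijective_of_isIso α).1 h9
  have h11 := congrArg TrivSqZeroExt.snd h10
  simp at h11

/-- An isomorphism of `G` with `μ_n` over `S` gives a character of `G` with values in the
invertible functions on `S`, all of whose nontrivial values are nowhere equal to `1`, together with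
the fact that `n` is invertible on `S`. -/
theorem ConstantGroupIsoMu.exists_character (hn : 0 < n) (hG : ConstantGroupIsoMu G n S) :
    ∃ χ : G →* Γ(S, ⊤), (∀ g, g ≠ 1 → IsUnit (χ g - 1)) ∧ IsUnit (n : Γ(S, ⊤)) ∧
      (Nonempty S → Nat.card G = n ∧ IsCyclic G) := by
  have : NeZero n := ⟨hn.ne'⟩
  have hunit : IsUnit (n : Γ(S, ⊤)) := by
    refine isUnit_of_forall_fromSpecResidueField _ fun s hs => ?_
    refine natCast_ne_zero_of_constantGroupIsoMu (K := S.residueField s) hn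
      (S.fromSpecResidueField s) hG ?_
    rw [map_natCast] at hs
    have h1 := congrArg (Scheme.ΓSpecIso (S.residueField s)).hom.hom hs
    rwa [map_natCast, map_zero] at h1
  have hcard : Nonempty S → Nat.card G = n ∧ IsCyclic G := fun ⟨s⟩ => by
    let K := AlgebraicClosure (S.residueField s)
    let p : Spec (CommRingCat.of K) ⟶ S :=
      Spec.map (CommRingCat.ofHom (algebraMap (S.residueField s) K)) ≫ S.fromSpecResidueField s
    have : NeZero (n : K) := ⟨natCast_ne_zero_of_constantGroupIsoMu hn p hG⟩
    obtain ⟨e, he⟩ := hG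
    let c : G →* LocallyConstant (Spec (CommRingCat.of K)) G := LocallyConstant.constMonoidHom
    have hc : Function.Bijective c := by
      have : Unique (Spec (CommRingCat.of K)) := inferInstanceAs (Unique (PrimeSpectrum K))
      refine ⟨fun g g' h => congrArg (fun f : LocallyConstant _ G => f default) h, fun a => ?_⟩
      refine ⟨a default, ?_⟩
      ext x
      rw [Unique.eq_default x]
      rfl
    -- Over an algebraically closed field `K` the isomorphism identifies `G` with the group of
    -- `n`-th roots of unity, which is cyclic of order `n` since `n` is invertible in `K`.
    let E : G ≃* rootsOfUnity n K := ((MulEquiv.ofBijective c hc).trans (e _ p)).trans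
      ((Scheme.ΓSpecIso (CommRingCat.of K)).commRingCatIsoToRingEquiv.toMulEquiv.restrictRootsOfUnity
        n)
    refine ⟨?_, ?_⟩
    · rw [Nat.card_congr E.toEquiv, HasEnoughRootsOfUnity.natCard_rootsOfUnity]
    · have := HasEnoughRootsOfUnity.rootsOfUnity_isCyclic K n
      exact isCyclic_of_injective E.toMonoidHom E.injective
  obtain ⟨e, he⟩ := hG
  let χ : G →* Γ(S, ⊤) := (Units.coeHom _).comp ((rootsOfUnity n Γ(S, ⊤)).subtype.comp
    ((e S (𝟙 S)).toMonoidHom.comp LocallyConstant.constMonoidHom))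
  refine ⟨χ, fun g hg => ?_, hunit, hcard⟩
  refine isUnit_of_forall_fromSpecResidueField _ fun s hs => hg ?_
  rw [map_sub, map_one, sub_eq_zero] at hs
  have h1 := he S _ (𝟙 S) (S.fromSpecResidueField s) (LocallyConstant.const S g)
  have h2 : e _ (S.fromSpecResidueField s ≫ 𝟙 S)
      ((LocallyConstant.const S g).comap (S.fromSpecResidueField s).base.hom) = 1 :=
    Subtype.ext (h1.trans (Units.ext hs))
  rw [map_eq_one_iff _ (e _ _).injective] at h2
  exact congrArg (fun f : LocallyConstant _ G => f default) h2

end Character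


/-! ### Equations of weight one -/

noncomputable section KummerCharts

variable {G : Type v} [Group G] {X Y Z S : Scheme.{u}} {ρ : G →* Aut X} {n : ℕ}

/-- An isomorphism of `G` with `μ_n` over `X`, compatible with the action of `G` on `X`: a character
with values in the invariant invertible functions on `X` all of whose nontrivial values are nowhere
equal to `1`, for a cyclic group `G` whose order `n` is invertible on `X`. The last two fields only
make sense for nonempty `X`, as over the empty scheme every group is isomorphic to `μ_n`. -/
structure IsTameCharacter (ρ : G →* Aut X) (n : ℕ) (χ : G →* Γ(X, ⊤)) : Prop where
  appTop_apply : ∀ g h, (ρ g).hom.appTop (χ h) = χ h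
  isUnit_sub_one : ∀ g, g ≠ 1 → IsUnit (χ g - 1)
  isUnit_natCast : IsUnit (n : Γ(X, ⊤))
  natCard_eq : Nonempty X → Nat.card G = n
  isCyclic : Nonempty X → IsCyclic G

lemma ConstantGroupIsoMu.exists_isTameCharacter (hn : 0 < n) (hG : ConstantGroupIsoMu G n S)
    {f : X ⟶ S} (hf : IsInvariant ρ f) : ∃ χ : G →* Γ(X, ⊤), IsTameCharacter ρ n χ := by
  obtain ⟨χ, h1, h2, h3⟩ := hG.exists_character hn
  refine ⟨(f.appTop.hom : Γ(S, ⊤) →* Γ(X, ⊤)).comp χ, fun g h => ?_, fun g hg => ?_, ?_,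
    fun ⟨x⟩ => (h3 ⟨f x⟩).1, fun ⟨x⟩ => (h3 ⟨f x⟩).2⟩
  · have h4 : f.appTop ≫ (ρ g).hom.appTop = f.appTop :=
      (Scheme.Hom.comp_appTop _ _).symm.trans (by rw [hf g])
    exact congrArg (fun k => k.hom (χ h)) h4
  · have := (h1 g hg).map f.appTop.hom
    rwa [map_sub, map_one] at this
  · have := h2.map f.appTop.hom
    rwa [map_natCast] at this

/-- The restriction of a character to an open subset. -/
def charOn (χ : G →* Γ(X, ⊤)) (V : X.Opens) : G →* Γ(X, V) :=
  ((X.presheaf.map (homOfLE (le_top : V ≤ ⊤)).op).hom : Γ(X, ⊤) →* Γ(X, V)).comp χ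

lemma map_charOn (χ : G →* Γ(X, ⊤)) {V V' : X.Opens} (h : V' ≤ V) (g : G) :
    X.presheaf.map (homOfLE h).op (charOn χ V g) = charOn χ V' g := by
  change (X.presheaf.map (homOfLE _).op ≫ X.presheaf.map (homOfLE h).op).hom (χ g) = _
  rw [← Functor.map_comp]
  rfl

namespace IsTameCharacter

variable {χ : G →* Γ(X, ⊤)} (hχ : IsTameCharacter ρ n χ)
include hχ

lemma isPrimitiveCharacter {V : X.Opens} (hV : IsStable ρ V) :
    letI := sectionsAction ρ hV
    IsPrimitiveCharacter (charOn χ V) := by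
  let := sectionsAction ρ hV
  refine ⟨fun g h => ?_, fun g hg => ?_⟩
  · have h1 := congrArg (fun k => k.hom (χ h)) (sectionsMap_map ρ (isStable_top ρ) hV le_top g⁻¹)
    refine Eq.trans h1 ?_
    have h2 : sectionsMap ρ (isStable_top ρ) g⁻¹ = (ρ g⁻¹).hom.appTop := Scheme.Hom.appLE_eq_app _
    change X.presheaf.map _ (sectionsMap ρ (isStable_top ρ) g⁻¹ (χ h)) = _
    rw [h2, hχ.appTop_apply]
    rfl
  · have := (hχ.isUnit_sub_one g hg).map (X.presheaf.map (homOfLE (le_top : V ≤ ⊤)).op).hom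
    rwa [map_sub, map_one] at this

lemma isUnit_natCard {V : X.Opens} (hX : Nonempty X) : IsUnit (Nat.card G : Γ(X, V)) := by
  have := hχ.isUnit_natCast.map (X.presheaf.map (homOfLE (le_top : V ≤ ⊤)).op).hom
  rwa [map_natCast, ← hχ.natCard_eq hX] at this

end IsTameCharacter

/-- A point is fixed if `G` acts trivially on the corresponding point with values in the residue
field. -/
def IsFixedPoint (ρ : G →* Aut X) (x : X) : Prop :=
  ∀ g, X.fromSpecResidueField x ≫ (ρ g).hom = X.fromSpecResidueField x

lemma IsFixedScheme.mem_range {ι : Z ⟶ X} [IsClosedImmersion ι] (hι : IsFixedScheme ρ ι)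
    {T : Scheme.{u}} {t : T ⟶ X} (ht : ∀ g, t ≫ (ρ g).hom = t) (s : T) : t s ∈ Set.range ι := by
  obtain ⟨h, rfl, -⟩ := hι.existsUnique_lift T t ht
  exact ⟨h s, rfl⟩

lemma IsFixedScheme.not_isFixedPoint {ι : Z ⟶ X} [IsClosedImmersion ι] (hι : IsFixedScheme ρ ι)
    {x : X} (hx : x ∉ Set.range ι) : ¬ IsFixedPoint ρ x := fun h => hx (by
  have := hι.mem_range h default
  rwa [Scheme.fromSpecResidueField_apply] at this)

lemma not_isFixedPoint_complement {ι : Z ⟶ X} [IsClosedImmersion ι] (hι : IsFixedScheme ρ ι)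
    (x : (complement ι : Scheme.{u})) : ¬ IsFixedPoint (complementAction ρ ι hι) x := fun h => by
  have h1 : ∀ g, ((complement ι : Scheme.{u}).fromSpecResidueField x ≫ (complement ι).ι) ≫
      (ρ g).hom = (complement ι : Scheme.{u}).fromSpecResidueField x ≫ (complement ι).ι :=
      fun g => by
    have h2 := IsGeometricQuotient.restrictAction_comp_ι ρ (complement_le_preimage ρ ι hι) g
    refine (Category.assoc _ _ _).trans ?_
    rw [← h2, ← Category.assoc]
    exact congrArg (· ≫ (complement ι).ι) (h g)
  have h3 := hι.mem_range h1 default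
  rw [Scheme.Hom.comp_apply, Scheme.fromSpecResidueField_apply] at h3
  exact x.2 h3

/-- A point at which all functions `g a - a` vanish is fixed. -/
lemma fixedIdeal_not_le_idealAt {V : X.Opens} (hV : IsStable ρ V) (hVa : IsAffineOpen V) {x : X}
    (hx : x ∈ V) (hfix : ¬ IsFixedPoint ρ x) :
    letI := sectionsAction ρ hV
    ¬ fixedIdeal G Γ(X, V) ≤ idealAt V x hx := by
  let := sectionsAction ρ hV
  intro hle
  refine hfix fun g => ?_
  have h1 : X.fromSpecResidueField x = Spec.map (X.evaluation V x hx) ≫ hVa.fromSpec := by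
    rw [Scheme.fromSpecResidueField, ← hVa.fromSpecStalk_eq_fromSpecStalk hx,
      IsAffineOpen.fromSpecStalk, ← Spec.map_comp_assoc]
    rfl
  have h3 : hVa.fromSpec ≫ (ρ g).hom = Spec.map (sectionsMap ρ hV g) ≫ hVa.fromSpec :=
    (IsAffineOpen.SpecMap_appLE_fromSpec _ hVa hVa (hV g)).symm
  have h4 : sectionsMap ρ hV g ≫ X.evaluation V x hx = X.evaluation V x hx := by
    ext a
    have h5 := hle (smul_sub_mem_fixedIdeal (G := G) g⁻¹ a)
    have h6 : (g⁻¹ • a : Γ(X, V)) = sectionsMap ρ hV g a := by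
      change sectionsMap ρ hV g⁻¹⁻¹ a = _
      rw [inv_inv]
    rw [h6, idealAt, RingHom.mem_ker, map_sub, sub_eq_zero] at h5
    exact h5
  rw [h1]
  refine (Category.assoc _ _ _).trans ?_
  rw [h3, ← Category.assoc, ← Spec.map_comp, h4]

/-- The situation of a Kummer covering: `t` is a nonzerodivisor of weight `1` for the character `χ`,
and generates the ideal of the fixed scheme. -/
structure IsKummer {A : Type*} [CommRing A] [MulSemiringAction G A] (χ : G →* A) (t : A) :
    Prop where
  isPrimitiveCharacter : IsPrimitiveCharacter χ
  isWeight : IsWeight χ 1 t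
  mem_nonZeroDivisors : t ∈ nonZeroDivisors A
  fixedIdeal_eq : fixedIdeal G A = Ideal.span {t}

lemma IsPrimitiveCharacter.isKummer_of_isUnit {A : Type*} [CommRing A] [MulSemiringAction G A]
    [Finite G] [IsCyclic G] (hG : 1 < Nat.card G) {χ : G →* A} (hχ : IsPrimitiveCharacter χ) {t : A}
    (ht : IsWeight χ 1 t) (htu : IsUnit t) : IsKummer χ t :=
  ⟨hχ, ht, htu.mem_nonZeroDivisors, by
    rw [Ideal.span_singleton_eq_top.mpr htu]
    exact Ideal.eq_top_of_isUnit_mem _ (hχ.mem_fixedIdeal_of_isWeight one_pos hG ht) htu⟩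

lemma IsWeight.map_sections {V V' : X.Opens} (hV : IsStable ρ V) (hV' : IsStable ρ V')
    (h : V' ≤ V) {χ : G →* Γ(X, ⊤)} {i : ℕ} {a : Γ(X, V)}
    (ha : letI := sectionsAction ρ hV; IsWeight (charOn χ V) i a) :
    letI := sectionsAction ρ hV'
    IsWeight (charOn χ V' ^ i) 1 (X.presheaf.map (homOfLE h).op a) := by
  let := sectionsAction ρ hV
  let := sectionsAction ρ hV'
  intro g
  have h1 := congrArg (fun k => k.hom a) (sectionsMap_map ρ hV hV' h g⁻¹)
  refine Eq.trans h1 ?_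
  have h2 : sectionsMap ρ hV g⁻¹ a = charOn χ V g ^ i * a := ha g
  change X.presheaf.map _ (sectionsMap ρ hV g⁻¹ a) = _
  rw [h2, map_mul, map_pow, map_charOn, pow_one, MonoidHom.pow_apply, smul_eq_mul]

variable [Finite G] {q : X ⟶ Y} {χ : G →* Γ(X, ⊤)}

/-- Away from the fixed points of a group of prime order, there are, locally on the quotient,
invertible functions of weight `1`. -/
theorem IsGeometricQuotient.exists_isKummer_isUnit (hq : IsGeometricQuotient ρ q)
    (hχ : IsTameCharacter ρ n χ) (hn : n.Prime) {x : X} (hx : ¬ IsFixedPoint ρ x) {W₀ : Y.Opens}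
    (hx₀ : q x ∈ W₀) : ∃ W ≤ W₀, IsAffineOpen W ∧ q x ∈ W ∧
      letI := sectionsAction ρ (hq.invariant.isStable_preimage W)
      ∃ (χ' : G →* Γ(X, q ⁻¹ᵁ W)) (t : Γ(X, q ⁻¹ᵁ W)), IsKummer χ' t ∧ IsUnit t := by
  have := hq.isAffineHom
  have hX : Nonempty X := ⟨x⟩
  have hcyc := hχ.isCyclic hX
  have hcard := hχ.natCard_eq hX
  obtain ⟨W, hW, hxW, hWW₀⟩ := exists_isAffineOpen_mem_and_subset hx₀
  have hV := hq.invariant.isStable_preimage W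
  have hVa : IsAffineOpen (q ⁻¹ᵁ W) := hW.preimage q
  let := sectionsAction ρ hV
  have hp := hχ.isPrimitiveCharacter hV
  obtain ⟨i, hi0, hi, h, hw, hh⟩ := hp.exists_isWeight_notMem (hχ.isUnit_natCard hX)
    (fixedIdeal_not_le_idealAt hV hVa hxW hx)
  -- The function `hⁿ` has weight `0`, so it is a function `u` on the quotient, and `h` is
  -- invertible where `u` is.
  obtain ⟨u, hu⟩ := (hq.sections W).exists_app_eq (h ^ n) fun g => by
    have h1 : sectionsMap ρ hV g h = charOn χ _ g⁻¹ ^ i * h := by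
      have := hw g⁻¹
      change sectionsMap ρ hV g⁻¹⁻¹ h = _ at this
      rwa [inv_inv] at this
    rw [map_pow, h1, mul_pow, ← pow_mul, mul_comm i, pow_mul, ← map_pow, ← hcard, pow_card_eq_one',
      map_one, one_pow, one_mul]
  have hle : q ⁻¹ᵁ Y.basicOpen u ≤ q ⁻¹ᵁ W := q.preimage_mono (Y.basicOpen_le u)
  have hV' := hq.invariant.isStable_preimage (Y.basicOpen u)
  have hD : q ⁻¹ᵁ Y.basicOpen u = X.basicOpen h := by
    rw [Scheme.preimage_basicOpen, hu, Scheme.basicOpen_pow _ _ hn.pos]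
  have hxh : x ∈ X.basicOpen h := by
    by_contra hxh
    exact hh (mem_idealAt.mpr hxh)
  refine ⟨Y.basicOpen u, (Y.basicOpen_le u).trans hWW₀, hW.basicOpen u, ?_, charOn χ _ ^ i,
    X.presheaf.map (homOfLE hle).op h, ?_⟩
  · rw [← Scheme.Hom.mem_preimage, hD]
    exact hxh
  · have hunit : IsUnit (X.presheaf.map (homOfLE hle).op h) := isUnit_of_le_basicOpen (by
      rw [Scheme.basicOpen_res, ← hD, inf_idem])
    refine ⟨?_, hunit⟩
    let := sectionsAction ρ hV'
    -- The function `h` has weight `i` for `χ`, hence weight `1` for `χ ^ i`.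
    refine IsPrimitiveCharacter.isKummer_of_isUnit (hcard ▸ hn.one_lt)
      ((hχ.isPrimitiveCharacter hV').pow_of_prime (hcard ▸ hn) hi0 hi) ?_ hunit
    exact IsWeight.map_sections hV hV' hle hw

omit [Finite G] in
lemma ker_app_map {ι : Z ⟶ X} [IsClosedImmersion ι] {U V : X.Opens} (hU : IsAffineOpen U)
    (hV : IsAffineOpen V) (h : V ≤ U) {t : Γ(X, U)}
    (ht : RingHom.ker (ι.app U).hom = Ideal.span {t}) :
    RingHom.ker (ι.app V).hom = Ideal.span {X.presheaf.map (homOfLE h).op t} := by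
  have h1 := ι.ker.map_ideal (U := ⟨V, hV⟩) (V := ⟨U, hU⟩) h
  rw [Scheme.Hom.ker_apply, Scheme.Hom.ker_apply] at h1
  rw [← h1, ht, Ideal.map_span, Set.image_singleton]
  rfl

omit [Finite G] in
lemma map_mem_nonZeroDivisors {U V : X.Opens} (hU : IsAffineOpen U)
    (hV : IsAffineOpen V) (h : V ≤ U) {t : Γ(X, U)} (ht : t ∈ nonZeroDivisors Γ(X, U)) :
    X.presheaf.map (homOfLE h).op t ∈ nonZeroDivisors Γ(X, V) := by
  have h1 : (X.presheaf.map (homOfLE h).op).hom.Flat := by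
    have h2 := (𝟙 X : X ⟶ X).flat_appLE hU hV h
    have h3 : (𝟙 X : X ⟶ X).appLE U V h = X.presheaf.map (homOfLE h).op := by
      simp only [Scheme.Hom.appLE, Scheme.Hom.id_app]
      exact Category.id_comp _
    rwa [h3] at h2
  algebraize [(X.presheaf.map (homOfLE h).op).hom]
  have h3 : IsSMulRegular Γ(X, V) t := Module.Flat.isSMulRegular_of_nonZeroDivisors ht
  refine mem_nonZeroDivisors_iff_right.mpr fun a ha => h3 ?_
  change t • a = t • 0
  rw [smul_zero, Algebra.smul_def, mul_comm]
  exact ha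

/-- A point fixed by `G` is alone in its fibre, so it has small saturated neighbourhoods. -/
lemma IsGeometricQuotient.exists_preimage_le (hq : IsGeometricQuotient ρ q) {x : X}
    (hfix : ∀ g, (ρ g).hom x = x) {U : X.Opens} (hxU : x ∈ U) :
    ∃ N : Y.Opens, q x ∈ N ∧ q ⁻¹ᵁ N ≤ U := by
  refine ⟨⟨(q '' (U : Set X)ᶜ)ᶜ, (hq.isClosedMap _ U.isOpen.isClosed_compl).isOpen_compl⟩, ?_,
    fun y hy => ?_⟩
  · rintro ⟨y, hy, hyx⟩
    obtain ⟨g, hg⟩ := hq.exists_of_apply_eq hyx.symm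
    rw [hfix] at hg
    exact hy (hg ▸ hxU)
  · by_contra hyU
    exact hy ⟨y, hyU, rfl⟩

/-- If the fixed scheme of a group of prime order is a Cartier divisor then, locally on the
quotient, it is defined by a function of weight `1`. -/
theorem IsGeometricQuotient.exists_isKummer (hq : IsGeometricQuotient ρ q)
    (hχ : IsTameCharacter ρ n χ) (hn : n.Prime) {ι : Z ⟶ X} [IsClosedImmersion ι]
    (hι : IsFixedScheme ρ ι) (hcar : IsCartierDivisor ι) (x : X) {W₀ : Y.Opens}
    (hx₀ : q x ∈ W₀) : ∃ W ≤ W₀, IsAffineOpen W ∧ q x ∈ W ∧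
      letI := sectionsAction ρ (hq.invariant.isStable_preimage W)
      ∃ (χ' : G →* Γ(X, q ⁻¹ᵁ W)) (t : Γ(X, q ⁻¹ᵁ W)), IsKummer χ' t := by
  by_cases hx : x ∈ Set.range ι
  swap
  · obtain ⟨W, hW, hWa, hxW, χ', t, ht, -⟩ :=
      hq.exists_isKummer_isUnit hχ hn (hι.not_isFixedPoint hx) hx₀
    exact ⟨W, hW, hWa, hxW, χ', t, ht⟩
  have := hq.isAffineHom
  have hX : Nonempty X := ⟨x⟩
  have hcyc := hχ.isCyclic hX
  have hcard := hχ.natCard_eq hX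
  have hfix : ∀ g, (ρ g).hom x = x := fun g => by
    obtain ⟨z, rfl⟩ := hx
    exact congrArg (fun k => k.base z) (hι.fixed g)
  obtain ⟨U, hU, hxU, t, ht, hker⟩ := hcar x
  obtain ⟨N, hxN, hN⟩ := hq.exists_preimage_le hfix hxU
  obtain ⟨W, hW, hxW, hWN⟩ := exists_isAffineOpen_mem_and_subset
    (show q x ∈ W₀ ⊓ N from ⟨hx₀, hxN⟩)
  have hV := hq.invariant.isStable_preimage W
  have hVa : IsAffineOpen (q ⁻¹ᵁ W) := hW.preimage q
  have hxV : x ∈ q ⁻¹ᵁ W := hxW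
  have hVU : q ⁻¹ᵁ W ≤ U := (q.preimage_mono (hWN.trans inf_le_right)).trans hN
  have ht' := map_mem_nonZeroDivisors hU hVa hVU ht
  have hker' := ker_app_map hU hVa hVU hker
  set t' := X.presheaf.map (homOfLE hVU).op t
  let := sectionsAction ρ hV
  have hp := hχ.isPrimitiveCharacter hV
  rw [ker_app_eq_fixedIdeal hι hV hVa] at hker'
  obtain ⟨i, hi0, hi, h, c, hw, hh, hc⟩ := hp.exists_isWeight_eq_mul (hχ.isUnit_natCard hX) ht' hker'
    (P := idealAt (q ⁻¹ᵁ W) x hxV) (Ideal.IsPrime.ne_top inferInstance)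
  classical
  cases nonempty_fintype G
  -- The norm `u` of the cofactor `c` is a function on the quotient. It does not vanish at `q x`, as
  -- `x` is fixed, and where it is invertible so is `c`, and `h = c t` is an equation of the fixed
  -- scheme.
  obtain ⟨u, hu⟩ := (hq.sections W).exists_app_eq (∏ g : G, sectionsMap ρ hV g c) fun g => by
    rw [map_prod]
    refine Fintype.prod_equiv (Equiv.mulRight g) _ _ fun g' => ?_
    rw [Equiv.coe_mulRight, sectionsMap_mul]
    rfl
  have hle : q ⁻¹ᵁ Y.basicOpen u ≤ q ⁻¹ᵁ W := q.preimage_mono (Y.basicOpen_le u)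
  have hV' := hq.invariant.isStable_preimage (Y.basicOpen u)
  have hD : q ⁻¹ᵁ Y.basicOpen u ≤ X.basicOpen c := by
    rw [Scheme.preimage_basicOpen, hu, ← Finset.mul_prod_erase _ _ (Finset.mem_univ 1),
      Scheme.basicOpen_mul, sectionsMap_one]
    exact inf_le_left
  let := sectionsAction ρ hV'
  have hVa' : IsAffineOpen (q ⁻¹ᵁ Y.basicOpen u) := (hW.basicOpen u).preimage q
  refine ⟨Y.basicOpen u, (Y.basicOpen_le u).trans (hWN.trans inf_le_left), hW.basicOpen u, ?_,
    charOn χ _ ^ i, X.presheaf.map (homOfLE hle).op h, ?_, ?_, ?_, ?_⟩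
  · rw [← Scheme.Hom.mem_preimage, Scheme.preimage_basicOpen, hu]
    by_contra hxc
    have hxc' := (mem_idealAt (hx := hxV)).mpr hxc
    obtain ⟨g, -, hg⟩ := (Ideal.IsPrime.prod_mem_iff).mp hxc'
    have hg' := mem_idealAt.mp hg
    rw [basicOpen_sectionsMap] at hg'
    have hg'' : (ρ g).hom x ∉ X.basicOpen c := hg'
    rw [hfix] at hg''
    exact hc (mem_idealAt.mpr hg'')
  · exact (hχ.isPrimitiveCharacter hV').pow_of_prime (hcard ▸ hn) hi0 hi
  · exact IsWeight.map_sections hV hV' hle hw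
  · have hunit : IsUnit (X.presheaf.map (homOfLE hle).op c) := isUnit_of_le_basicOpen (by
      rw [Scheme.basicOpen_res]
      exact le_inf le_rfl hD)
    rw [hh, map_mul]
    exact mul_mem hunit.mem_nonZeroDivisors (map_mem_nonZeroDivisors hVa hVa' hle ht')
  · have hunit : IsUnit (X.presheaf.map (homOfLE hle).op c) := isUnit_of_le_basicOpen (by
      rw [Scheme.basicOpen_res]
      exact le_inf le_rfl hD)
    rw [← ker_app_eq_fixedIdeal hι hV' hVa', hh, map_mul,
      Ideal.span_singleton_mul_left_unit hunit]
    exact ker_app_map hVa hVa' hle (by rw [ker_app_eq_fixedIdeal hι hV hVa, hker'])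

end KummerCharts


/-! ### Flatness and smoothness of the quotient, smoothness of the fixed scheme -/

section FlatSmooth

variable {G : Type v} [Group G] [Finite G] {X Y Z S : Scheme.{u}} {ρ : G →* Aut X} {n : ℕ}
  {q : X ⟶ Y} {χ : G →* Γ(X, ⊤)}

/-- If the fixed scheme is a Cartier divisor then the functions on `X` are locally free over those
on the quotient, with basis the powers of an equation of the fixed scheme. -/
theorem IsGeometricQuotient.flat (hq : IsGeometricQuotient ρ q) (hχ : IsTameCharacter ρ n χ)
    (hn : n.Prime) {ι : Z ⟶ X} [IsClosedImmersion ι] (hι : IsFixedScheme ρ ι)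
    (hcar : IsCartierDivisor ι) : Flat q := by
  have := hq.isAffineHom
  refine (HasRingHomProperty.iff_exists_appLE (P := @Flat)
    (RingHom.Flat.stableUnderComposition.stableUnderCompositionWithLocalizationAway
      RingHom.Flat.holdsForLocalizationAway).left).mpr fun x => ?_
  obtain ⟨W, -, hW, hxW, χ', t, ht⟩ := hq.exists_isKummer hχ hn hι hcar x (W₀ := ⊤) trivial
  refine ⟨⟨W, hW⟩, ⟨q ⁻¹ᵁ W, hW.preimage q⟩, hxW, le_rfl, ?_⟩
  rw [Scheme.Hom.appLE_eq_app]
  let := sectionsAction ρ (hq.invariant.isStable_preimage W)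
  let := (q.app W).hom.toAlgebra
  have := hq.algebra_isInvariant W
  have := hq.smulCommClass W
  have hX : Nonempty X := ⟨x⟩
  have := hχ.isCyclic hX
  have h1 := (ht.isPrimitiveCharacter.free_invariants (A₀ := Γ(Y, W)) ht.isWeight
    ht.mem_nonZeroDivisors ht.fixedIdeal_eq (hχ.isUnit_natCard hX) (hq.sections W).injective).1
  change Module.Flat Γ(Y, W) Γ(X, q ⁻¹ᵁ W)
  infer_instance

/-- Locally, a smooth `X` is a Kummer covering of its quotient, and smoothness descends along it. -/
theorem IsGeometricQuotient.smooth [IsLocallyNoetherian S] (hq : IsGeometricQuotient ρ q)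
    (hχ : IsTameCharacter ρ n χ)
    (hn : n.Prime) {ι : Z ⟶ X} [IsClosedImmersion ι] (hι : IsFixedScheme ρ ι)
    (hcar : IsCartierDivisor ι) {f : X ⟶ S} [Smooth f] {h : Y ⟶ S} (hf : q ≫ h = f) :
    Smooth h := by
  have := hq.isAffineHom
  refine (HasRingHomProperty.iff_exists_appLE (P := @Smooth)
    (RingHom.Smooth.stableUnderComposition.stableUnderCompositionWithLocalizationAway
      RingHom.Smooth.holdsForLocalizationAway).left).mpr fun y => ?_
  obtain ⟨x, rfl⟩ := hq.surjective y
  obtain ⟨S₀, hS₀, hyS₀, -⟩ := exists_isAffineOpen_mem_and_subset (U := ⊤) (x := h (q x)) trivial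
  obtain ⟨W, hWS, hW, hxW, χ', t, ht⟩ := hq.exists_isKummer hχ hn hι hcar x (W₀ := h ⁻¹ᵁ S₀) hyS₀
  refine ⟨⟨S₀, hS₀⟩, ⟨W, hW⟩, hxW, hWS, ?_⟩
  have hle : q ⁻¹ᵁ W ≤ f ⁻¹ᵁ S₀ := by
    rw [← hf]
    exact q.preimage_mono hWS
  have hcomp : f.appLE S₀ (q ⁻¹ᵁ W) hle = h.appLE S₀ W hWS ≫ q.app W := by
    subst hf
    rw [← q.appLE_eq_app, Scheme.Hom.appLE_comp_appLE]
  have hsm := f.smooth_appLE hS₀ (hW.preimage q) hle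
  let := sectionsAction ρ (hq.invariant.isStable_preimage W)
  let := (q.app W).hom.toAlgebra
  let := (h.appLE S₀ W hWS).hom.toAlgebra
  let := (f.appLE S₀ (q ⁻¹ᵁ W) hle).hom.toAlgebra
  have := hq.algebra_isInvariant W
  have := hq.smulCommClass W
  have hX : Nonempty X := ⟨x⟩
  have := hχ.isCyclic hX
  have : IsScalarTower Γ(S, S₀) Γ(Y, W) Γ(X, q ⁻¹ᵁ W) :=
    .of_algebraMap_eq fun r => congrArg (fun k => k.hom r) hcomp
  have : Algebra.Smooth Γ(S, S₀) Γ(X, q ⁻¹ᵁ W) := hsm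
  have : IsNoetherianRing Γ(S, S₀) := IsLocallyNoetherian.component_noetherian ⟨S₀, hS₀⟩
  exact ht.isPrimitiveCharacter.smooth_invariants (R := Γ(S, S₀)) (A₀ := Γ(Y, W)) ht.isWeight
    ht.mem_nonZeroDivisors ht.fixedIdeal_eq (hχ.isUnit_natCard hX) (hq.sections W).injective

/-- The fixed scheme of a tame action on a smooth scheme is smooth. -/
theorem IsFixedScheme.smooth [IsLocallyNoetherian S] (hq : IsGeometricQuotient ρ q)
    (hχ : IsTameCharacter ρ n χ) {ι : Z ⟶ X} [IsClosedImmersion ι] (hι : IsFixedScheme ρ ι)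
    {f : X ⟶ S} [Smooth f] {h : Y ⟶ S} (hf : q ≫ h = f) : Smooth (ι ≫ f) := by
  have := hq.isAffineHom
  refine (HasRingHomProperty.iff_exists_appLE (P := @Smooth)
    (RingHom.Smooth.stableUnderComposition.stableUnderCompositionWithLocalizationAway
      RingHom.Smooth.holdsForLocalizationAway).left).mpr fun z => ?_
  have hX : Nonempty X := ⟨ι z⟩
  obtain ⟨S₀, hS₀, hyS₀, -⟩ := exists_isAffineOpen_mem_and_subset (U := ⊤) (x := h (q (ι z))) trivial
  obtain ⟨W, hW, hxW, hWS⟩ := exists_isAffineOpen_mem_and_subset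
    (show q (ι z) ∈ h ⁻¹ᵁ S₀ from hyS₀)
  have hV := hq.invariant.isStable_preimage W
  have hVa : IsAffineOpen (q ⁻¹ᵁ W) := hW.preimage q
  have hle : q ⁻¹ᵁ W ≤ f ⁻¹ᵁ S₀ := by
    rw [← hf]
    exact q.preimage_mono hWS
  refine ⟨⟨S₀, hS₀⟩, ⟨ι ⁻¹ᵁ q ⁻¹ᵁ W, hVa.preimage ι⟩, hxW, ι.preimage_mono hle, ?_⟩
  have hcomp : (ι ≫ f).appLE S₀ (ι ⁻¹ᵁ q ⁻¹ᵁ W) (ι.preimage_mono hle) =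
      f.appLE S₀ (q ⁻¹ᵁ W) hle ≫ ι.app (q ⁻¹ᵁ W) := by
    rw [← ι.appLE_eq_app, Scheme.Hom.appLE_comp_appLE]
  have hWS : W ≤ h ⁻¹ᵁ S₀ := hWS
  have hcomp' : f.appLE S₀ (q ⁻¹ᵁ W) hle = h.appLE S₀ W hWS ≫ q.app W := by
    subst hf
    rw [← q.appLE_eq_app, Scheme.Hom.appLE_comp_appLE]
  have hsm := f.smooth_appLE hS₀ hVa hle
  let := sectionsAction ρ hV
  let := (f.appLE S₀ (q ⁻¹ᵁ W) hle).hom.toAlgebra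
  let := ((ι ≫ f).appLE S₀ (ι ⁻¹ᵁ q ⁻¹ᵁ W) (ι.preimage_mono hle)).hom.toAlgebra
  have : Algebra.Smooth Γ(S, S₀) Γ(X, q ⁻¹ᵁ W) := hsm
  have : IsNoetherianRing Γ(S, S₀) := IsLocallyNoetherian.component_noetherian ⟨S₀, hS₀⟩
  have : SMulCommClass G Γ(S, S₀) Γ(X, q ⁻¹ᵁ W) := ⟨fun g r a => by
    rw [Algebra.smul_def, Algebra.smul_def, smul_mul']
    congr 1
    have h1 : algebraMap Γ(S, S₀) Γ(X, q ⁻¹ᵁ W) r = q.app W (h.appLE S₀ W hWS r) :=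
      congrArg (fun k => k.hom r) hcomp'
    rw [h1]
    exact hq.invariant.sectionsMap_app W g⁻¹ _⟩
  let φ : Γ(X, q ⁻¹ᵁ W) →ₐ[Γ(S, S₀)] Γ(Z, ι ⁻¹ᵁ q ⁻¹ᵁ W) :=
    { (ι.app (q ⁻¹ᵁ W)).hom with
      commutes' := fun r => (congrArg (fun k => k.hom r) hcomp).symm }
  have hφ : Function.Surjective φ := ι.app_surjective _ hVa
  have hker : RingHom.ker φ = fixedIdeal G Γ(X, q ⁻¹ᵁ W) := ker_app_eq_fixedIdeal hι hV hVa
  have h1 := formallySmooth_quotient_fixedIdeal (R := Γ(S, S₀)) (G := G)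
    (hχ.isUnit_natCard (V := q ⁻¹ᵁ W) hX)
  rw [← hker] at h1
  have h2 : Algebra.FormallySmooth Γ(S, S₀) Γ(Z, ι ⁻¹ᵁ q ⁻¹ᵁ W) :=
    .of_equiv (Ideal.quotientKerAlgEquivOfSurjective hφ)
  have h3 : Algebra.FiniteType Γ(S, S₀) Γ(Z, ι ⁻¹ᵁ q ⁻¹ᵁ W) := .of_surjective φ hφ
  have h4 : Algebra.Smooth Γ(S, S₀) Γ(Z, ι ⁻¹ᵁ q ⁻¹ᵁ W) :=
    ⟨h2, (Algebra.FinitePresentation.of_finiteType).mp h3⟩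
  exact h4

end FlatSmooth

/-! ### The image of the fixed scheme in the quotient -/

section Image

variable {G : Type v} [Group G] [Finite G] {X Y Z S : Scheme.{u}} {ρ : G →* Aut X} {n : ℕ}
  {q : X ⟶ Y} {χ : G →* Γ(X, ⊤)}

/-- As the order of `G` is invertible, every function on the fixed scheme lifts to an invariant
function. -/
theorem IsFixedScheme.isClosedImmersion_comp (hq : IsGeometricQuotient ρ q)
    (hχ : IsTameCharacter ρ n χ) {ι : Z ⟶ X} [IsClosedImmersion ι] (hι : IsFixedScheme ρ ι) :
    IsClosedImmersion (ι ≫ q) := by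
  have := hq.isAffineHom
  refine isClosedImmersion_iff_isAffineHom.mpr ⟨inferInstance, fun W hW c => ?_⟩
  by_cases hX : Nonempty X
  swap
  · have : IsEmpty Z := ⟨fun z => hX ⟨ι z⟩⟩
    have h0 : IsUnit (0 : Γ(Z, (ι ≫ q) ⁻¹ᵁ W)) := isUnit_of_le_basicOpen fun z _ => this.elim z
    have := subsingleton_of_zero_eq_one (isUnit_zero_iff.mp h0)
    exact ⟨0, Subsingleton.elim _ _⟩
  have hV := hq.invariant.isStable_preimage W
  have hVa : IsAffineOpen (q ⁻¹ᵁ W) := hW.preimage q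
  let := sectionsAction ρ hV
  obtain ⟨a, ha⟩ := ι.app_surjective _ hVa c
  obtain ⟨b, hb, hba⟩ := exists_invariant_sub_mem_fixedIdeal (G := G)
    (hχ.isUnit_natCard (V := q ⁻¹ᵁ W) hX) a
  rw [← ker_app_eq_fixedIdeal hι hV hVa, RingHom.mem_ker, map_sub, sub_eq_zero] at hba
  obtain ⟨d, hd⟩ := (hq.sections W).exists_app_eq b fun g => by
    have := hb g⁻¹
    change sectionsMap ρ hV g⁻¹⁻¹ b = b at this
    rwa [inv_inv] at this
  refine ⟨d, ?_⟩
  rw [Scheme.Hom.comp_app]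
  refine Eq.trans ?_ ha
  refine Eq.trans ?_ hba
  rw [← hd]
  rfl

omit [Finite G] in
lemma IsFixedScheme.apply_eq {ι : Z ⟶ X} [IsClosedImmersion ι] (hι : IsFixedScheme ρ ι) (g : G)
    (z : Z) : (ρ g).hom (ι z) = ι z :=
  congrArg (fun k => k.base z) (hι.fixed g)

/-- Fibres of `q` are orbits, and the orbit of a fixed point is a single point. -/
theorem IsFixedScheme.preimage_image (hq : IsGeometricQuotient ρ q) {ι : Z ⟶ X}
    [IsClosedImmersion ι] (hι : IsFixedScheme ρ ι) :
    q ⁻¹' (q '' Set.range ι) = Set.range ι := by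
  refine Set.Subset.antisymm ?_ (Set.subset_preimage_image _ _)
  rintro x ⟨-, ⟨z, rfl⟩, hz⟩
  obtain ⟨g, hg⟩ := hq.exists_of_apply_eq hz
  exact ⟨z, by rw [← hg, hι.apply_eq]⟩

/-- The complement of the fixed scheme is the inverse image of an open subset of the quotient. -/
theorem IsFixedScheme.exists_quotient_complement (hq : IsGeometricQuotient ρ q) {ι : Z ⟶ X}
    [IsClosedImmersion ι] (hι : IsFixedScheme ρ ι) :
    ∃ (V : Y.Opens) (hV : complement ι ≤ q ⁻¹ᵁ V), (V : Set Y) = (q '' Set.range ι)ᶜ ∧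
      IsGeometricQuotient (complementAction ρ ι hι) (q.resLE V (complement ι) hV) := by
  let V : Y.Opens := ⟨(q '' Set.range ι)ᶜ,
    (hq.isClosedMap _ ι.isClosedEmbedding.isClosed_range).isOpen_compl⟩
  have hUV : complement ι = q ⁻¹ᵁ V := by
    refine TopologicalSpace.Opens.ext ?_
    change (Set.range ι)ᶜ = (q ⁻¹' (q '' Set.range ι))ᶜ
    rw [hι.preimage_image hq]
  exact ⟨V, hUV.le, rfl, hq.restrict (complement_le_preimage ρ ι hι) hUV⟩

end Image


/-! ### Free actions and torsors -/

section Torsor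

open TensorProduct

/-- A statement about `A ⊗[R] A` holds for every pushout of `R ⟶ A` with itself. -/
lemma bijective_pi_of_isPushout {ι : Type*} {R A B : CommRingCat.{u}} {i : R ⟶ A} {j k : A ⟶ B}
    (h : IsPushout i i j k) (σ : ι → (A ⟶ A)) (φ : ι → (B ⟶ A)) (hj : ∀ g, j ≫ φ g = σ g)
    (hk : ∀ g, k ≫ φ g = 𝟙 A) (τ : ι → letI := i.hom.toAlgebra; (A →ₐ[R] A))
    (hτ : ∀ g a, τ g a = σ g a)
    (hbij : letI := i.hom.toAlgebra; Function.Bijective (AlgHom.pi fun g : ι =>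
      Algebra.TensorProduct.productMap (τ g) (AlgHom.id R A))) :
    Function.Bijective fun (b : B) (g : ι) => φ g b := by
  let := i.hom.toAlgebra
  have h' := CommRingCat.isPushout_tensorProduct R A A
  let e := h'.isoIsPushout _ _ h
  have he : ∀ x : A ⊗[R] A, (fun g => φ g (e.hom x)) = AlgHom.pi (fun g : ι =>
      Algebra.TensorProduct.productMap (τ g) (AlgHom.id R A)) x := fun x => funext fun g => by
    have h1 : e.hom ≫ φ g = CommRingCat.ofHom
        (Algebra.TensorProduct.productMap (τ g) (AlgHom.id R A)).toRingHom := by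
      refine h'.hom_ext ?_ ?_
      · rw [IsPushout.inl_isoIsPushout_hom_assoc, hj]
        ext a
        change σ g a = Algebra.TensorProduct.productMap (τ g) (AlgHom.id R A) (a ⊗ₜ 1)
        rw [Algebra.TensorProduct.productMap_apply_tmul, map_one, mul_one, hτ]
      · rw [IsPushout.inr_isoIsPushout_hom_assoc, hk]
        ext a
        change a = Algebra.TensorProduct.productMap (τ g) (AlgHom.id R A) (1 ⊗ₜ a)
        rw [Algebra.TensorProduct.productMap_apply_tmul, map_one, one_mul, AlgHom.id_apply]
    exact congrArg (fun k => k.hom x) h1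
  have hf : (fun (x : A ⊗[R] A) (g : ι) => φ g (e.hom x)) = (fun (b : B) (g : ι) => φ g b) ∘
      e.commRingCatIsoToRingEquiv := rfl
  refine (Function.Bijective.of_comp_iff _ e.commRingCatIsoToRingEquiv.bijective).mp ?_
  rw [← hf, funext he]
  exact hbij

lemma appLE_id_self {X : Scheme.{u}} (V : X.Opens) (e : V ≤ 𝟙 X ⁻¹ᵁ V) :
    (𝟙 X : X ⟶ X).appLE V V e = 𝟙 _ := by
  refine (congrArg (· ≫ _) (Scheme.Hom.id_app V)).trans ((Category.id_comp _).trans ?_)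
  exact X.presheaf.map_id _

lemma injective_map_of_eq {X : Scheme.{u}} {U V : X.Opens} (h : U = V) :
    Function.Injective (X.presheaf.map (homOfLE h.ge).op) := by
  subst h
  change Function.Injective (X.presheaf.map (𝟙 _))
  rw [CategoryTheory.Functor.map_id]
  exact Function.injective_id

/-- Functions on a disjoint union are determined by their restrictions to the components. -/
lemma sigma_app_ext {ι : Type v} [Small.{u} ι] {X : ι → Scheme.{u}} {U : (∐ X).Opens}
    {s t : Γ(∐ X, U)} (h : ∀ g, (Sigma.ι X g).app U s = (Sigma.ι X g).app U t) : s = t := by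
  refine (∐ X).sheaf.eq_of_locally_eq' (fun g => (Sigma.ι X g) ''ᵁ (Sigma.ι X g) ⁻¹ᵁ U) U
    (fun g => homOfLE (Scheme.Hom.image_preimage_le _ _)) (fun x hx => ?_) s t fun g => ?_
  · obtain ⟨g, y, rfl⟩ := (sigmaOpenCover X).exists_eq x
    exact TopologicalSpace.Opens.mem_iSup.mpr ⟨g, y, hx, rfl⟩
  · have h1 : (∐ X).presheaf.map (homOfLE ((Sigma.ι X g).image_preimage_le U)).op ≫
        ((Sigma.ι X g).appIso ((Sigma.ι X g) ⁻¹ᵁ U)).hom = (Sigma.ι X g).app U := by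
      rw [Scheme.Hom.appIso_hom', Scheme.Hom.map_appLE, Scheme.Hom.appLE_eq_app]
    have h2 := h g
    rw [← h1] at h2
    exact ((Sigma.ι X g).appIso ((Sigma.ι X g) ⁻¹ᵁ U)).commRingCatIsoToRingEquiv.injective h2

variable {G : Type v} [Group G] [Finite G] {X Y Z S : Scheme.{u}} {ρ : G →* Aut X} {n : ℕ}
  {q : X ⟶ Y} {χ : G →* Γ(X, ⊤)}

lemma ι_torsorMap_fst (hq : IsInvariant ρ q) (g : G) :
    (Sigma.ι (fun _ : G => X) g ≫ torsorMap ρ q hq) ≫ pullback.fst q q = (ρ g).hom := by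
  rw [torsorMap, Sigma.ι_desc, pullback.lift_fst]

lemma ι_torsorMap_snd (hq : IsInvariant ρ q) (g : G) :
    (Sigma.ι (fun _ : G => X) g ≫ torsorMap ρ q hq) ≫ pullback.snd q q = 𝟙 X := by
  rw [torsorMap, Sigma.ι_desc, pullback.lift_snd]

lemma isAffineHom_of_forall_sigmaι {ι : Type v} [Finite ι] {X : ι → Scheme.{u}} {f : ∐ X ⟶ Y}
    (h : ∀ g, IsAffineHom (Sigma.ι X g ≫ f)) : IsAffineHom f := by
  refine ⟨fun W hW => ?_⟩
  have h1 : f ⁻¹ᵁ W = ⨆ g, Sigma.ι X g ''ᵁ (Sigma.ι X g ≫ f) ⁻¹ᵁ W := by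
    refine le_antisymm (fun x hx => ?_) (iSup_le fun g => ?_)
    · obtain ⟨g, y, rfl⟩ := (sigmaOpenCover X).exists_eq x
      exact TopologicalSpace.Opens.mem_iSup.mpr ⟨g, y, hx, rfl⟩
    · exact Scheme.Hom.image_preimage_le (Sigma.ι X g) (f ⁻¹ᵁ W)
  rw [h1]
  refine IsAffineOpen.iSup_of_disjoint (fun g => (hW.preimage _).image_of_isOpenImmersion _)
    fun g g' hg => ?_
  exact (disjoint_opensRange_sigmaι X g g' hg).mono (Scheme.Hom.image_le_opensRange _ _)
    (Scheme.Hom.image_le_opensRange _ _)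

lemma isAffineHom_torsorMap (hq : IsGeometricQuotient ρ q) :
    IsAffineHom (torsorMap ρ q hq.invariant) := by
  have := hq.isAffineHom
  have h1 : IsAffineHom (torsorMap ρ q hq.invariant ≫ pullback.snd q q) :=
    isAffineHom_of_forall_sigmaι fun g => by
      rw [← Category.assoc, ι_torsorMap_snd]
      infer_instance
  exact .of_comp _ (pullback.snd q q)

/-- A tame action of a group of prime order without fixed points is a torsor over the quotient. -/
theorem IsGeometricQuotient.isIso_torsorMap (hq : IsGeometricQuotient ρ q)
    (hχ : IsTameCharacter ρ n χ) (hn : n.Prime) (hfree : ∀ x, ¬ IsFixedPoint ρ x) :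
    IsIso (torsorMap ρ q hq.invariant) := by
  have hT := isAffineHom_torsorMap hq
  have := hq.isAffineHom
  choose W hW₀ hWa hxW χ' t ht htu using fun x =>
    hq.exists_isKummer_isUnit hχ hn (hfree x) (W₀ := ⊤) trivial
  let p := pullback.fst q q ≫ q
  have : IsAffineHom (pullback.fst q q) :=
    MorphismProperty.IsStableUnderBaseChange.of_isPullback (P := @IsAffineHom)
      (IsPullback.of_hasPullback q q).flip this
  have : IsAffineHom p := inferInstanceAs (IsAffineHom (pullback.fst q q ≫ q))
  change MorphismProperty.isomorphisms _ _
  refine IsZariskiLocalAtTarget.of_iSup_eq_top (fun x => p ⁻¹ᵁ W x) ?_ fun x => ?_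
  · refine top_le_iff.mp fun z _ => TopologicalSpace.Opens.mem_iSup.mpr ?_
    exact ⟨pullback.fst q q z, hxW (pullback.fst q q z)⟩
  change IsIso _
  rw [isIso_morphismRestrict_iff_isIso_app _ ((hWa x).preimage p)]
  have hV := hq.invariant.isStable_preimage (W x)
  let := sectionsAction ρ hV
  let := (q.app (W x)).hom.toAlgebra
  have := hq.algebra_isInvariant (W x)
  have := hq.smulCommClass (W x)
  have hX : Nonempty X := ⟨x⟩
  have := hχ.isCyclic hX
  cases nonempty_fintype G
  have hbij := (ht x).isPrimitiveCharacter.bijective_torsorHom (A₀ := Γ(Y, W x)) (ht x).isWeight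
    (hχ.natCard_eq hX ▸ hn.one_lt) (hχ.isUnit_natCard hX) (htu x)
  -- The group acts on functions through inverses, so the components are indexed by `g⁻¹`.
  have hbij' : Function.Bijective (AlgHom.pi fun g : G => Algebra.TensorProduct.productMap
      (MulSemiringAction.toAlgHom Γ(Y, W x) Γ(X, q ⁻¹ᵁ W x) g⁻¹)
      (AlgHom.id Γ(Y, W x) Γ(X, q ⁻¹ᵁ W x))) :=
    ((Equiv.inv G).arrowCongr (Equiv.refl Γ(X, q ⁻¹ᵁ W x))).bijective.comp hbij
  set T := torsorMap ρ q hq.invariant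
  have hsnd : p ⁻¹ᵁ W x = pullback.snd q q ⁻¹ᵁ q ⁻¹ᵁ W x := by
    change (pullback.fst q q ≫ q) ⁻¹ᵁ W x = _
    rw [pullback.condition]
    rfl
  have hpo := (isIso_pushoutSection_iff (IsPullback.of_hasPullback q q) (US := W x) le_rfl le_rfl
    (UY := p ⁻¹ᵁ W x) (le_antisymm (le_inf le_rfl hsnd.le) inf_le_left)).mp
      (isIso_pushoutSection_of_isAffineOpen (IsPullback.of_hasPullback q q) le_rfl le_rfl _
        (hWa x) ((hWa x).preimage q) ((hWa x).preimage q))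
  rw [Scheme.Hom.appLE_eq_app] at hpo
  have hle' : ∀ g, (Sigma.ι (fun _ : G => X) g) ⁻¹ᵁ T ⁻¹ᵁ p ⁻¹ᵁ W x = q ⁻¹ᵁ W x := fun g => by
    rw [hsnd, ← Scheme.Hom.comp_preimage, ← Scheme.Hom.comp_preimage, ι_torsorMap_snd]
    rfl
  have hle : ∀ g, q ⁻¹ᵁ W x ≤ (Sigma.ι (fun _ : G => X) g) ⁻¹ᵁ T ⁻¹ᵁ p ⁻¹ᵁ W x := fun g => by
    rw [hle' g]
  let ψ : ∀ g, Γ(∐ fun _ : G => X, T ⁻¹ᵁ p ⁻¹ᵁ W x) ⟶ Γ(X, q ⁻¹ᵁ W x) := fun g =>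
    (Sigma.ι (fun _ : G => X) g).appLE _ _ (hle g)
  have h1 := bijective_pi_of_isPushout hpo (fun g => sectionsMap ρ hV g)
    (fun g => T.app (p ⁻¹ᵁ W x) ≫ ψ g)
    (fun g => by
      rw [← Scheme.Hom.appLE_eq_app, Scheme.Hom.appLE_comp_appLE, Scheme.Hom.appLE_comp_appLE]
      exact appLE_congr_hom (ι_torsorMap_fst hq.invariant g) _ _ _)
    (fun g => by
      rw [← Scheme.Hom.appLE_eq_app, Scheme.Hom.appLE_comp_appLE, Scheme.Hom.appLE_comp_appLE]
      refine (appLE_congr_hom (ι_torsorMap_snd hq.invariant g) _ _ _).trans ?_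
      exact appLE_id_self _ _)
    (fun g => MulSemiringAction.toAlgHom Γ(Y, W x) Γ(X, q ⁻¹ᵁ W x) g⁻¹)
    (fun g a => by
      change sectionsMap ρ hV g⁻¹⁻¹ a = _
      rw [inv_inv]) hbij'
  have hinj : Function.Injective fun s g => ψ g s := fun s s' hss => sigma_app_ext fun g => by
    exact injective_map_of_eq (hle' g) (congrFun hss g)
  rw [ConcreteCategory.isIso_iff_bijective]
  refine ⟨fun a b hab => h1.1 (funext fun g => congrArg (ψ g) hab), fun s => ?_⟩
  obtain ⟨a, ha⟩ := h1.2 fun g => ψ g s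
  exact ⟨a, hinj ha⟩

/-- Over the complement of the fixed scheme, a tame action of a group of prime order makes `X` a
torsor over its quotient. The hypothesis `hχ` is tameness of the action on every equivariant
`X`-scheme. -/
theorem IsFixedScheme.isIso_torsorMap {q : X ⟶ Y} (hq : IsGeometricQuotient ρ q)
    (hχ : ∀ {X' : Scheme.{u}} (j : X' ⟶ X) (ρ' : G →* Aut X')
      (_ : ∀ g, (ρ' g).hom ≫ j = j ≫ (ρ g).hom), ∃ χ', IsTameCharacter ρ' n χ')
    (hn : n.Prime) {ι : Z ⟶ X} [IsClosedImmersion ι] (hι : IsFixedScheme ρ ι) {W : Scheme.{u}}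
    {r : (complement ι : Scheme.{u}) ⟶ W}
    (hr : IsCategoricalQuotient (complementAction ρ ι hι) r) :
    IsIso (torsorMap (complementAction ρ ι hι) r hr.invariant) := by
  obtain ⟨V, hV, -, hqV⟩ := hι.exists_quotient_complement hq
  obtain ⟨χ', hχ'⟩ := hχ (complement ι).ι (complementAction ρ ι hι)
    (IsGeometricQuotient.restrictAction_comp_ι ρ (complement_le_preimage ρ ι hι))
  exact (hr.isGeometricQuotient hqV).isIso_torsorMap hχ' hn (not_isFixedPoint_complement hι)

end Torsor


/-! ### Sections of sheaves of modules -/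

section Sections

open Scheme.Modules hiding pullback

variable {X Y Z : Scheme.{u}} {M N P : X.Modules}

/-- The functor of sections over an open subset. -/
noncomputable def sectionsFunctor (U : X.Opens) : X.Modules ⥤ Ab.{u} :=
  toPresheaf X ⋙ (evaluation _ _).obj (.op U)

instance (U : X.Opens) : PreservesLimits (sectionsFunctor U) :=
  have : PreservesLimits ((evaluation (TopologicalSpace.Opens X)ᵒᵖ Ab.{u}).obj (.op U)) :=
    ⟨fun {_} _ => inferInstance⟩
  comp_preservesLimits (toPresheaf X) ((evaluation (TopologicalSpace.Opens X)ᵒᵖ Ab.{u}).obj (.op U))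

lemma app_injective_of_mono (i : M ⟶ N) [Mono i] (U : X.Opens) : Function.Injective (i.app U) := by
  have h := (inferInstance : Mono ((sectionsFunctor U).map i))
  exact (AddCommGrpCat.mono_iff_injective _).mp h

lemma exists_app_eq_of_isLimit {f g : M ⟶ N} {K : X.Modules} {i : K ⟶ M} {w : i ≫ f = i ≫ g}
    (hc : IsLimit (Fork.ofι i w)) {U : X.Opens}
    (m : Γ(M, U)) (hm : f.app U m = g.app U m) : ∃ k, i.app U k = m := by
  have h1 := isLimitForkMapOfIsLimit (sectionsFunctor U ⋙ forget Ab) w hc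
  obtain ⟨k, hk, -⟩ := (Types.type_equalizer_iff_unique _ _).mp ⟨h1⟩ m hm
  exact ⟨k, hk⟩

lemma map_app (φ : M ⟶ N) {U V : X.Opens} (h : U ≤ V) (m : Γ(M, V)) :
    φ.app U (M.presheaf.map (homOfLE h).op m) = N.presheaf.map (homOfLE h).op (φ.app V m) :=
  ConcreteCategory.congr_hom (φ.mapPresheaf.naturality (homOfLE h).op) m

lemma map_map (M : X.Modules) {U V W : X.Opens} (h : U ≤ V) (h' : V ≤ W) (m : Γ(M, W)) :
    M.presheaf.map (homOfLE h).op (M.presheaf.map (homOfLE h').op m) =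
      M.presheaf.map (homOfLE (h.trans h')).op m :=
  congrArg (fun k => k.hom m) (M.presheaf.map_comp (homOfLE h').op (homOfLE h).op).symm

lemma map_self (M : X.Modules) {U : X.Opens} (h : U ≤ U) (m : Γ(M, U)) :
    M.presheaf.map (homOfLE h).op m = m :=
  congrArg (fun k => k.hom m) (M.presheaf.map_id (.op U))

lemma section_ext (M : X.Modules) {U : X.Opens} {s t : Γ(M, U)}
    (h : ∀ x ∈ U, ∃ (V : X.Opens) (hV : V ≤ U), x ∈ V ∧
      M.presheaf.map (homOfLE hV).op s = M.presheaf.map (homOfLE hV).op t) : s = t := by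
  choose V hV hxV hst using fun x : U => h x.1 x.2
  exact TopCat.Sheaf.eq_of_locally_eq' ⟨M.presheaf, M.isSheaf⟩ V U (fun x => homOfLE (hV x))
    (fun x hx => TopologicalSpace.Opens.mem_iSup.mpr ⟨⟨x, hx⟩, hxV ⟨x, hx⟩⟩) s t hst

/-- The endomorphism of the sections of `M` over `V` defined by a morphism `M ⟶ k_* M`, when `V` is
stable under `k`. -/
noncomputable def twistedMap {k : X ⟶ X} (φ : M ⟶ (pushforward k).obj M) {V : X.Opens}
    (hV : V ≤ k ⁻¹ᵁ V) : Γ(M, V) →+ Γ(M, V) :=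
  (φ.app V ≫ M.presheaf.map (homOfLE hV).op).hom

lemma twistedMap_smul {k : X ⟶ X} (φ : M ⟶ (pushforward k).obj M) {V : X.Opens}
    (hV : V ≤ k ⁻¹ᵁ V) (a : Γ(X, V)) (m : Γ(M, V)) :
    twistedMap φ hV (a • m) = k.appLE V V hV a • twistedMap φ hV m := by
  refine (congrArg _ (φ.app_smul a m)).trans ?_
  exact map_smul M (homOfLE hV) (k.app V a) (φ.app V m : Γ(M, k ⁻¹ᵁ V))

lemma twistedMap_map {k : X ⟶ X} (φ : M ⟶ (pushforward k).obj M) {V V' : X.Opens}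
    (hV : V ≤ k ⁻¹ᵁ V) (hV' : V' ≤ k ⁻¹ᵁ V') (h : V' ≤ V) (m : Γ(M, V)) :
    twistedMap φ hV' (M.presheaf.map (homOfLE h).op m) =
      M.presheaf.map (homOfLE h).op (twistedMap φ hV m) := by
  let y : Γ(M, k ⁻¹ᵁ V) := φ.app V m
  exact (congrArg (M.presheaf.map (homOfLE hV').op) (map_app φ h m)).trans
    ((map_map M hV' (k.preimage_mono h) y).trans (map_map M h hV y).symm)

lemma twistedMap_id {k : X ⟶ X} (hk : 𝟙 X = k) {V : X.Opens} (hV : V ≤ k ⁻¹ᵁ V) (m : Γ(M, V)) :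
    twistedMap ((pushforwardId X).inv.app M ≫ (pushforwardCongr hk).hom.app M) hV m = m := by
  subst hk
  exact (map_map M (W := V) hV le_rfl m).trans (map_self M _ m)

lemma twistedMap_comp {k l n : X ⟶ X} (h : l ≫ k = n) (φ : M ⟶ (pushforward k).obj M)
    (ψ : M ⟶ (pushforward l).obj M) {V : X.Opens} (hk : V ≤ k ⁻¹ᵁ V) (hl : V ≤ l ⁻¹ᵁ V)
    (hn : V ≤ n ⁻¹ᵁ V) (m : Γ(M, V)) :
    twistedMap (φ ≫ (pushforward k).map ψ ≫ (pushforwardComp l k).hom.app M ≫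
      (pushforwardCongr h).hom.app M) hn m = twistedMap ψ hl (twistedMap φ hk m) := by
  subst h
  let y : Γ(M, k ⁻¹ᵁ V) := φ.app V m
  let z : Γ(M, l ⁻¹ᵁ k ⁻¹ᵁ V) := ψ.app (k ⁻¹ᵁ V) y
  exact (map_map M hn (le_refl (l ⁻¹ᵁ k ⁻¹ᵁ V)) z).trans
    ((map_map M hl (l.preimage_mono hk) z).symm.trans
      (congrArg (M.presheaf.map (homOfLE hl).op) (map_app ψ hk y).symm))

lemma twistedMap_unit {k : X ⟶ X} {ι : Z ⟶ X} (h : ι ≫ k = ι) (φ : M ⟶ (pushforward k).obj M)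
    {K : Z.Modules} (η : M ⟶ (pushforward ι).obj K) {V : X.Opens} (hV : V ≤ k ⁻¹ᵁ V)
    (m : Γ(M, V)) :
    (φ ≫ (pushforward k).map η ≫ (pushforwardComp ι k).hom.app K ≫
      (pushforwardCongr h).hom.app K).app V m = η.app V (twistedMap φ hV m) := by
  exact (map_app η hV (φ.app V m : Γ(M, k ⁻¹ᵁ V))).symm

end Sections

/-! ### Equivariant modules -/

section EquivariantModules

open Scheme.Modules hiding pullback

variable {G : Type v} [Group G] {X Y Z : Scheme.{u}} {ρ : G →* Aut X} {M : X.Modules}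

/-- The action of `g` on the sections of an equivariant module over a stable open subset. -/
noncomputable def moduleSectionsMap (α : EquivariantStructure ρ M) {V : X.Opens} (hV : IsStable ρ V)
    (g : G) : Γ(M, V) →+ Γ(M, V) :=
  twistedMap (α.act g) (hV g)

lemma moduleSectionsMap_smul (α : EquivariantStructure ρ M) {V : X.Opens} (hV : IsStable ρ V)
    (g : G) (a : Γ(X, V)) (m : Γ(M, V)) :
    moduleSectionsMap α hV g (a • m) = sectionsMap ρ hV g a • moduleSectionsMap α hV g m :=
  twistedMap_smul _ _ _ _

lemma moduleSectionsMap_map (α : EquivariantStructure ρ M) {V V' : X.Opens} (hV : IsStable ρ V)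
    (hV' : IsStable ρ V') (h : V' ≤ V) (g : G) (m : Γ(M, V)) :
    moduleSectionsMap α hV' g (M.presheaf.map (homOfLE h).op m) =
      M.presheaf.map (homOfLE h).op (moduleSectionsMap α hV g m) :=
  twistedMap_map _ _ _ h m

lemma moduleSectionsMap_one (α : EquivariantStructure ρ M) {V : X.Opens} (hV : IsStable ρ V)
    (m : Γ(M, V)) : moduleSectionsMap α hV 1 m = m := by
  rw [moduleSectionsMap, α.act_one]
  exact twistedMap_id _ _ m

lemma moduleSectionsMap_mul (α : EquivariantStructure ρ M) {V : X.Opens} (hV : IsStable ρ V)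
    (g h : G) (m : Γ(M, V)) : moduleSectionsMap α hV (g * h) m =
      moduleSectionsMap α hV h (moduleSectionsMap α hV g m) := by
  rw [moduleSectionsMap, α.act_mul]
  exact twistedMap_comp _ _ _ (hV g) (hV h) _ m

/-- The action on `ι^* M` is compatible with the one on `M`. -/
lemma pullbackAction_app_unit (α : EquivariantStructure ρ M) {ι : Z ⟶ X}
    (hι : ∀ g : G, ι ≫ (ρ g).hom = ι) {V : X.Opens} (hV : IsStable ρ V) (g : G) (m : Γ(M, V)) :
    (pullbackAction α hι g).app (ι ⁻¹ᵁ V)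
        (((pullbackPushforwardAdjunction ι).unit.app M).app V m) =
      ((pullbackPushforwardAdjunction ι).unit.app M).app V (moduleSectionsMap α hV g m) := by
  have h1 : (pullbackPushforwardAdjunction ι).unit.app M ≫
      (pushforward ι).map (pullbackAction α hι g) = _ :=
    ((pullbackPushforwardAdjunction ι).homEquiv_unit _ _ _).symm.trans (Equiv.apply_symm_apply _ _)
  exact (congrArg (fun k => Hom.app k V m) h1).trans (twistedMap_unit (hι g) (α.act g) _ (hV g) m)

lemma pullback_hom_ext {f : Z ⟶ X} {K : Z.Modules} {φ ψ : (Scheme.Modules.pullback f).obj M ⟶ K}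
    (h : ∀ (U : X.Opens) (m : Γ(M, U)),
      φ.app (f ⁻¹ᵁ U) (((pullbackPushforwardAdjunction f).unit.app M).app U m) =
        ψ.app (f ⁻¹ᵁ U) (((pullbackPushforwardAdjunction f).unit.app M).app U m)) : φ = ψ := by
  refine ((pullbackPushforwardAdjunction f).homEquiv _ _).injective ?_
  rw [Adjunction.homEquiv_unit, Adjunction.homEquiv_unit]
  refine Scheme.Modules.hom_ext _ _ fun U => ?_
  ext m
  exact h U m

omit [Group G] in
lemma invariantsι_app_injective [Finite G] (a : G → (M ⟶ M)) (U : X.Opens) :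
    Function.Injective ((invariantsι a).app U) := by
  have : Mono (invariantsι a) := inferInstanceAs (Mono (equalizer.ι _ _))
  exact app_injective_of_mono _ _

omit [Group G] in
lemma invariantsι_comp [Finite G] (a : G → (M ⟶ M)) (g : G) :
    invariantsι a ≫ a g = invariantsι a := by
  have h := congrArg (· ≫ Pi.π (fun _ : G => M) g)
    (equalizer.condition (Pi.lift a) (Pi.lift fun _ : G => 𝟙 M))
  simp only [Category.assoc, limit.lift_π, Fan.mk_pt, Fan.mk_π_app] at h
  exact h.trans (Category.comp_id _)

omit [Group G] in
lemma exists_invariantsι_app_eq [Finite G] (a : G → (M ⟶ M)) {U : X.Opens} (m : Γ(M, U))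
    (hm : ∀ g, (a g).app U m = m) : ∃ k, (invariantsι a).app U k = m := by
  refine exists_app_eq_of_isLimit (equalizerIsEqualizer (Pi.lift a) (Pi.lift fun _ : G => 𝟙 M)) m ?_
  refine Concrete.isLimit_ext _ (isLimitOfPreserves (sectionsFunctor U)
    (limit.isLimit (Discrete.functor fun _ : G => M))) _ _ fun ⟨g⟩ => ?_
  have h1 := congrArg (fun k => Hom.app k U m) (limit.lift_π (Fan.mk M a) ⟨g⟩)
  have h2 := congrArg (fun k => Hom.app k U m) (limit.lift_π (Fan.mk M fun _ : G => 𝟙 M) ⟨g⟩)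
  exact h1.trans ((hm g).trans h2.symm)

end EquivariantModules

/-! ### The invariants of the conormal sheaf -/

section Conormal

open Scheme.Modules hiding pullback

variable {G : Type v} [Group G] {X Y Z : Scheme.{u}} {ρ : G →* Aut X} {n : ℕ} {ι : Z ⟶ X}

lemma exists_idealInclusion_app_eq (ι : Z ⟶ X) {U : X.Opens} {a : Γ(X, U)}
    (ha : ι.app U a = 0) : ∃ m : Γ(idealModule ι, U), (idealInclusion ι).app U m = a :=
  exists_app_eq_of_isLimit (f := structureMap ι) (g := 0) (kernelIsKernel (structureMap ι)) a ha

lemma app_idealInclusion_app (ι : Z ⟶ X) {U : X.Opens} (m : Γ(idealModule ι, U)) :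
    ι.app U ((idealInclusion ι).app U m : Γ(X, U)) = 0 :=
  congrArg (fun k => Hom.app k U m) (kernel.condition (structureMap ι))

/-- The unit `I ⟶ ι_* ι^* I` vanishes on `I ⬝ I`. -/
lemma unit_app_smul_eq_zero {M : X.Modules} {U : X.Opens} {a : Γ(X, U)} (ha : ι.app U a = 0)
    (m : Γ(M, U)) : ((pullbackPushforwardAdjunction ι).unit.app M).app U (a • m) = 0 := by
  rw [Hom.app_smul]
  have : ∀ x : Γ((Scheme.Modules.pullback ι).obj M, ι ⁻¹ᵁ U), ι.app U a • x = 0 := fun x => by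
    rw [ha, zero_smul]
  exact this _

lemma idealInclusion_moduleSectionsMap (hι : ∀ g : G, ι ≫ (ρ g).hom = ι) {V : X.Opens}
    (hV : IsStable ρ V) (g : G) (m : Γ(idealModule ι, V)) :
    (idealInclusion ι).app V (moduleSectionsMap (idealEquivariant ρ ι hι) hV g m) =
      sectionsMap ρ hV g ((idealInclusion ι).app V m : Γ(X, V)) := by
  have h1 := congrArg (fun k => Hom.app k V m) (idealAct_inclusion ι (ρ g).hom (hι g))
  refine (map_app (idealInclusion ι) (hV g) _).trans ?_
  exact congrArg (X.presheaf.map (homOfLE (hV g)).op) h1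

variable [Finite G] {q : X ⟶ Y} {χ : G →* Γ(X, ⊤)}

omit [Finite G] in
/-- The trace of a section of the ideal of the fixed scheme vanishes in the conormal sheaf. -/
lemma unit_app_sum_moduleSectionsMap [Fintype G] (hχ : IsTameCharacter ρ n χ) [IsClosedImmersion ι]
    (hι : IsFixedScheme ρ ι) {V : X.Opens} (hV : IsStable ρ V) (hVa : IsAffineOpen V)
    (hX : Nonempty X) (m : Γ(idealModule ι, V)) :
    ((pullbackPushforwardAdjunction ι).unit.app (idealModule ι)).app V
      (∑ g, moduleSectionsMap (idealEquivariant ρ ι hι.fixed) hV g m) = 0 := by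
  let := sectionsAction ρ hV
  have := hχ.isCyclic hX
  have hker := ker_app_eq_fixedIdeal hι hV hVa
  -- Sections of the ideal sheaf which belong to the square of the ideal vanish in the conormal
  -- sheaf.
  have key : ∀ s ∈ fixedIdeal G Γ(X, V) * fixedIdeal G Γ(X, V),
      ∃ m' : Γ(idealModule ι, V), (idealInclusion ι).app V m' = s ∧
        ((pullbackPushforwardAdjunction ι).unit.app (idealModule ι)).app V m' = 0 := by
    intro s hs
    rw [← hker] at hs
    induction hs using Submodule.mul_induction_on' with
    | mem_mul_mem b hb c hc =>
      obtain ⟨m', hm'⟩ := exists_idealInclusion_app_eq ι hc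
      exact ⟨b • m', (Hom.app_smul _ _ _).trans (congrArg (b • ·) hm'),
        unit_app_smul_eq_zero hb m'⟩
    | add b _ c _ hb hc =>
      obtain ⟨m₁, h1, h1'⟩ := hb
      obtain ⟨m₂, h2, h2'⟩ := hc
      exact ⟨m₁ + m₂, (map_add _ _ _).trans (congrArg₂ (· + ·) h1 h2), by
        rw [map_add, h1', h2', add_zero]⟩
  have ha : ((idealInclusion ι).app V m : Γ(X, V)) ∈ fixedIdeal G Γ(X, V) := by
    rw [← hker]
    exact app_idealInclusion_app ι m
  obtain ⟨m', hm', h0⟩ := key _ ((hχ.isPrimitiveCharacter hV).sum_smul_mem_sq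
    (hχ.isUnit_natCard hX) ha)
  suffices h : ∑ g, moduleSectionsMap (idealEquivariant ρ ι hι.fixed) hV g m = m' by rw [h, h0]
  refine app_injective_of_mono (idealInclusion ι) V ?_
  rw [hm', map_sum]
  refine Fintype.sum_equiv (Equiv.inv G) _ _ fun g => ?_
  refine (idealInclusion_moduleSectionsMap hι.fixed hV g m).trans ?_
  change _ = sectionsMap ρ hV g⁻¹⁻¹ _
  rw [inv_inv]

lemma sum_app {M N : X.Modules} {κ : Type*} (s : Finset κ) (φ : κ → (M ⟶ N)) (U : X.Opens)
    (m : Γ(M, U)) : (∑ g ∈ s, φ g).app U m = ∑ g ∈ s, (φ g).app U m :=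
  map_sum (⟨⟨fun φ : M ⟶ N => φ.app U m, rfl⟩, fun _ _ => rfl⟩ : (M ⟶ N) →+ Γ(N, U)) φ s

/-- The trace on the conormal sheaf vanishes. -/
theorem sum_conormalAction [Fintype G] (hq : IsGeometricQuotient ρ q) (hχ : IsTameCharacter ρ n χ)
    [IsClosedImmersion ι] (hι : IsFixedScheme ρ ι) :
    ∑ g, conormalAction ρ ι hι.fixed g = 0 := by
  have := hq.isAffineHom
  refine pullback_hom_ext (φ := ∑ g, conormalAction ρ ι hι.fixed g) (ψ := 0) fun U m => ?_
  set D := (pullbackPushforwardAdjunction ι).unit.app (idealModule ι) ≫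
    (pushforward ι).map (∑ g, conormalAction ρ ι hι.fixed g)
  change D.app U m = 0
  refine section_ext (conormalSheaf ι) (U := ι ⁻¹ᵁ U) (s := D.app U m) (t := 0) fun z hz => ?_
  have hX : Nonempty X := ⟨ι z⟩
  obtain ⟨N, hxN, hN⟩ := hq.exists_preimage_le (fun g => hι.apply_eq g z) (show ι z ∈ U from hz)
  obtain ⟨W, hW, hxW, hWN⟩ := exists_isAffineOpen_mem_and_subset hxN
  have hVU : q ⁻¹ᵁ W ≤ U := (q.preimage_mono hWN).trans hN
  have hV := hq.invariant.isStable_preimage W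
  refine ⟨ι ⁻¹ᵁ q ⁻¹ᵁ W, ι.preimage_mono hVU, hxW, ?_⟩
  rw [map_zero]
  refine (map_app D hVU m).symm.trans ?_
  refine (sum_app Finset.univ (conormalAction ρ ι hι.fixed) _ _).trans ?_
  refine Eq.trans ?_ (unit_app_sum_moduleSectionsMap hχ hι hV (hW.preimage q) hX
    ((idealModule ι).presheaf.map (homOfLE hVU).op m))
  rw [map_sum]
  exact Finset.sum_congr rfl fun g _ =>
    pullbackAction_app_unit (idealEquivariant ρ ι hι.fixed) hι.fixed hV g _

/-- As the order of `G` is invertible, an invariant section is determined by its trace. -/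
theorem isZero_invariants_conormalAction (hq : IsGeometricQuotient ρ q)
    (hχ : IsTameCharacter ρ n χ) [IsClosedImmersion ι] (hι : IsFixedScheme ρ ι) :
    IsZero (invariants (conormalAction ρ ι hι.fixed)) := by
  cases nonempty_fintype G
  have hmono : Mono (invariantsι (conormalAction ρ ι hι.fixed)) :=
    inferInstanceAs (Mono (equalizer.ι _ _))
  have h1 : ∑ _ : G, invariantsι (conormalAction ρ ι hι.fixed) = 0 := by
    have h2 : invariantsι (conormalAction ρ ι hι.fixed) ≫ ∑ g, conormalAction ρ ι hι.fixed g = 0 := by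
      rw [sum_conormalAction hq hχ hι, comp_zero]
    rw [Preadditive.comp_sum] at h2
    simpa only [invariantsι_comp] using h2
  have h3 : invariantsι (conormalAction ρ ι hι.fixed) = 0 := by
    refine Scheme.Modules.hom_ext _ _ fun U => ?_
    ext m
    change (invariantsι (conormalAction ρ ι hι.fixed)).app U m = 0
    refine section_ext _ fun z hz => ⟨U, le_rfl, hz, congrArg _ ?_⟩
    have hc : IsUnit (Nat.card G : Γ(Z, U)) := by
      have h4 := hχ.isUnit_natCard (V := ⊤) ⟨ι z⟩
      have h5 := (h4.map ι.appTop.hom).map (Z.presheaf.map (homOfLE (le_top : U ≤ ⊤)).op).hom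
      rwa [map_natCast, map_natCast] at h5
    refine hc.smul_eq_zero.mp ?_
    rw [Nat.cast_smul_eq_nsmul, Nat.card_eq_fintype_card, ← Finset.card_univ, ← Finset.sum_const]
    exact (sum_app Finset.univ (fun _ : G => invariantsι (conormalAction ρ ι hι.fixed)) U m).symm.trans
      (congrArg (fun k => Hom.app k U m) h1)
  refine (IsZero.iff_id_eq_zero _).mpr ?_
  rw [← cancel_mono (invariantsι (conormalAction ρ ι hι.fixed)), h3, comp_zero, comp_zero]

end Conormal


/-! ### Local bases of modules -/

section LocalBasis

open Scheme.Modules hiding pullback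

variable {X Y Z : Scheme.{u}} {M N : X.Modules} {V : X.Opens} {r : ℕ}

lemma presheaf_map_map (X : Scheme.{u}) {U V W : X.Opens} (h : U ≤ V) (h' : V ≤ W) (a : Γ(X, W)) :
    X.presheaf.map (homOfLE h).op (X.presheaf.map (homOfLE h').op a) =
      X.presheaf.map (homOfLE (h.trans h')).op a :=
  congrArg (fun k => k.hom a) (X.presheaf.map_comp (homOfLE h').op (homOfLE h).op).symm

lemma presheaf_map_self (X : Scheme.{u}) {U : X.Opens} (h : U ≤ U) (a : Γ(X, U)) :
    X.presheaf.map (homOfLE h).op a = a :=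
  congrArg (fun k => k.hom a) (X.presheaf.map_id (.op U))

lemma exists_glue_functions {U : X.Opens} {κ : Type*} {D : κ → X.Opens} (hD : ∀ k, D k ≤ U)
    (hcover : U ≤ iSup D) (a : ∀ k, Γ(X, D k))
    (h : ∀ k l, X.presheaf.map (homOfLE (inf_le_left : D k ⊓ D l ≤ D k)).op (a k) =
      X.presheaf.map (homOfLE (inf_le_right : D k ⊓ D l ≤ D l)).op (a l)) :
    ∃ b : Γ(X, U), ∀ k, X.presheaf.map (homOfLE (hD k)).op b = a k :=
  (X.sheaf.existsUnique_gluing' D U (fun k => homOfLE (hD k)) hcover a h).exists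

lemma exists_glue_sections (M : X.Modules) {U : X.Opens} {κ : Type*} {D : κ → X.Opens}
    (hD : ∀ k, D k ≤ U) (hcover : U ≤ iSup D) (a : ∀ k, Γ(M, D k))
    (h : ∀ k l, M.presheaf.map (homOfLE (inf_le_left : D k ⊓ D l ≤ D k)).op (a k) =
      M.presheaf.map (homOfLE (inf_le_right : D k ⊓ D l ≤ D l)).op (a l)) :
    ∃ b : Γ(M, U), ∀ k, M.presheaf.map (homOfLE (hD k)).op b = a k :=
  (TopCat.Sheaf.existsUnique_gluing' ⟨M.presheaf, M.isSheaf⟩ D U (fun k => homOfLE (hD k))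
    hcover a h).exists

lemma function_ext {U : X.Opens} {a b : Γ(X, U)}
    (h : ∀ x ∈ U, ∃ (V : X.Opens) (hV : V ≤ U), x ∈ V ∧
      X.presheaf.map (homOfLE hV).op a = X.presheaf.map (homOfLE hV).op b) : a = b := by
  choose V hV hxV hst using fun x : U => h x.1 x.2
  exact X.sheaf.eq_of_locally_eq' V U (fun x => homOfLE (hV x))
    (fun x hx => TopologicalSpace.Opens.mem_iSup.mpr ⟨⟨x, hx⟩, hxV ⟨x, hx⟩⟩) a b hst

/-- The linear combination of the restrictions to `V'` of sections `e i` over `V`. -/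
noncomputable def linComb (e : Fin r → Γ(M, V)) {V' : X.Opens} (h : V' ≤ V)
    (c : Fin r → Γ(X, V')) : Γ(M, V') :=
  ∑ i, c i • M.presheaf.map (homOfLE h).op (e i)

lemma map_linComb (e : Fin r → Γ(M, V)) {V' V'' : X.Opens} (h : V' ≤ V) (h' : V'' ≤ V')
    (c : Fin r → Γ(X, V')) : M.presheaf.map (homOfLE h').op (linComb e h c) =
      linComb e (h'.trans h) fun i => X.presheaf.map (homOfLE h').op (c i) := by
  rw [linComb, map_sum]
  exact Finset.sum_congr rfl fun i _ => by rw [map_smul, map_map]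

lemma linComb_map (e : Fin r → Γ(M, V)) {V' V'' : X.Opens} (h : V' ≤ V) (h' : V'' ≤ V')
    (c : Fin r → Γ(X, V'')) : linComb (fun i => M.presheaf.map (homOfLE h).op (e i)) h' c =
      linComb e (h'.trans h) c :=
  Finset.sum_congr rfl fun i _ => by rw [map_map]

lemma app_linComb (φ : M ⟶ N) (e : Fin r → Γ(M, V)) {V' : X.Opens} (h : V' ≤ V)
    (c : Fin r → Γ(X, V')) : φ.app V' (linComb e h c) = linComb (fun i => φ.app V (e i)) h c := by
  rw [linComb, map_sum]
  exact Finset.sum_congr rfl fun i _ => by rw [Hom.app_smul, map_app]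

lemma linComb_add (e : Fin r → Γ(M, V)) {V' : X.Opens} (h : V' ≤ V) (c d : Fin r → Γ(X, V')) :
    linComb e h (c + d) = linComb e h c + linComb e h d := by
  simp only [linComb, Pi.add_apply, add_smul, Finset.sum_add_distrib]

lemma linComb_smul (e : Fin r → Γ(M, V)) {V' : X.Opens} (h : V' ≤ V) (a : Γ(X, V'))
    (c : Fin r → Γ(X, V')) : linComb e h (a • c) = a • linComb e h c := by
  simp only [linComb, Pi.smul_apply, smul_eq_mul, mul_smul, Finset.smul_sum]

lemma linComb_single (e : Fin r → Γ(M, V)) {V' : X.Opens} (h : V' ≤ V) (j : Fin r) :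
    linComb e h (Pi.single j 1) = M.presheaf.map (homOfLE h).op (e j) := by
  rw [linComb, Finset.sum_eq_single j]
  · rw [Pi.single_eq_same, one_smul]
  · intro i _ hi
    rw [Pi.single_eq_of_ne hi, zero_smul]
  · intro hj
    exact absurd (Finset.mem_univ j) hj

/-- The sections `e i` over `V` are a basis of the restriction of `M` to `V`, as a sheaf of
modules. -/
def IsLocalBasis (e : Fin r → Γ(M, V)) : Prop :=
  ∀ (V' : X.Opens) (h : V' ≤ V), Function.Bijective (linComb e h)

namespace IsLocalBasis

variable {e : Fin r → Γ(M, V)}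

lemma restrict (he : IsLocalBasis e) {V' : X.Opens} (h : V' ≤ V) :
    IsLocalBasis fun i => M.presheaf.map (homOfLE h).op (e i) := fun V'' h' => by
  have : linComb (fun i => M.presheaf.map (homOfLE h).op (e i)) h' = linComb e (h'.trans h) :=
    funext fun c => linComb_map e h h' c
  rw [this]
  exact he V'' _

/-- The coordinates of a section in a basis. -/
noncomputable def coord (he : IsLocalBasis e) {V' : X.Opens} (h : V' ≤ V) (m : Γ(M, V')) :
    Fin r → Γ(X, V') :=
  (Equiv.ofBijective _ (he V' h)).symm m

variable (he : IsLocalBasis e)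

lemma linComb_coord {V' : X.Opens} (h : V' ≤ V) (m : Γ(M, V')) : linComb e h (he.coord h m) = m :=
  (Equiv.ofBijective _ (he V' h)).apply_symm_apply m

lemma coord_eq {V' : X.Opens} (h : V' ≤ V) {m : Γ(M, V')} {c : Fin r → Γ(X, V')}
    (hc : linComb e h c = m) : he.coord h m = c :=
  (he V' h).1 ((he.linComb_coord h m).trans hc.symm)

lemma coord_add {V' : X.Opens} (h : V' ≤ V) (m m' : Γ(M, V')) :
    he.coord h (m + m') = he.coord h m + he.coord h m' :=
  he.coord_eq h (by rw [linComb_add, linComb_coord, linComb_coord])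

lemma coord_smul {V' : X.Opens} (h : V' ≤ V) (a : Γ(X, V')) (m : Γ(M, V')) :
    he.coord h (a • m) = a • he.coord h m :=
  he.coord_eq h (by rw [linComb_smul, linComb_coord])

lemma coord_map {V' V'' : X.Opens} (h : V' ≤ V) (h' : V'' ≤ V') (m : Γ(M, V')) :
    he.coord (h'.trans h) (M.presheaf.map (homOfLE h').op m) =
      fun i => X.presheaf.map (homOfLE h').op (he.coord h m i) :=
  he.coord_eq _ (by rw [← map_linComb e h h', linComb_coord])

lemma coord_apply {V' : X.Opens} (h : V' ≤ V) (j : Fin r) :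
    he.coord h (M.presheaf.map (homOfLE h).op (e j)) = Pi.single j 1 :=
  he.coord_eq h (linComb_single e h j)

lemma coord_zero {V' : X.Opens} (h : V' ≤ V) : he.coord h 0 = 0 :=
  he.coord_eq h (by simp [linComb])

include he in
/-- Sections whose matrix of coordinates is invertible are a basis. -/
lemma of_isUnit_det {m : Fin r → Γ(M, V)}
    (hdet : IsUnit (Matrix.of fun j => he.coord le_rfl (m j)).det) : IsLocalBasis m := by
  intro V' h
  set a : Matrix (Fin r) (Fin r) Γ(X, V) := Matrix.of fun j => he.coord le_rfl (m j) with ha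
  set a' := a.map (X.presheaf.map (homOfLE h).op).hom with ha'
  have hdet' : IsUnit a'.det := by
    have := hdet.map (X.presheaf.map (homOfLE h).op).hom
    rwa [RingHom.map_det] at this
  have h1 : ∀ j, M.presheaf.map (homOfLE h).op (m j) = linComb e h (a' j) := fun j => by
    conv_lhs => rw [← he.linComb_coord le_rfl (m j), map_linComb]
    rfl
  have h2 : linComb m h = linComb e h ∘ fun c => Matrix.vecMul c a' := by
    funext c
    have h3 : Matrix.vecMul c a' = ∑ j, c j • a' j := by
      ext i
      simp [Matrix.vecMul, dotProduct, Finset.sum_apply]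
    let L : (Fin r → Γ(X, V')) →ₗ[Γ(X, V')] Γ(M, V') :=
      { toFun := linComb e h
        map_add' := linComb_add e h
        map_smul' := linComb_smul e h }
    change _ = L (Matrix.vecMul c a')
    rw [h3, map_sum]
    refine Finset.sum_congr rfl fun j _ => ?_
    rw [_root_.map_smul, h1]
    rfl
  rw [h2]
  refine (he V' h).comp ⟨fun c d hcd => ?_, fun d => ⟨Matrix.vecMul d a'⁻¹, ?_⟩⟩
  · have := congrArg (fun c => Matrix.vecMul c a'⁻¹) hcd
    simpa only [Matrix.vecMul_vecMul, Matrix.mul_nonsing_inv _ hdet', Matrix.vecMul_one] using this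
  · change Matrix.vecMul (Matrix.vecMul d a'⁻¹) a' = d
    rw [Matrix.vecMul_vecMul, Matrix.nonsing_inv_mul _ hdet', Matrix.vecMul_one]

omit he in
/-- To be a basis is a local property. -/
lemma of_forall_exists (h : ∀ x ∈ V, ∃ (V' : X.Opens) (h : V' ≤ V), x ∈ V' ∧
    IsLocalBasis fun i => M.presheaf.map (homOfLE h).op (e i)) : IsLocalBasis e := by
  intro V' hV'
  choose U hU hxU hb using h
  have hcov : V' ≤ ⨆ x : V', U x.1 (hV' x.2) ⊓ V' := fun x hx =>
    TopologicalSpace.Opens.mem_iSup.mpr ⟨⟨x, hx⟩, hxU x _, hx⟩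
  constructor
  · intro c d hcd
    funext i
    refine function_ext fun x hx => ⟨_, inf_le_right, ⟨hxU x (hV' hx), hx⟩, ?_⟩
    have h1 := congrArg (M.presheaf.map
      (homOfLE (inf_le_right : U x (hV' hx) ⊓ V' ≤ V')).op) hcd
    rw [map_linComb, map_linComb, ← linComb_map e (hU x (hV' hx)) inf_le_left,
      ← linComb_map e (hU x (hV' hx)) inf_le_left] at h1
    exact congrFun ((hb x (hV' hx) _ inf_le_left).1 h1) i
  · intro m
    let c : ∀ x : V', Fin r → Γ(X, U x.1 (hV' x.2) ⊓ V') := fun x =>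
      (hb x.1 (hV' x.2)).coord inf_le_left (M.presheaf.map (homOfLE inf_le_right).op m)
    have hc : ∀ x : V', linComb e (inf_le_right.trans hV') (c x) =
        M.presheaf.map (homOfLE inf_le_right).op m := fun x => by
      rw [← (hb x.1 (hV' x.2)).linComb_coord inf_le_left
        (M.presheaf.map (homOfLE inf_le_right).op m), linComb_map]
    have hglue : ∀ i, ∃ b : Γ(X, V'), ∀ x : V',
        X.presheaf.map (homOfLE (inf_le_right : U x.1 (hV' x.2) ⊓ V' ≤ V')).op b = c x i := by
      intro i
      refine exists_glue_functions (fun _ => inf_le_right) hcov (fun x => c x i) fun x y => ?_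
      have h1 : ∀ z : V', ∀ (O : X.Opens) (hO : O ≤ U z.1 (hV' z.2) ⊓ V'),
          linComb e (hO.trans (inf_le_right.trans hV'))
            (fun i => X.presheaf.map (homOfLE hO).op (c z i)) =
          M.presheaf.map (homOfLE (hO.trans inf_le_right)).op m := fun z O hO => by
        rw [← map_linComb e (inf_le_right.trans hV') hO, hc, map_map]
      have h2 := (h1 x _ inf_le_left).trans (h1 y _ inf_le_right).symm
      have hO : U x.1 (hV' x.2) ⊓ V' ⊓ (U y.1 (hV' y.2) ⊓ V') ≤ U x.1 (hV' x.2) :=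
        inf_le_left.trans inf_le_left
      rw [← linComb_map e (hU x.1 (hV' x.2)) hO, ← linComb_map e (hU x.1 (hV' x.2)) hO] at h2
      exact congrFun ((hb x.1 (hV' x.2) _ hO).1 h2) i
    choose b hb' using hglue
    refine ⟨b, section_ext M fun x hx => ⟨_, inf_le_right, ⟨hxU x (hV' hx), hx⟩, ?_⟩⟩
    rw [map_linComb]
    refine Eq.trans ?_ (hc ⟨x, hx⟩)
    congr 1
    exact funext fun i => hb' i ⟨x, hx⟩

end IsLocalBasis

lemma IsLocalBasis.of_iso (θ : M ≅ N) {e : Fin r → Γ(M, V)} (he : IsLocalBasis e) :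
    IsLocalBasis fun i => θ.hom.app V (e i) := fun V' h => by
  have h1 : linComb (fun i => θ.hom.app V (e i)) h = θ.hom.app V' ∘ linComb e h :=
    funext fun c => (app_linComb θ.hom e h c).symm
  rw [h1]
  exact (ConcreteCategory.bijective_of_isIso (θ.hom.app V')).comp (he V' h)

/-- The tautological basis of a free module. -/
lemma exists_isLocalBasis_free (X : Scheme.{u}) (r : ℕ) {F : X.Modules}
    (hF : F = (SheafOfModules.free (ULift.{u} (Fin r)) : SheafOfModules X.ringCatSheaf)) :
    ∃ e : Fin r → Γ(F, ⊤), IsLocalBasis e := by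
  let b : ∀ i : ULift.{u} (Fin r), structureModule X ⟶ F := fun i =>
    (SheafOfModules.ιFree i : SheafOfModules.unit X.ringCatSheaf ⟶ _) ≫ eqToHom hF.symm
  have c : IsColimit (Cofan.mk F b) := by
    subst hF
    exact (SheafOfModules.isColimitFreeCofan (R := X.ringCatSheaf) (ULift.{u} (Fin r))).ofIsoColimit
      (Cofan.ext (Iso.refl _) fun i => rfl)
  classical
  let p : ∀ j : ULift.{u} (Fin r), F ⟶ structureModule X := fun j =>
    Cofan.IsColimit.desc c fun i => if i = j then 𝟙 _ else 0
  have hbp : ∀ i j, b i ≫ p j = if i = j then 𝟙 _ else 0 := fun i j =>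
    Cofan.IsColimit.fac c _ i
  have hpb : ∑ i, p i ≫ b i = 𝟙 F := by
    refine Cofan.IsColimit.hom_ext c _ _ fun j => ?_
    change b j ≫ _ = b j ≫ _
    rw [Preadditive.comp_sum, Category.comp_id, Finset.sum_eq_single j]
    · exact (Category.assoc _ _ _).symm.trans
        ((congrArg (· ≫ b j) ((hbp j j).trans (if_pos rfl))).trans (Category.id_comp _))
    · intro i _ hij
      exact (Category.assoc _ _ _).symm.trans
        ((congrArg (· ≫ b i) ((hbp j i).trans (if_neg hij.symm))).trans zero_comp)
    · intro hj
      exact absurd (Finset.mem_univ j) hj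
  have h1 : ∀ (i) (U : X.Opens) (a : Γ(X, U)), (b i).app U (a : Γ(structureModule X, U)) =
      a • F.presheaf.map (homOfLE le_top).op ((b i).app ⊤ (1 : Γ(X, ⊤))) :=
      fun i U a => by
    refine Eq.trans ?_ (congrArg (a • ·) (map_app (b i) (le_top : U ≤ ⊤) (1 : Γ(X, ⊤))))
    refine Eq.trans (congrArg ((b i).app U) ?_) (Hom.app_smul (b i) a _)
    exact (mul_one a).symm.trans
      (congrArg (a * ·) (map_one (X.presheaf.map (homOfLE le_top).op).hom).symm)
  refine ⟨fun i => (b ⟨i⟩).app ⊤ (1 : Γ(X, ⊤)), fun U hU => ?_⟩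
  have h2 : ∀ a : Fin r → Γ(X, U), linComb (M := F) (fun i => (b ⟨i⟩).app ⊤ (1 : Γ(X, ⊤))) hU a =
      ∑ i : Fin r, (b ⟨i⟩).app U (a i : Γ(structureModule X, U)) := fun a =>
    Finset.sum_congr rfl fun i _ => (h1 ⟨i⟩ U (a i)).symm
  have h3 : ∀ (a : Fin r → Γ(structureModule X, U)) j,
      (p ⟨j⟩).app U (∑ i : Fin r, (b ⟨i⟩).app U (a i)) = a j := fun a j => by
    rw [map_sum, Finset.sum_eq_single j]
    · refine (congrArg (fun k => Hom.app k U (a j)) (hbp ⟨j⟩ ⟨j⟩)).trans ?_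
      rw [if_pos rfl]
      rfl
    · intro i _ hij
      refine (congrArg (fun k => Hom.app k U (a i)) (hbp ⟨i⟩ ⟨j⟩)).trans ?_
      rw [if_neg (fun h => hij (ULift.up_injective h))]
      rfl
    · intro hj
      exact absurd (Finset.mem_univ j) hj
  refine ⟨fun a a' haa' => ?_, fun m => ⟨fun i => ((p ⟨i⟩).app U m : Γ(structureModule X, U)), ?_⟩⟩
  · rw [h2, h2] at haa'
    funext j
    exact (h3 a j).symm.trans ((congrArg ((p ⟨j⟩).app U) haa').trans (h3 a' j))
  · refine (h2 _).trans ?_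
    refine Eq.trans ?_ (congrArg (fun k => Hom.app k U m) hpb)
    refine Eq.trans ?_ (sum_app Finset.univ (fun i => p i ≫ b i) U m).symm
    exact Fintype.sum_equiv Equiv.ulift.symm _ _ fun i => rfl

/-- A locally free module has a basis on a neighbourhood of every point. -/
lemma IsLocallyFreeOfFiniteRank.exists_isLocalBasis (hM : IsLocallyFreeOfFiniteRank M) (x : X) :
    ∃ (V : X.Opens) (_ : x ∈ V) (r : ℕ) (e : Fin r → Γ(M, V)), IsLocalBasis e := by
  obtain ⟨U, hxU, r, ⟨θ⟩⟩ := hM x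
  obtain ⟨e₀, he₀⟩ := exists_isLocalBasis_free (U : Scheme.{u}) r rfl
  have he := IsLocalBasis.of_iso θ.symm he₀
  set e := fun i => θ.symm.hom.app ⊤ (e₀ i)
  refine ⟨U.ι ''ᵁ ⊤, by simpa using hxU, r, fun i => (e i : Γ(M, U.ι ''ᵁ ⊤)), fun V' hV' => ?_⟩
  obtain ⟨V, rfl⟩ : ∃ V : (U : Scheme.{u}).Opens, V' = U.ι ''ᵁ V :=
    ⟨U.ι ⁻¹ᵁ V', by
      rw [Scheme.Hom.image_preimage_eq_opensRange_inf]
      exact (inf_eq_right.mpr (hV'.trans (by simp))).symm⟩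
  have h1 : linComb e le_top = linComb (M := M) (fun i => (e i : Γ(M, U.ι ''ᵁ ⊤))) hV' ∘
      fun c i => (U.ι.appIso V).inv (c i) := funext fun c => by
    refine Finset.sum_congr rfl fun i _ => ?_
    exact ConcreteCategory.congr_hom (smul_restrictAppIso_hom U.ι M V (c i)) _
  have h2 : Function.Bijective fun (c : Fin r → Γ(U, V)) i => (U.ι.appIso V).inv (c i) :=
    Function.Bijective.piMap fun _ => ConcreteCategory.bijective_of_isIso (U.ι.appIso V).inv
  exact (Function.Bijective.of_comp_iff _ h2).mp (h1 ▸ he V le_top)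

end LocalBasis


/-! ### Morphisms defined by local bases -/

section HomOfBasis

open Scheme.Modules hiding pullback

variable {X T : Scheme.{u}} {M : X.Modules} {V : X.Opens} {r : ℕ}

lemma appLE_map_apply {k : T ⟶ X} {U U' : X.Opens} {W W' : T.Opens} (e : W ≤ k ⁻¹ᵁ U)
    (hU : U' ≤ U) (hW : W' ≤ W) (e' : W' ≤ k ⁻¹ᵁ U') (a : Γ(X, U)) :
    k.appLE U' W' e' (X.presheaf.map (homOfLE hU).op a) =
      T.presheaf.map (homOfLE hW).op (k.appLE U W e a) := by
  have h1 := congrArg (fun φ => φ.hom a) (Scheme.Hom.map_appLE k e' (homOfLE hU).op)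
  have h2 := congrArg (fun φ => φ.hom a) (Scheme.Hom.appLE_map k e (homOfLE hW).op)
  exact h1.trans h2.symm

/-- A basis of `M` over an open subset through which `k` factors, together with sections of a
module `K` on the source of `k`, defines a morphism `M ⟶ k_* K`. -/
theorem IsLocalBasis.exists_hom {e : Fin r → Γ(M, V)} (he : IsLocalBasis e) (k : T ⟶ X)
    (hk : ⊤ ≤ k ⁻¹ᵁ V) (K : T.Modules) (f : Fin r → Γ(K, ⊤)) :
    ∃ D : M ⟶ (pushforward k).obj K, ∀ (V' : X.Opens) (h : V' ≤ V) (c : Fin r → Γ(X, V')),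
      D.app V' (linComb e h c) = linComb (V' := k ⁻¹ᵁ V') f le_top fun i => k.app V' (c i) := by
  -- As `k` factors through `V`, sections over `k ⁻¹ U` only depend on `U ⊓ V`, where there are
  -- coordinates.
  have hle : ∀ U : X.Opens, k ⁻¹ᵁ U ≤ k ⁻¹ᵁ (U ⊓ V) := fun U t ht => ⟨ht, hk trivial⟩
  let F : ∀ U : X.Opens, Γ(M, U) → Γ(K, k ⁻¹ᵁ U) := fun U m =>
    linComb f le_top fun i => k.appLE (U ⊓ V) (k ⁻¹ᵁ U) (hle U)
      (he.coord inf_le_right (M.presheaf.map (homOfLE inf_le_left).op m) i)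
  have hadd : ∀ U m m', F U (m + m') = F U m + F U m' := fun U m m' => by
    simp only [F, map_add, coord_add]
    rw [← linComb_add]
    congr 1
    funext i
    exact map_add (k.appLE (U ⊓ V) (k ⁻¹ᵁ U) (hle U)).hom _ _
  have hsmul : ∀ U (a : Γ(X, U)) m, F U (a • m) = k.app U a • F U m := fun U a m => by
    simp only [F, map_smul, coord_smul]
    rw [← linComb_smul]
    congr 1
    funext i
    refine (map_mul (k.appLE (U ⊓ V) (k ⁻¹ᵁ U) (hle U)).hom _ _).trans (congrArg (· * _) ?_)
    refine (appLE_map_apply (W := k ⁻¹ᵁ U) le_rfl inf_le_left le_rfl (hle U) a).trans ?_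
    rw [← Scheme.Hom.app_eq_appLE]
    exact presheaf_map_self _ _ _
  have hmap : ∀ (U U' : X.Opens) (h : U' ≤ U) m, F U' (M.presheaf.map (homOfLE h).op m) =
      K.presheaf.map (homOfLE (k.preimage_mono h)).op (F U m) := fun U U' h m => by
    simp only [F]
    rw [map_linComb f le_top (k.preimage_mono h), map_map]
    congr 1
    funext i
    rw [← appLE_map_apply (hle U) (inf_le_inf_right V h) (k.preimage_mono h) (hle U')]
    refine congrArg (k.appLE (U' ⊓ V) (k ⁻¹ᵁ U') (hle U')) ?_
    refine Eq.trans ?_ (congrFun (he.coord_map inf_le_right (inf_le_inf_right V h) _) i)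
    rw [map_map]
  let φ : M.presheaf ⟶ ((pushforward k).obj K).presheaf :=
    { app := fun U => AddCommGrpCat.ofHom (AddMonoidHom.mk' (F U.unop) (hadd U.unop))
      naturality := fun U U' h => by
        ext m
        exact hmap U.unop U'.unop h.unop.le m }
  let D : M ⟶ (pushforward k).obj K :=
    ⟨PresheafOfModules.homMk φ fun U a m => hsmul U.unop a m⟩
  refine ⟨D, fun V' h c => ?_⟩
  change F V' _ = _
  simp only [F]
  congr 1
  funext i
  have h1 : he.coord (inf_le_right : V' ⊓ V ≤ V) (M.presheaf.map (homOfLE inf_le_left).op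
      (linComb e h c)) = fun i => X.presheaf.map (homOfLE inf_le_left).op (c i) :=
    he.coord_eq _ (map_linComb e h inf_le_left c).symm
  rw [h1]
  refine (appLE_map_apply (W := k ⁻¹ᵁ V') le_rfl inf_le_left le_rfl (hle V') (c i)).trans ?_
  rw [← Scheme.Hom.app_eq_appLE]
  exact presheaf_map_self _ _ _

end HomOfBasis


/-! ### Extension of sections of locally free modules -/

section Extension

open Scheme.Modules hiding pullback

variable {X : Scheme.{u}} {M : X.Modules} {V : X.Opens} {r : ℕ}

/-- Over an affine open subset with a basis, sections over a basic open subset extend after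
multiplication with a power of the function. -/
lemma IsLocalBasis.exists_map_eq_pow_smul {e : Fin r → Γ(M, V)} (he : IsLocalBasis e)
    (hV : IsAffineOpen V) (h : Γ(X, V)) {D : X.Opens} (hD : D = X.basicOpen h) (hDV : D ≤ V)
    (s : Γ(M, D)) : ∃ (N : ℕ) (t : Γ(M, V)), M.presheaf.map (homOfLE hDV).op t =
      X.presheaf.map (homOfLE hDV).op h ^ N • s := by
  subst hD
  have := hV.isLocalization_basicOpen h
  obtain ⟨⟨_, N, rfl⟩, hb⟩ := IsLocalization.exist_integer_multiples_of_finite (Submonoid.powers h)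
    (he.coord hDV s)
  choose c hc using hb
  refine ⟨N, linComb e le_rfl c, ?_⟩
  rw [map_linComb]
  conv_rhs => rw [← he.linComb_coord hDV s, ← linComb_smul]
  congr 1
  funext i
  refine (hc i).trans ((Algebra.smul_def _ _).trans ?_)
  exact congrArg (· * _) (map_pow (X.presheaf.map (homOfLE hDV).op).hom h N)

lemma IsLocalBasis.exists_pow_smul_eq_zero {e : Fin r → Γ(M, V)} (he : IsLocalBasis e)
    (hV : IsAffineOpen V) (h : Γ(X, V)) {D : X.Opens} (hD : D = X.basicOpen h) (hDV : D ≤ V)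
    (s : Γ(M, V)) (hs : M.presheaf.map (homOfLE hDV).op s = 0) : ∃ N : ℕ, h ^ N • s = 0 := by
  subst hD
  have := hV.isLocalization_basicOpen h
  have h1 : ∀ i, ∃ N : ℕ, h ^ N * he.coord le_rfl s i = 0 := fun i => by
    have h2 : X.presheaf.map (homOfLE hDV).op (he.coord le_rfl s i) = 0 := by
      refine (congrFun (he.coord_map le_rfl hDV s) i).symm.trans ?_
      rw [hs, he.coord_zero]
      rfl
    obtain ⟨⟨_, N, rfl⟩, hN⟩ := (IsLocalization.map_eq_zero_iff (Submonoid.powers h)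
      Γ(X, X.basicOpen h) _).mp h2
    exact ⟨N, hN⟩
  choose N hN using h1
  refine ⟨∑ i, N i, ?_⟩
  rw [← he.linComb_coord le_rfl s, ← linComb_smul]
  refine Finset.sum_eq_zero fun i _ => ?_
  have h3 : (h ^ (∑ i, N i) • he.coord le_rfl s) i = 0 := by
    rw [Pi.smul_apply, smul_eq_mul, ← Finset.add_sum_erase _ _ (Finset.mem_univ i), pow_add,
      mul_right_comm, hN, zero_mul]
  rw [h3, zero_smul]

/-- Over an affine open subset, sections of a locally free module over a basic open subset extend
after multiplication with a power of the function. -/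
theorem IsLocallyFreeOfFiniteRank.exists_map_eq_pow_smul (hM : IsLocallyFreeOfFiniteRank M)
    (hV : IsAffineOpen V) (h : Γ(X, V)) (s : Γ(M, X.basicOpen h)) :
    ∃ (N : ℕ) (t : Γ(M, V)), M.presheaf.map (homOfLE (X.basicOpen_le h)).op t =
      X.presheaf.map (homOfLE (X.basicOpen_le h)).op h ^ N • s := by
  classical
  have h1 : ∀ x : V, ∃ f : Γ(X, V), x.1 ∈ X.basicOpen f ∧
      ∃ (r : ℕ) (e : Fin r → Γ(M, X.basicOpen f)), IsLocalBasis e := fun x => by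
    obtain ⟨U, hxU, r, e, he⟩ := hM.exists_isLocalBasis x.1
    obtain ⟨f, hfU, hxf⟩ := hV.exists_basicOpen_le ⟨x.1, hxU⟩ x.2
    exact ⟨f, hxf, r, _, he.restrict hfU⟩
  choose f hxf r e he using h1
  obtain ⟨κ, hκ⟩ := hV.isCompact.elim_finite_subcover (fun x => (X.basicOpen (f x) : Set X))
    (fun x => (X.basicOpen (f x)).isOpen) fun x hx => Set.mem_iUnion.mpr ⟨⟨x, hx⟩, hxf _⟩
  let D : κ → X.Opens := fun k => X.basicOpen (f k)
  have hD : ∀ k, D k ≤ V := fun k => X.basicOpen_le _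
  have hcov : V ≤ iSup D := fun x hx => by
    obtain ⟨k, hk, hxk⟩ := Set.mem_iUnion₂.mp (hκ hx)
    exact TopologicalSpace.Opens.mem_iSup.mpr ⟨⟨k, hk⟩, hxk⟩
  have hB := X.basicOpen_le h
  -- the extensions to the members of the cover, with a common exponent
  have h2 : ∀ k, ∃ (N : ℕ) (t : Γ(M, D k)),
      M.presheaf.map (homOfLE (inf_le_left : D k ⊓ X.basicOpen h ≤ D k)).op t =
        X.presheaf.map (homOfLE (inf_le_left.trans (hD k) : D k ⊓ X.basicOpen h ≤ V)).op h ^ N •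
          M.presheaf.map (homOfLE inf_le_right).op s := fun k => by
    obtain ⟨N, t, ht⟩ := (he k).exists_map_eq_pow_smul (hV.basicOpen (f k))
      (X.presheaf.map (homOfLE (hD k)).op h) (X.basicOpen_res h (homOfLE (hD k)).op).symm
      inf_le_left (M.presheaf.map (homOfLE inf_le_right).op s)
    rw [presheaf_map_map] at ht
    exact ⟨N, t, ht⟩
  choose N t ht using h2
  have h2 : ∃ N₁ : ℕ, ∀ k, ∃ t₁ : Γ(M, D k),
      M.presheaf.map (homOfLE (inf_le_left : D k ⊓ X.basicOpen h ≤ D k)).op t₁ =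
        X.presheaf.map (homOfLE (inf_le_left.trans (hD k) : D k ⊓ X.basicOpen h ≤ V)).op h ^ N₁ •
          M.presheaf.map (homOfLE inf_le_right).op s := by
    refine ⟨∑ k, N k, fun k =>
      ⟨X.presheaf.map (homOfLE (hD k)).op h ^ (∑ l ∈ Finset.univ.erase k, N l) • t k, ?_⟩⟩
    rw [Scheme.Modules.map_smul, ht, smul_smul, map_pow, presheaf_map_map, ← pow_add,
      Finset.sum_erase_add _ _ (Finset.mem_univ k)]
  obtain ⟨N₁, h2⟩ := h2
  choose t₁ ht₁ using h2
  -- they agree on the overlaps after multiplication with a power of `h`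
  have h3 : ∀ k l, ∃ N : ℕ,
      X.presheaf.map (homOfLE (inf_le_left.trans (hD k) : D k ⊓ D l ≤ V)).op h ^ N •
        (M.presheaf.map (homOfLE inf_le_left).op (t₁ k) -
          M.presheaf.map (homOfLE inf_le_right).op (t₁ l)) = 0 := fun k l => by
    have haff : IsAffineOpen (D k ⊓ D l) := by
      have := hV.basicOpen (f k * f l)
      rwa [X.basicOpen_mul] at this
    refine ((he k).restrict (inf_le_left : D k ⊓ D l ≤ D k)).exists_pow_smul_eq_zero haff _
      (X.basicOpen_res h (homOfLE (inf_le_left.trans (hD k) : D k ⊓ D l ≤ V)).op).symm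
      inf_le_left _ ?_
    have h4 : ∀ (k) (O : X.Opens) (hO : O ≤ D k) (hO' : O ≤ X.basicOpen h),
        M.presheaf.map (homOfLE hO).op (t₁ k) = X.presheaf.map (homOfLE (hO.trans (hD k))).op h ^ N₁ •
          M.presheaf.map (homOfLE hO').op s := fun k O hO hO' => by
      have := congrArg (M.presheaf.map (homOfLE (le_inf hO hO')).op) (ht₁ k)
      rw [map_map, Scheme.Modules.map_smul, map_map, map_pow, presheaf_map_map] at this
      exact this
    rw [map_sub, map_map, map_map, h4 k _ _ inf_le_right, h4 l _ _ inf_le_right, sub_self]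
  choose N₂ hN₂ using h3
  let N₃ := ∑ k, ∑ l, N₂ k l
  obtain ⟨b, hb⟩ := exists_glue_sections M hD hcov
    (fun k => X.presheaf.map (homOfLE (hD k)).op h ^ N₃ • t₁ k) fun k l => by
      rw [Scheme.Modules.map_smul, Scheme.Modules.map_smul, map_pow, map_pow, presheaf_map_map,
        presheaf_map_map, ← sub_eq_zero, ← smul_sub]
      have h5 : N₃ = (∑ a ∈ Finset.univ.erase k, ∑ l, N₂ a l + ∑ b ∈ Finset.univ.erase l, N₂ k b) +
          N₂ k l := by
        rw [add_assoc, Finset.sum_erase_add _ _ (Finset.mem_univ l),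
          Finset.sum_erase_add _ _ (Finset.mem_univ k)]
      rw [h5, pow_add, mul_smul]
      exact (congrArg _ (hN₂ k l)).trans (smul_zero _)
  refine ⟨N₃ + N₁, b, section_ext M fun x hx => ?_⟩
  obtain ⟨k, hk⟩ := TopologicalSpace.Opens.mem_iSup.mp (hcov (hB hx))
  refine ⟨D k ⊓ X.basicOpen h, inf_le_right, ⟨hk, hx⟩, ?_⟩
  have h6 := congrArg (M.presheaf.map (homOfLE (inf_le_left : D k ⊓ X.basicOpen h ≤ D k)).op) (hb k)
  rw [map_map, Scheme.Modules.map_smul, ht₁, map_pow, presheaf_map_map, smul_smul, ← pow_add] at h6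
  rw [map_map, Scheme.Modules.map_smul, map_pow, presheaf_map_map]
  exact h6

/-- Over an affine neighbourhood of a point there are sections of a locally free module which are
a basis near the point. -/
theorem IsLocallyFreeOfFiniteRank.exists_isLocalBasis_map (hM : IsLocallyFreeOfFiniteRank M)
    (hV : IsAffineOpen V) {x : X} (hx : x ∈ V) :
    ∃ (D : X.Opens) (hD : D ≤ V) (r : ℕ) (s : Fin r → Γ(M, V)), x ∈ D ∧
      IsLocalBasis fun i => M.presheaf.map (homOfLE hD).op (s i) := by
  obtain ⟨U, hxU, r, e, he⟩ := hM.exists_isLocalBasis x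
  obtain ⟨h, hhU, hxh⟩ := hV.exists_basicOpen_le ⟨x, hxU⟩ hx
  have he' := he.restrict hhU
  -- Multiplied with powers of `h`, which is invertible over `D(h)`, the members of a basis over
  -- `D(h)` extend to `V`.
  choose N s hs using fun i => hM.exists_map_eq_pow_smul hV h (M.presheaf.map (homOfLE hhU).op (e i))
  refine ⟨X.basicOpen h, X.basicOpen_le h, r, s, hxh, he'.of_isUnit_det ?_⟩
  have h1 : (Matrix.of fun j => he'.coord le_rfl
      (M.presheaf.map (homOfLE (X.basicOpen_le h)).op (s j))) =
        Matrix.diagonal fun j => X.presheaf.map (homOfLE (X.basicOpen_le h)).op h ^ N j := by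
    ext i j
    rw [Matrix.of_apply, hs, he'.coord_smul]
    have h2 := he'.coord_apply le_rfl i
    rw [map_self] at h2
    rw [h2, Pi.smul_apply, smul_eq_mul, Matrix.diagonal_apply, Pi.single_apply]
    by_cases hij : i = j
    · rw [if_pos hij, if_pos hij.symm, mul_one]
    · rw [if_neg hij, if_neg (Ne.symm hij), mul_zero]
  rw [h1, Matrix.det_diagonal]
  have hu : IsUnit (X.presheaf.map (homOfLE (X.basicOpen_le h)).op h) :=
    RingedSpace.isUnit_res_basicOpen _ h
  exact IsUnit.prod_univ_iff.mpr fun j => hu.pow _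

end Extension


/-! ### Bases of invariant sections -/

section Translation

open Scheme.Modules hiding pullback

variable {G : Type v} [Group G] {X : Scheme.{u}} {ρ : G →* Aut X} {M : X.Modules} {V : X.Opens}
  {r : ℕ}

lemma map_pushforwardId_app {k : X ⟶ X} (hk : 𝟙 X = k) {O U : X.Opens} (hO : O ≤ k ⁻¹ᵁ U)
    (hO' : O ≤ U) (m : Γ(M, U)) :
    M.presheaf.map (homOfLE hO).op
      (((pushforwardId X).inv.app M ≫ (pushforwardCongr hk).hom.app M).app U m : Γ(M, k ⁻¹ᵁ U)) =
        M.presheaf.map (homOfLE hO').op m := by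
  subst hk
  exact map_map M (W := U) hO le_rfl m

lemma map_pushforwardComp_app {k l n : X ⟶ X} (h : l ≫ k = n) (φ : M ⟶ (pushforward k).obj M)
    (ψ : M ⟶ (pushforward l).obj M) {O U : X.Opens} (hO : O ≤ n ⁻¹ᵁ U)
    (hO' : O ≤ l ⁻¹ᵁ k ⁻¹ᵁ U) (m : Γ(M, U)) :
    M.presheaf.map (homOfLE hO).op ((φ ≫ (pushforward k).map ψ ≫ (pushforwardComp l k).hom.app M ≫
      (pushforwardCongr h).hom.app M).app U m : Γ(M, n ⁻¹ᵁ U)) =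
        M.presheaf.map (homOfLE hO').op
          (ψ.app (k ⁻¹ᵁ U) (φ.app U m : Γ(M, k ⁻¹ᵁ U)) : Γ(M, l ⁻¹ᵁ k ⁻¹ᵁ U)) := by
  subst h
  let z : Γ(M, l ⁻¹ᵁ k ⁻¹ᵁ U) := ψ.app (k ⁻¹ᵁ U) (φ.app U m : Γ(M, k ⁻¹ᵁ U))
  exact map_map M hO (le_refl (l ⁻¹ᵁ k ⁻¹ᵁ U)) z

/-- The actions of mutually inverse elements are mutually inverse, up to the identification of open
subsets which are equal but not definitionally so. -/
lemma EquivariantStructure.map_act_act (α : EquivariantStructure ρ M) {g h : G} (hgh : g * h = 1)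
    {O U : X.Opens} (hO : O ≤ (ρ h).hom ⁻¹ᵁ (ρ g).hom ⁻¹ᵁ U) (hO' : O ≤ U) (m : Γ(M, U)) :
    M.presheaf.map (homOfLE hO).op ((α.act h).app ((ρ g).hom ⁻¹ᵁ U)
      ((α.act g).app U m : Γ(M, (ρ g).hom ⁻¹ᵁ U)) : Γ(M, (ρ h).hom ⁻¹ᵁ (ρ g).hom ⁻¹ᵁ U)) =
        M.presheaf.map (homOfLE hO').op m := by
  have h1 : ∀ (k : G) (_ : k = 1) (hk : O ≤ (ρ k).hom ⁻¹ᵁ U),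
      M.presheaf.map (homOfLE hk).op ((α.act k).app U m : Γ(M, (ρ k).hom ⁻¹ᵁ U)) =
        M.presheaf.map (homOfLE hO').op m := by
    rintro k rfl hk
    rw [α.act_one]
    exact map_pushforwardId_app _ hk hO' m
  have h2 : O ≤ (ρ (g * h)).hom ⁻¹ᵁ U := by rw [action_mul_hom]; exact hO
  refine Eq.trans ?_ (h1 _ hgh h2)
  rw [α.act_mul]
  exact (map_pushforwardComp_app _ _ _ h2 hO m).symm

lemma preimage_preimage_eq {g h : G} (hgh : g * h = 1) (U : X.Opens) :
    (ρ h).hom ⁻¹ᵁ (ρ g).hom ⁻¹ᵁ U = U := by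
  rw [← Scheme.Hom.comp_preimage, ← action_mul_hom, hgh, action_one_hom]
  rfl

lemma EquivariantStructure.bijective_act (α : EquivariantStructure ρ M) (g : G) (U : X.Opens) :
    Function.Bijective ((α.act g).app U) := by
  have h1 := preimage_preimage_eq (ρ := ρ) (mul_inv_cancel g) U
  have h2 := preimage_preimage_eq (ρ := ρ) (inv_mul_cancel g)
  constructor
  · intro a b hab
    rw [← map_self M le_rfl a, ← map_self M le_rfl b,
      ← α.map_act_act (mul_inv_cancel g) h1.ge le_rfl, hab,
      α.map_act_act (mul_inv_cancel g)]
  · intro b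
    let b' : Γ(M, (ρ g).hom ⁻¹ᵁ U) := b
    let c : Γ(M, (ρ g⁻¹).hom ⁻¹ᵁ (ρ g).hom ⁻¹ᵁ U) := (α.act g⁻¹).app ((ρ g).hom ⁻¹ᵁ U) b'
    refine ⟨M.presheaf.map (homOfLE h1.ge).op c, ?_⟩
    refine (map_app (α.act g) h1.ge c).trans ?_
    exact (α.map_act_act (inv_mul_cancel g) ((ρ g).hom.preimage_mono h1.ge) le_rfl b').trans
      (map_self M _ b')

/-- The translates of a basis of invariant sections are bases. -/
lemma IsLocalBasis.preimage (α : EquivariantStructure ρ M) (hV : IsStable ρ V)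
    {m : Fin r → Γ(M, V)} (g : G) (hm : ∀ j, moduleSectionsMap α hV g (m j) = m j)
    {U : X.Opens} (hU : U ≤ V) (hb : IsLocalBasis fun j => M.presheaf.map (homOfLE hU).op (m j))
    (hU' : (ρ g).hom ⁻¹ᵁ U ≤ V) :
    IsLocalBasis fun j => M.presheaf.map (homOfLE hU').op (m j) := by
  intro V' hV'
  obtain ⟨O, rfl⟩ : ∃ O, V' = (ρ g).hom ⁻¹ᵁ O :=
    ⟨_, (preimage_preimage_eq (inv_mul_cancel g) V').symm⟩
  have hO : O ≤ U := by
    rw [← preimage_preimage_eq (ρ := ρ) (mul_inv_cancel g) O,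
      ← preimage_preimage_eq (ρ := ρ) (mul_inv_cancel g) U]
    exact (ρ g⁻¹).hom.preimage_mono hV'
  have h1 : ∀ j, ((α.act g).app O (M.presheaf.map (homOfLE (hO.trans hU)).op (m j)) :
      Γ(M, (ρ g).hom ⁻¹ᵁ O)) = M.presheaf.map (homOfLE (hV'.trans hU')).op (m j) := fun j => by
    let y : Γ(M, (ρ g).hom ⁻¹ᵁ V) := (α.act g).app V (m j)
    refine (map_app (α.act g) (hO.trans hU) (m j)).trans ?_
    refine Eq.trans ?_ (congrArg (M.presheaf.map (homOfLE (hV'.trans hU')).op) (hm j))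
    exact (map_map M (hV'.trans hU') (hV g) y).symm
  have h2 : (α.act g).app O ∘ linComb (fun j => M.presheaf.map (homOfLE hU).op (m j)) hO =
      linComb (fun j => M.presheaf.map (homOfLE hU').op (m j)) hV' ∘
        fun c i => (ρ g).hom.app O (c i) := by
    funext c
    refine (map_sum ((α.act g).app O).hom _ _).trans (Finset.sum_congr rfl fun j _ => ?_)
    refine (Hom.app_smul _ _ _).trans ?_
    rw [map_map, map_map]
    exact congrArg (fun y : Γ(M, (ρ g).hom ⁻¹ᵁ O) => (ρ g).hom.app O (c j) • y) (h1 j)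
  have h3 : Function.Bijective fun (c : Fin r → Γ(X, O)) i => (ρ g).hom.app O (c i) :=
    have : IsIso (ρ g).hom := (ρ g).isIso_hom
    Function.Bijective.piMap fun _ => ConcreteCategory.bijective_of_isIso ((ρ g).hom.app O)
  exact (Function.Bijective.of_comp_iff _ h3).mp (h2 ▸ (α.bijective_act g O).comp (hb O hO))

end Translation

section InvariantBasis

open Scheme.Modules hiding pullback

variable {G : Type v} [Group G] {X Y Z : Scheme.{u}} {ρ : G →* Aut X} {M : X.Modules}
  {V D : X.Opens} {r : ℕ} {q : X ⟶ Y} {n : ℕ} {χ : G →* Γ(X, ⊤)}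

/-- The values at a point of the coordinates of a section. -/
noncomputable def IsLocalBasis.valueAt {e : Fin r → Γ(M, D)} (he : IsLocalBasis e) {x : X}
    (hx : x ∈ D) (m : Γ(M, D)) : Fin r → X.residueField x :=
  fun i => X.evaluation D x hx (he.coord le_rfl m i)

namespace IsLocalBasis

variable {e : Fin r → Γ(M, D)} (he : IsLocalBasis e) {x : X} (hx : x ∈ D)

lemma valueAt_add (m m' : Γ(M, D)) :
    he.valueAt hx (m + m') = he.valueAt hx m + he.valueAt hx m' := by
  funext i
  rw [valueAt, coord_add]
  exact map_add (X.evaluation D x hx).hom _ _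

lemma valueAt_smul (a : Γ(X, D)) (m : Γ(M, D)) :
    he.valueAt hx (a • m) = X.evaluation D x hx a • he.valueAt hx m := by
  funext i
  rw [valueAt, coord_smul]
  exact map_mul (X.evaluation D x hx).hom _ _

lemma valueAt_sum {κ : Type*} (s : Finset κ) (m : κ → Γ(M, D)) :
    he.valueAt hx (∑ k ∈ s, m k) = ∑ k ∈ s, he.valueAt hx (m k) :=
  map_sum (AddMonoidHom.mk' _ (he.valueAt_add hx)) m s

lemma valueAt_apply (j : Fin r) : he.valueAt hx (e j) = Pi.single j 1 := by
  have h := he.coord_apply le_rfl j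
  rw [map_self] at h
  funext i
  rw [valueAt, h, Pi.single_apply, Pi.single_apply]
  split_ifs
  · exact map_one (X.evaluation D x hx).hom
  · exact map_zero (X.evaluation D x hx).hom

include he in
/-- Sections whose values at a point are a basis of the fibre are a basis near the point. -/
lemma exists_restrict (m : Fin r → Γ(M, D))
    (hm : LinearIndependent (X.residueField x) fun j => he.valueAt hx (m j)) :
    ∃ (D' : X.Opens) (hD : D' ≤ D), x ∈ D' ∧
      IsLocalBasis fun j => M.presheaf.map (homOfLE hD).op (m j) := by
  set a : Matrix (Fin r) (Fin r) Γ(X, D) := Matrix.of fun j => he.coord le_rfl (m j) with ha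
  have hu : IsUnit (a.map (X.evaluation D x hx).hom) :=
    Matrix.linearIndependent_rows_iff_isUnit.mp hm
  have hxa : x ∈ X.basicOpen a.det := by
    rw [← X.evaluation_ne_zero_iff_mem_basicOpen x hx]
    have h1 := ((Matrix.isUnit_iff_isUnit_det _).mp hu).ne_zero
    have h2 := RingHom.map_det (X.evaluation D x hx).hom a
    exact fun h => h1 (h2.symm.trans h)
  refine ⟨_, X.basicOpen_le a.det, hxa, (he.restrict (X.basicOpen_le a.det)).of_isUnit_det ?_⟩
  have h3 : (Matrix.of fun j => (he.restrict (X.basicOpen_le a.det)).coord le_rfl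
      (M.presheaf.map (homOfLE (X.basicOpen_le a.det)).op (m j))) =
        a.map (X.presheaf.map (homOfLE (X.basicOpen_le a.det)).op).hom := by
    ext j i
    refine congrFun ((he.restrict (X.basicOpen_le a.det)).coord_eq le_rfl ?_) i
    refine (linComb_map e _ le_rfl _).trans ?_
    refine (map_linComb e le_rfl _ _).symm.trans ?_
    exact congrArg _ (he.linComb_coord le_rfl (m j))
  rw [h3]
  have h4 := RingHom.map_det (X.presheaf.map (homOfLE (X.basicOpen_le a.det)).op).hom a
  exact h4 ▸ RingedSpace.isUnit_res_basicOpen _ a.det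

end IsLocalBasis

/-- If the values at `x` of the invariant sections span the fibre of `M`, then there is a basis of
invariant sections on a stable neighbourhood of `x`. -/
theorem IsGeometricQuotient.exists_isLocalBasis_of_span [Finite G] (hq : IsGeometricQuotient ρ q)
    (α : EquivariantStructure ρ M) {W : Y.Opens} {hDV : D ≤ q ⁻¹ᵁ W} {e : Fin r → Γ(M, D)}
    (he : IsLocalBasis e) {x : X} (hx : x ∈ D)
    (hspan : Submodule.span (X.residueField x)
      {v : Fin r → X.residueField x | ∃ m : Γ(M, q ⁻¹ᵁ W),
        (∀ g, moduleSectionsMap α (hq.invariant.isStable_preimage W) g m = m) ∧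
          he.valueAt hx (M.presheaf.map (homOfLE hDV).op m) = v} = ⊤) :
    ∃ W' : Y.Opens, q x ∈ W' ∧ ∃ m : Fin r → Γ(M, q ⁻¹ᵁ W'),
      (∀ g j, moduleSectionsMap α (hq.invariant.isStable_preimage W') g (m j) = m j) ∧
        IsLocalBasis m := by
  let b := Module.Basis.ofSpan hspan.ge
  let b' := b.reindex (b.indexEquiv (Pi.basisFun (X.residueField x) (Fin r)))
  have hb' : ∀ j, ∃ m : Γ(M, q ⁻¹ᵁ W),
      (∀ g, moduleSectionsMap α (hq.invariant.isStable_preimage W) g m = m) ∧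
        he.valueAt hx (M.presheaf.map (homOfLE hDV).op m) = b' j := fun j => by
    refine Module.Basis.ofSpan_subset hspan.ge ?_
    rw [Module.Basis.reindex_apply]
    exact Set.mem_range_self _
  choose m hm hmb using hb'
  obtain ⟨D', hD', hxD', hbD'⟩ := he.exists_restrict hx
    (fun j => M.presheaf.map (homOfLE hDV).op (m j)) (by
      simp only [hmb]
      exact b'.linearIndependent)
  simp only [map_map] at hbD'
  -- the largest open subset over which the sections are a basis; it is stable, hence an inverse
  -- image
  let O : X.Opens := sSup {U | ∃ hU : U ≤ q ⁻¹ᵁ W,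
    IsLocalBasis fun j => M.presheaf.map (homOfLE hU).op (m j)}
  have hV := hq.invariant.isStable_preimage W
  have hO : IsStable ρ O := by
    intro g y hy
    obtain ⟨U, ⟨hU, hbU⟩, hyU⟩ := TopologicalSpace.Opens.mem_sSup.mp hy
    have hU' : (ρ g⁻¹).hom ⁻¹ᵁ U ≤ q ⁻¹ᵁ W :=
      ((ρ g⁻¹).hom.preimage_mono hU).trans (hV.preimage_eq g⁻¹).le
    refine TopologicalSpace.Opens.mem_sSup.mpr ⟨(ρ g⁻¹).hom ⁻¹ᵁ U,
      ⟨hU', hbU.preimage α hV g⁻¹ (fun j => hm j g⁻¹) hU hU'⟩, ?_⟩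
    have h1 := preimage_preimage_eq (ρ := ρ) (inv_mul_cancel g) U
    exact h1.ge hyU
  obtain ⟨W', hW', -⟩ := hq.exists_opens_preimage_eq hO
  have hle : q ⁻¹ᵁ W' ≤ q ⁻¹ᵁ W := hW'.ge.trans (sSup_le fun U hU => hU.1)
  refine ⟨W', ?_, fun j => M.presheaf.map (homOfLE hle).op (m j), fun g j => ?_,
    IsLocalBasis.of_forall_exists fun y hy => ?_⟩
  · exact hW'.le (TopologicalSpace.Opens.mem_sSup.mpr ⟨D', ⟨hD'.trans hDV, hbD'⟩, hxD'⟩)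
  · rw [moduleSectionsMap_map α hV, hm]
  · obtain ⟨U, hU, hyU⟩ := TopologicalSpace.Opens.mem_sSup.mp (hW'.ge hy)
    refine ⟨U, (le_sSup hU).trans hW'.le, hyU, ?_⟩
    simp only [map_map]
    exact hU.2

end InvariantBasis


/-! ### Invariant bases of equivariant locally free modules -/

section InvariantBases

open Scheme.Modules hiding pullback

variable {G : Type v} [Group G] [Finite G] {X Y Z T : Scheme.{u}} {ρ : G →* Aut X} {M : X.Modules}
  {V D : X.Opens} {r : ℕ} {q : X ⟶ Y} {n : ℕ} {χ : G →* Γ(X, ⊤)} {ι : Z ⟶ X}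

omit [Group G] [Finite G] in
/-- Two sections with the same image in `ι^* M` have the same coordinates along `ι`. -/
lemma IsLocalBasis.app_coord_eq_of_unit_app_eq {e : Fin r → Γ(M, V)} (he : IsLocalBasis e)
    (j : T ⟶ Z) (hj : ⊤ ≤ (j ≫ ι) ⁻¹ᵁ V) {m m' : Γ(M, V)}
    (h : ((pullbackPushforwardAdjunction ι).unit.app M).app V m =
      ((pullbackPushforwardAdjunction ι).unit.app M).app V m') (i : Fin r) :
    (j ≫ ι).app V (he.coord le_rfl m i) = (j ≫ ι).app V (he.coord le_rfl m' i) := by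
  obtain ⟨u, hu⟩ : ∃ u : Γ(structureModule T, ⊤), u = (1 : Γ(T, ⊤)) := ⟨_, rfl⟩
  obtain ⟨D, hD⟩ := he.exists_hom (j ≫ ι) hj (structureModule T) (Pi.single i u)
  let D' : M ⟶ (pushforward ι).obj ((pushforward j).obj (structureModule T)) :=
    D ≫ (pushforwardComp j ι).inv.app _
  let φ := ((pullbackPushforwardAdjunction ι).homEquiv _ _).symm D'
  have h1 : (pullbackPushforwardAdjunction ι).unit.app M ≫ (pushforward ι).map φ = D' :=
    ((pullbackPushforwardAdjunction ι).homEquiv_unit _ _ _).symm.trans (Equiv.apply_symm_apply _ _)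
  have h2 : ∀ m, (D.app V m : Γ(T, (j ≫ ι) ⁻¹ᵁ V)) =
      (φ.app (ι ⁻¹ᵁ V) (((pullbackPushforwardAdjunction ι).unit.app M).app V m) :
        Γ(structureModule T, j ⁻¹ᵁ ι ⁻¹ᵁ V)) := fun m =>
    (congrArg (fun k => Hom.app k V m) h1).symm
  have h3 : ∀ m, (D.app V m : Γ(T, (j ≫ ι) ⁻¹ᵁ V)) = (j ≫ ι).app V (he.coord le_rfl m i) := by
    intro m
    have h4 := hD V le_rfl (he.coord le_rfl m)
    rw [he.linComb_coord] at h4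
    refine h4.trans ((Fintype.sum_eq_single i fun k hk => ?_).trans ?_)
    · rw [Pi.single_eq_of_ne hk, map_zero, smul_zero]
      rfl
    · rw [Pi.single_eq_same]
      exact (congrArg ((j ≫ ι).app V (he.coord le_rfl m i) * ·)
        ((congrArg (T.presheaf.map (homOfLE le_top).op) hu).trans
          (map_one (T.presheaf.map (homOfLE le_top).op).hom))).trans (mul_one _)
  exact (h3 m).symm.trans ((h2 m).trans ((congrArg (φ.app (ι ⁻¹ᵁ V)) h).trans
    ((h2 m').symm.trans (h3 m'))))

lemma evaluation_eq_of_app_eq {z : Z} {a b : Γ(X, V)} (hz : ι z ∈ V)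
    (h : (Z.fromSpecResidueField z ≫ ι).app V a = (Z.fromSpecResidueField z ≫ ι).app V b) :
    X.evaluation V (ι z) hz a = X.evaluation V (ι z) hz b := by
  rw [← sub_eq_zero, ← map_sub, X.evaluation_eq_zero_iff_notMem_basicOpen]
  intro hx
  let t : Spec (Z.residueField z) := IsLocalRing.closedPoint _
  have ht : (Z.fromSpecResidueField z ≫ ι) t = ι z := by
    rw [Scheme.Hom.comp_apply, Scheme.fromSpecResidueField_apply]
  have h1 : t ∈ (Z.fromSpecResidueField z ≫ ι) ⁻¹ᵁ X.basicOpen (a - b) := by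
    change (Z.fromSpecResidueField z ≫ ι) t ∈ X.basicOpen (a - b)
    rwa [ht]
  rw [Scheme.preimage_basicOpen, map_sub, h, sub_self, Scheme.basicOpen_zero] at h1
  exact h1

omit [Finite G] in
lemma natCast_card_residueField_ne_zero (hχ : IsTameCharacter ρ n χ) {x : X} (hx : x ∈ V) :
    (Nat.card G : X.residueField x) ≠ 0 := by
  have h1 := (hχ.isUnit_natCard (V := V) ⟨x⟩).map (X.evaluation V x hx).hom
  rw [map_natCast] at h1
  exact h1.ne_zero

omit [Finite G] in
lemma moduleSectionsMap_sum [Fintype G] (α : EquivariantStructure ρ M) (hV : IsStable ρ V) (g : G)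
    (m : Γ(M, V)) : moduleSectionsMap α hV g (∑ h, moduleSectionsMap α hV h m) =
      ∑ h, moduleSectionsMap α hV h m := by
  rw [map_sum]
  simp only [← moduleSectionsMap_mul]
  exact Fintype.sum_equiv (Equiv.mulRight g) _ _ fun _ => rfl

/-- Near a fixed point, the traces of the members of a basis of `M` are again a basis, if the
action on the restriction of `M` to the fixed scheme is trivial. -/
theorem IsGeometricQuotient.exists_isLocalBasis_of_isFixedScheme (hq : IsGeometricQuotient ρ q)
    (hχ : IsTameCharacter ρ n χ) [IsClosedImmersion ι] (hι : IsFixedScheme ρ ι)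
    (α : EquivariantStructure ρ M) (hM : IsLocallyFreeOfFiniteRank M)
    (hα : ∀ g, pullbackAction α hι.fixed g = 𝟙 _) (z : Z) :
    ∃ W : Y.Opens, q (ι z) ∈ W ∧ ∃ (r : ℕ) (m : Fin r → Γ(M, q ⁻¹ᵁ W)),
      (∀ g j, moduleSectionsMap α (hq.invariant.isStable_preimage W) g (m j) = m j) ∧
        IsLocalBasis m := by
  cases nonempty_fintype G
  obtain ⟨U, hxU, r, e₀, he₀⟩ := hM.exists_isLocalBasis (ι z)
  obtain ⟨W, hxW, hWU⟩ := hq.exists_preimage_le (fun g => hι.apply_eq g z) hxU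
  have hxV : ι z ∈ q ⁻¹ᵁ W := hxW
  have hV := hq.invariant.isStable_preimage W
  have he := he₀.restrict hWU
  set e := fun i => M.presheaf.map (homOfLE hWU).op (e₀ i)
  obtain ⟨W', hW', m, hm⟩ := hq.exists_isLocalBasis_of_span α (W := W) (hDV := le_rfl) he
    hxV (by
    -- As `G` acts trivially on `ι^* M`, it does not change values at the fixed point `ι z`, so the
    -- trace of a section has `|G|` times its value.
    have h1 : ∀ g m, he.valueAt hxV (moduleSectionsMap α hV g m) =
        he.valueAt hxV m := fun g m => by
      funext i
      refine evaluation_eq_of_app_eq (ι := ι) hxV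
        (he.app_coord_eq_of_unit_app_eq (ι := ι) (Z.fromSpecResidueField z) (fun t _ => ?_) ?_ i)
      · have h2 : (Z.fromSpecResidueField z ≫ ι) t = ι z := by
          rw [Scheme.Hom.comp_apply, Scheme.fromSpecResidueField_apply]
        change (Z.fromSpecResidueField z ≫ ι) t ∈ q ⁻¹ᵁ W
        rw [h2]
        exact hxW
      · refine (pullbackAction_app_unit α hι.fixed hV g m).symm.trans ?_
        rw [hα]
        rfl
    have h3 := natCast_card_residueField_ne_zero (V := q ⁻¹ᵁ W) hχ hxV
    rw [← top_le_iff, ← (Pi.basisFun (X.residueField (ι z)) (Fin r)).span_eq, Submodule.span_le]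
    rintro _ ⟨i, rfl⟩
    rw [Pi.basisFun_apply]
    refine (Submodule.smul_mem_iff _ h3).mp (Submodule.subset_span
      ⟨∑ g, moduleSectionsMap α hV g (e i), fun g => moduleSectionsMap_sum α hV g _, ?_⟩)
    rw [map_self, he.valueAt_sum]
    simp only [h1]
    rw [Finset.sum_const, Finset.card_univ, ← Nat.card_eq_fintype_card, he.valueAt_apply,
      Nat.cast_smul_eq_nsmul])
  exact ⟨W', hW', r, m, hm⟩

/-- The action of `G` on the sections of an equivariant module over a stable open subset. -/
noncomputable abbrev moduleSectionsAction (α : EquivariantStructure ρ M) (hV : IsStable ρ V) :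
    DistribMulAction G Γ(M, V) where
  smul g m := moduleSectionsMap α hV g⁻¹ m
  one_smul m := by
    change moduleSectionsMap α hV 1⁻¹ m = m
    rw [inv_one, moduleSectionsMap_one]
  mul_smul g h m := by
    change moduleSectionsMap α hV (g * h)⁻¹ m =
      moduleSectionsMap α hV g⁻¹ (moduleSectionsMap α hV h⁻¹ m)
    rw [mul_inv_rev, moduleSectionsMap_mul]
  smul_zero g := map_zero _
  smul_add g := map_add _

/-- Away from the fixed points, multiplication with powers of an invertible function of weight `1`
turns sections of arbitrary weight into invariant ones. -/
theorem IsGeometricQuotient.exists_isLocalBasis_of_not_isFixedPoint (hq : IsGeometricQuotient ρ q)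
    (hχ : IsTameCharacter ρ n χ) (hn : n.Prime) (α : EquivariantStructure ρ M)
    (hM : IsLocallyFreeOfFiniteRank M) {x : X} (hx : ¬ IsFixedPoint ρ x) :
    ∃ W : Y.Opens, q x ∈ W ∧ ∃ (r : ℕ) (m : Fin r → Γ(M, q ⁻¹ᵁ W)),
      (∀ g j, moduleSectionsMap α (hq.invariant.isStable_preimage W) g (m j) = m j) ∧
        IsLocalBasis m := by
  have := hq.isAffineHom
  obtain ⟨W, -, hW, hxW, χ', t, ht, htu⟩ :=
    hq.exists_isKummer_isUnit hχ hn hx (W₀ := ⊤) trivial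
  have hV := hq.invariant.isStable_preimage W
  let := sectionsAction ρ hV
  let := moduleSectionsAction α hV
  obtain ⟨D, hDV, r, s, hxD, hs⟩ := hM.exists_isLocalBasis_map (hW.preimage q) hxW
  obtain ⟨W', hW', m, hm⟩ := hq.exists_isLocalBasis_of_span α (W := W) (hDV := hDV) hs hxD (by
    have h3 := natCast_card_residueField_ne_zero (V := q ⁻¹ᵁ W) hχ hxW
    rw [← top_le_iff, ← (Pi.basisFun (X.residueField x) (Fin r)).span_eq, Submodule.span_le]
    rintro _ ⟨i, rfl⟩
    rw [Pi.basisFun_apply]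
    obtain ⟨w, hw, hwt⟩ := ht.isPrimitiveCharacter.exists_sum_isWeight
      (fun g a m => moduleSectionsMap_smul α hV g⁻¹ a m) (s i)
    refine (Submodule.smul_mem_iff _ h3).mp ?_
    -- The value of `|G| s i` is the sum of those of its components `w k` of weight `k`, and these
    -- are the products of the invariant sections `y` with powers of `t`.
    have h4 : (Nat.card G : X.residueField x) • Pi.single i 1 =
        ∑ k ∈ Finset.range (Nat.card G), hs.valueAt hxD (M.presheaf.map (homOfLE hDV).op (w k)) := by
      rw [← hs.valueAt_sum, ← map_sum, ← hw, Scheme.Modules.map_smul, hs.valueAt_smul,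
        hs.valueAt_apply, map_natCast, map_natCast]
    rw [h4]
    refine Submodule.sum_mem _ fun k _ => ?_
    obtain ⟨t', ht'⟩ := htu.exists_left_inv
    let y := t' ^ k • w k
    have hy : t ^ k • y = w k := by
      rw [smul_smul, ← mul_pow, mul_comm, ht', one_pow, one_smul]
    have hyinv : ∀ g : G, g • y = y := fun g => by
      have h5 : g • t ^ k • y = (g • t) ^ k • g • y := by
        rw [← smul_pow']
        exact moduleSectionsMap_smul α hV g⁻¹ _ _
      have h6 := hwt k g
      rw [← hy, h5, smul_smul, ← mul_pow, ht.isWeight g, pow_one, smul_eq_mul] at h6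
      exact (((((χ'.toHomUnits g).isUnit).mul htu).pow k).smul_left_cancel).mp h6
    rw [← hy, Scheme.Modules.map_smul, hs.valueAt_smul]
    refine Submodule.smul_mem _ _ (Submodule.subset_span ⟨y, fun g => ?_, rfl⟩)
    have h7 := hyinv g⁻¹
    change moduleSectionsMap α hV g⁻¹⁻¹ y = y at h7
    rwa [inv_inv] at h7)
  exact ⟨W', hW', r, m, hm⟩

end InvariantBases


/-! ### Descent of equivariant locally free modules -/

section Descent

open Scheme.Modules hiding pullback

variable {G : Type v} [Group G] [Finite G] {X Y Z : Scheme.{u}} {ρ : G →* Aut X} {M P : X.Modules}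
  {V : X.Opens} {r : ℕ} {q : X ⟶ Y} {n : ℕ} {χ : G →* Γ(X, ⊤)} {ι : Z ⟶ X}

omit [Group G] [Finite G] in
lemma isIso_of_forall_exists_bijective {φ : P ⟶ M}
    (h : ∀ x : X, ∃ V : X.Opens, x ∈ V ∧ ∀ V' ≤ V, Function.Bijective (φ.app V')) : IsIso φ := by
  rw [Hom.isIso_iff_isIso_app]
  intro U
  choose V hxV hV using h
  have hinj : ∀ U, Function.Injective (φ.app U) := fun U a b hab =>
    section_ext P fun x hx => ⟨V x ⊓ U, inf_le_right, ⟨hxV x, hx⟩, (hV x _ inf_le_left).1 (by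
      rw [map_app, map_app, hab])⟩
  refine ConcreteCategory.isIso_iff_bijective _ |>.mpr ⟨hinj U, fun m => ?_⟩
  choose b hb using fun x : X => (hV x (V x ⊓ U) inf_le_left).2
    (M.presheaf.map (homOfLE inf_le_right).op m)
  obtain ⟨c, hc⟩ := exists_glue_sections P (U := U) (D := fun x : X => V x ⊓ U)
    (fun _ => inf_le_right)
    (fun x hx => TopologicalSpace.Opens.mem_iSup.mpr ⟨x, hxV x, hx⟩) b fun x y => hinj _ (by
      rw [map_app, map_app, hb, hb, map_map, map_map])
  exact ⟨c, section_ext M fun x hx => ⟨V x ⊓ U, inf_le_right, ⟨hxV x, hx⟩, by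
    rw [← map_app, hc, hb]⟩⟩

omit [Group G] [Finite G] in
lemma injective_map_of_ge (M : X.Modules) {U U' : X.Opens} (h : U ≤ U') (h' : U' ≤ U) :
    Function.Injective (M.presheaf.map (homOfLE h').op) :=
  Function.LeftInverse.injective (g := M.presheaf.map (homOfLE h).op) fun m => by
    rw [map_map, map_self]

lemma pullbackInvariantsMap_app_unit (α : EquivariantStructure ρ M) (hq : IsInvariant ρ q)
    (W : Y.Opens) (k : Γ(invariants (pushforwardAction α hq), W)) :
    (pullbackInvariantsMap α hq).app (q ⁻¹ᵁ W)
      (((pullbackPushforwardAdjunction q).unit.app _).app W k) =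
        ((invariantsι (pushforwardAction α hq)).app W k : Γ(M, q ⁻¹ᵁ W)) := by
  have h1 : (pullbackPushforwardAdjunction q).unit.app _ ≫
      (pushforward q).map (pullbackInvariantsMap α hq) = invariantsι (pushforwardAction α hq) :=
    ((pullbackPushforwardAdjunction q).homEquiv_unit _ _ _).symm.trans (Equiv.apply_symm_apply _ _)
  exact congrArg (fun φ => Hom.app φ W k) h1

omit [Finite G] in
/-- The coordinates of an invariant section in a basis of invariant sections are invariant. -/
lemma IsLocalBasis.sectionsMap_coord (α : EquivariantStructure ρ M) {e : Fin r → Γ(M, V)}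
    (he : IsLocalBasis e) (hV : IsStable ρ V) {g : G} (hg : ∀ j, moduleSectionsMap α hV g (e j) = e j)
    {V' : X.Opens} (h : V' ≤ V) (hV' : IsStable ρ V') {m : Γ(M, V')}
    (hm : moduleSectionsMap α hV' g m = m) (i : Fin r) :
    sectionsMap ρ hV' g (he.coord h m i) = he.coord h m i := by
  refine (congrFun (he.coord_eq h (c := fun i => sectionsMap ρ hV' g (he.coord h m i)) ?_) i).symm
  conv_rhs => rw [← hm, ← he.linComb_coord h m, linComb, map_sum]
  refine Finset.sum_congr rfl fun j _ => ?_
  rw [moduleSectionsMap_smul, moduleSectionsMap_map α hV, hg]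

/-- If `M` has a basis of invariant sections over `q ⁻¹ W`, then `q^* (q_* M)^G ⟶ M` is an
isomorphism there. The inverse is constructed from the basis. -/
theorem IsGeometricQuotient.bijective_pullbackInvariantsMap_app (hq : IsGeometricQuotient ρ q)
    (α : EquivariantStructure ρ M) {W : Y.Opens} {m : Fin r → Γ(M, q ⁻¹ᵁ W)}
    (hm : ∀ g j, moduleSectionsMap α (hq.invariant.isStable_preimage W) g (m j) = m j)
    (hb : IsLocalBasis m) {V' : X.Opens} (h : V' ≤ q ⁻¹ᵁ W) :
    Function.Bijective ((pullbackInvariantsMap α hq.invariant).app V') := by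
  set a := pushforwardAction α hq.invariant
  set c := pullbackInvariantsMap α hq.invariant
  set η := (pullbackPushforwardAdjunction q).unit.app (invariants a)
  let P := (Scheme.Modules.pullback q).obj (invariants a)
  choose k hk using fun j => exists_invariantsι_app_eq a (U := W) (m j) fun g => hm g j
  let p : Fin r → Γ(P, q ⁻¹ᵁ W) := fun j => η.app W (k j)
  have hp : ∀ j, c.app (q ⁻¹ᵁ W) (p j) = m j := fun j =>
    (pullbackInvariantsMap_app_unit α hq.invariant W (k j)).trans (hk j)
  constructor
  swap
  · intro s
    refine ⟨linComb p h (hb.coord h s), ?_⟩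
    rw [app_linComb]
    simp only [hp]
    exact hb.linComb_coord h s
  -- For injectivity, a left inverse `D` over `q ⁻¹ W` sends the basis `m` to the sections `p`.
  set j := (q ⁻¹ᵁ W).ι
  have hj : ⊤ ≤ j ⁻¹ᵁ (q ⁻¹ᵁ W) := by simp [j]
  let θ : P ⟶ (pushforward j).obj (P.restrict j) := (restrictAdjunction j).unit.app P
  obtain ⟨D, hD⟩ := hb.exists_hom j hj (P.restrict j) fun i =>
    (P.restrict j).presheaf.map (homOfLE hj).op (θ.app (q ⁻¹ᵁ W) (p i))
  -- the two morphisms agree on linear combinations of the sections `p i`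
  have hE : ∀ (O : X.Opens) (hO : O ≤ q ⁻¹ᵁ W) (d : Fin r → Γ(X, O)),
      D.app O (c.app O (linComb p hO d)) = θ.app O (linComb p hO d) := fun O hO d => by
    rw [app_linComb c]
    simp only [hp]
    refine (hD O hO d).trans ?_
    refine Eq.trans ?_ (app_linComb θ p hO d).symm
    refine Finset.sum_congr rfl fun i _ => ?_
    exact congrArg (fun y : Γ(P.restrict j, j ⁻¹ᵁ O) => j.app O (d i) • y)
      (map_map (P.restrict j) le_top hj (θ.app (q ⁻¹ᵁ W) (p i)))
  have hcomp : c ≫ D = θ := by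
    refine pullback_hom_ext fun U b => ?_
    have hQ : Function.Injective (((pushforward j).obj (P.restrict j)).presheaf.map
        (homOfLE (q.preimage_mono (inf_le_left : U ⊓ W ≤ U))).op) := by
      have hle : j ⁻¹ᵁ q ⁻¹ᵁ U ≤ j ⁻¹ᵁ q ⁻¹ᵁ (U ⊓ W) := fun y hy => ⟨hy, hj (x := y) trivial⟩
      refine injective_map_of_ge (P.restrict j) hle (j.preimage_mono (q.preimage_mono inf_le_left))
    -- Both sides are determined by the restriction `b'` of `b` to `U ⊓ W`, which is a combination
    -- of the sections `k i` with coefficients in `𝒪_Y`.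
    refine hQ ((map_app _ _ _).symm.trans (Eq.trans ?_ (map_app _ _ _)))
    let b' := (invariants a).presheaf.map (homOfLE (inf_le_left : U ⊓ W ≤ U)).op b
    let s : Γ(M, q ⁻¹ᵁ (U ⊓ W)) := (invariantsι a).app (U ⊓ W) b'
    have hWs : q ⁻¹ᵁ (U ⊓ W) ≤ q ⁻¹ᵁ W := q.preimage_mono inf_le_right
    have hs : ∀ g, moduleSectionsMap α (hq.invariant.isStable_preimage (U ⊓ W)) g s = s := fun g =>
      congrArg (fun φ => Hom.app φ (U ⊓ W) b') (invariantsι_comp a g)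
    choose d hd using fun i => (hq.sections (U ⊓ W)).exists_app_eq (hb.coord hWs s i) fun g =>
      hb.sectionsMap_coord α (hq.invariant.isStable_preimage W) (hm g) hWs _ (hs g) i
    have hb' : b' = linComb k inf_le_right d := by
      refine invariantsι_app_injective a _ ?_
      rw [app_linComb]
      simp only [hk]
      refine (hb.linComb_coord hWs s).symm.trans ?_
      refine Finset.sum_congr rfl fun i _ => ?_
      rw [← hd]
      rfl
    have hη : (η.app (U ⊓ W) b' : Γ(P, q ⁻¹ᵁ (U ⊓ W))) =
        linComb p hWs fun i => q.app (U ⊓ W) (d i) := by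
      rw [hb']
      exact app_linComb η k inf_le_right d
    have hη' : P.presheaf.map (homOfLE (q.preimage_mono (inf_le_left : U ⊓ W ≤ U))).op
        (η.app U b) = η.app (U ⊓ W) b' := (map_app η inf_le_left b).symm
    have hx := hE (q ⁻¹ᵁ (U ⊓ W)) hWs fun i => q.app (U ⊓ W) (d i)
    rw [← hη, ← hη'] at hx
    exact hx
  have hθ : Function.Injective (θ.app V') := by
    refine injective_map_of_ge P (U := V') (U' := j ''ᵁ j ⁻¹ᵁ V') ?_ (j.image_preimage_le V')
    rw [Scheme.Hom.image_preimage_eq_opensRange_inf, Scheme.Opens.opensRange_ι]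
    exact le_inf h le_rfl
  intro s t hst
  refine hθ ?_
  have h1 : ∀ s, θ.app V' s = D.app V' (c.app V' s) := fun s =>
    (congrArg (fun φ => Hom.app φ V' s) hcomp).symm
  rw [h1, h1, hst]

/-- An equivariant locally free module descends to the quotient if its restriction to the fixed
scheme carries the trivial action. -/
theorem IsGeometricQuotient.isIso_pullbackInvariantsMap (hq : IsGeometricQuotient ρ q)
    (hχ : IsTameCharacter ρ n χ) (hn : n.Prime) [IsClosedImmersion ι] (hι : IsFixedScheme ρ ι)
    (α : EquivariantStructure ρ M) (hM : IsLocallyFreeOfFiniteRank M)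
    (hα : ∀ g, pullbackAction α hι.fixed g = 𝟙 _) :
    IsIso (pullbackInvariantsMap α hq.invariant) := by
  refine isIso_of_forall_exists_bijective fun x => ?_
  obtain ⟨W, hxW, r, m, hm, hb⟩ : ∃ W : Y.Opens, q x ∈ W ∧ ∃ (r : ℕ) (m : Fin r → Γ(M, q ⁻¹ᵁ W)),
      (∀ g j, moduleSectionsMap α (hq.invariant.isStable_preimage W) g (m j) = m j) ∧
        IsLocalBasis m := by
    by_cases hx : x ∈ Set.range ι
    · obtain ⟨z, rfl⟩ := hx
      exact hq.exists_isLocalBasis_of_isFixedScheme hχ hι α hM hα z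
    · exact hq.exists_isLocalBasis_of_not_isFixedPoint hχ hn α hM (hι.not_isFixedPoint hx)
  exact ⟨q ⁻¹ᵁ W, hxW, fun V' h => hq.bijective_pullbackInvariantsMap_app α hm hb h⟩

end Descent

end EquivariantScheme

theorem proposition2p5 {G : Type v} [Group G] [Finite G] {S X : Scheme.{u}} [IsNoetherian S]
    (f : X ⟶ S) [IsSeparated f] [LocallyOfFiniteType f] [QuasiCompact f]
    (ρ : G →* Aut X) (hf : IsInvariant ρ f) (horb : OrbitsInAffineOpens ρ)
    (n : ℕ) (hn : 0 < n) (hG : ConstantGroupIsoMu G n S)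
    {XG : Scheme.{u}} (ι : XG ⟶ X) [IsClosedImmersion ι] (hι : IsFixedScheme ρ ι)
    {Y : Scheme.{u}} (q : X ⟶ Y) (hq : IsCategoricalQuotient ρ q) :
    (n.Prime → IsCartierDivisor ι → Flat q) ∧
    (IsCartierDivisor ι → IsZero (invariants (conormalAction ρ ι hι.fixed))) ∧
    (IsClosedImmersion (ι ≫ q) ∧ q ⁻¹' (q '' Set.range ι) = Set.range ι ∧
      ∃ (V : Y.Opens) (hV : complement ι ≤ q ⁻¹ᵁ V), (V : Set Y) = (q '' Set.range ι)ᶜ ∧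
        IsCategoricalQuotient (complementAction ρ ι hι) (q.resLE V (complement ι) hV)) ∧
    (n.Prime → ∀ (W : Scheme.{u}) (r : (complement ι : Scheme.{u}) ⟶ W)
      (hr : IsCategoricalQuotient (complementAction ρ ι hι) r),
        IsIso (torsorMap (complementAction ρ ι hι) r hr.invariant)) ∧
    (∀ (M : X.Modules) (α : EquivariantStructure ρ M), IsLocallyFreeOfFiniteRank M →
      (∀ g : G, pullbackAction α hι.fixed g = 𝟙 _) → Flat q → n.Prime →
        IsIso (pullbackInvariantsMap α hq.invariant)) ∧
    (Smooth f → Flat (ι ≫ f) → Smooth (ι ≫ f)) ∧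
    (n.Prime → Smooth f → IsCartierDivisor ι → Flat (ι ≫ f) →
      ∀ h : Y ⟶ S, q ≫ h = f → Smooth h) := by
  have hgeom := hq.isGeometricQuotient_of_orbits f hf horb
  obtain ⟨χ, hχ⟩ := hG.exists_isTameCharacter hn hf
  obtain ⟨h, hh, -⟩ := hq.existsUnique_desc S f hf
  refine ⟨fun hn hcar => hgeom.flat hχ hn hι hcar,
    fun _ => isZero_invariants_conormalAction hgeom hχ hι,
    ⟨hι.isClosedImmersion_comp hgeom hχ, hι.preimage_image hgeom, ?_⟩,
    fun hn W r hr => hι.isIso_torsorMap hgeom (fun j ρ' hρ' => ?_) hn hr,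
    fun M α hM hα _ hn => hgeom.isIso_pullbackInvariantsMap hχ hn hι α hM hα,
    fun _ _ => IsFixedScheme.smooth hgeom hχ hι hh,
    fun hn _ hcar _ h hh => hgeom.smooth hχ hn hι hcar hh⟩
  · obtain ⟨V, hV, hVq, hqV⟩ := hι.exists_quotient_complement hgeom
    exact ⟨V, hV, hVq, hqV.isCategoricalQuotient⟩
  · exact hG.exists_isTameCharacter hn.pos (f := j ≫ f) fun g => by
      rw [← Category.assoc, hρ' g, Category.assoc, hf g]
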